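/- A graph database over a finite alphabet $\Sigma$ is a pair $\mathcal G=(V,E)$ with a finite set $V$ of nodes and a set $E\subseteq V\times\Sigma\times V$ of labelled edges. A path in $\mathcal G$ is a sequence $v_0a_1v_1\cdots a_kv_k$, $k\ge 0$, with $(v_{i-1},a_i,v_i)\in E$ for $1\le i\le k$; its label is the word $a_1\cdots a_k$. For a regular expression $L$ over $\Sigma$, $L(\mathcal G)$ is the set of pairs $(v,v')$ such that some path from $v$ to $v'$ has a label in the language of $L$. A conjunctive regular path query (CRPQ) is an expression $\gamma(\bar x)=\exists\bar z\,\big(L_1(x_1,y_1)\wedge\dots\wedge L_m(x_m,y_m)\big)$, where the $L_i$ are regular expressions over $\Sigma$, the $x_i,y_i$ are variables, and the tuple $\bar x$ of free variables consists of variables among $x_1,y_1,\dots,x_m,y_m$, the others being existentially quantified. Its evaluation $\gamma(\mathcal G)$ is the set of the tuples $h(\bar x)$ for all maps $h$ from its variables to $V$ with $(h(x_i),h(y_i))\in L_i(\mathcal G)$ for all $i$. CRPQ-query-by-example is the following problem: given a finite alphabet $\Sigma$, a graph database $\mathcal G$ over $\Sigma$, and $n$-ary relations $S^+$ and $S^-$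 over the nodes of $\mathcal G$ (all given explicitly; $n$ is part of the input), is there a CRPQ $\gamma$ over $\Sigma$ with $S^+\subseteq\gamma(\mathcal G)$ and $\gamma(\mathcal G)\cap S^-=\emptyset$? CRPQ-definability is the problem: given $\Sigma$, $\mathcal G$ and an $n$-ary relation $S^+$ over the nodes of $\mathcal G$, is there a CRPQ $\gamma$ over $\Sigma$ with $\gamma(\mathcal G)=S^+$? Theorem. CRPQ-query-by-example and CRPQ-definability are in coNEXPTIME, i.e. the complement of each of the two problems is accepted by a nondeterministic Turing machine in time $2^{p(\ell)}$ on inputs of length $\ell$, for some polynomial $p$. -/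

import Mathlib

/-! ### Nondeterministic exponential time -/

/-- A nondeterministic Turing machine with input alphabet `α`: finitely many two-way infinite tapes,
a finite tape alphabet whose blank symbol is `default`, finitely many states, and a transition
relation that, from the current state and the symbols under the heads, offers a set of moves: a new
state and, for every tape, a symbol to write and a direction (`none`: the head stays). -/
structure NTM (α : Type) where
  /-- the states -/
  Q : Type
  /-- the tapes -/
  K : Type
  /-- the tape alphabet -/
  Γ : Type
  [finQ : Fintype Q]
  [finK : Fintype K]
  [decK : DecidableEq K]
  [finΓ : Fintype Γ]
  [blank : Inhabited Γ]
  /-- the tape that initially carries the input -/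
  inputTape : K
  /-- the representation of the input letters by non-blank tape symbols -/
  letter : α → Γ
  letter_injective : Function.Injective letter
  letter_ne_blank : ∀ a, letter a ≠ default
  /-- the initial state -/
  start : Q
  /-- the accepting states -/
  accept : Set Q
  /-- the transition relation -/
  trans : Q → (K → Γ) → Set (Q × (K → Γ × Option Turing.Dir))

namespace NTM

variable {α : Type}

attribute [instance] NTM.finQ NTM.finK NTM.decK NTM.finΓ NTM.blank

/-- A configuration: the state and the tapes with their head positions. -/
structure Cfg (M : NTM α) where
  state : M.Q
  tape : M.K → Turing.Tape M.Γ

/-- Write a symbol under the head and then move the head. -/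
def act {Γ : Type} [Inhabited Γ] (x : Γ × Option Turing.Dir) (T : Turing.Tape Γ) : Turing.Tape Γ :=
  match x.2 with
  | none => T.write x.1
  | some d => (T.write x.1).move d

/-- `c'` is a successor configuration of `c`. -/
def Step (M : NTM α) (c c' : M.Cfg) : Prop :=
  ∃ x ∈ M.trans c.state (fun k => (c.tape k).head),
    c' = ⟨x.1, fun k => act (x.2 k) (c.tape k)⟩

/-- The initial configuration: the input word on the input tape with the head on its first letter,
all other tapes blank. -/
def init (M : NTM α) (w : List α) : M.Cfg :=
  ⟨M.start, fun k => if k = M.inputTape then Turing.Tape.mk₁ (w.map M.letter)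
    else Turing.Tape.mk₁ []⟩

/-- Some computation from the configuration reaches an accepting state in at most `t` steps. -/
def AcceptsWithin (M : NTM α) : ℕ → M.Cfg → Prop
  | 0, c => c.state ∈ M.accept
  | t + 1, c => c.state ∈ M.accept ∨ ∃ c', M.Step c c' ∧ AcceptsWithin M t c'

end NTM

/-- Nondeterministic exponential time: the languages accepted by a nondeterministic Turing machine
such that, for some polynomial `p`, every accepted word of length `n` has an accepting computation
of at most `2 ^ p(n)` steps. -/
def NEXP (α : Type) : Set (Language α) :=
  {L | ∃ (M : NTM α) (p : Polynomial ℕ), ∀ w : List α,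
    (w ∈ L → M.AcceptsWithin (2 ^ p.eval w.length) (M.init w)) ∧
    (w ∉ L → ∀ t, ¬ M.AcceptsWithin t (M.init w))}

/-- The languages whose complement (among all words over the alphabet) is in `NEXP`. -/
def coNEXP (α : Type) : Set (Language α) :=
  {L | Lᶜ ∈ NEXP α}

/-! ### Graph databases and conjunctive regular path queries -/

/-- A graph database with node set `V` over the alphabet `A`: a set of labelled directed edges. -/
structure GraphDB (V A : Type) where
  edge : Set (V × A × V)

namespace GraphDB

variable {V A : Type}

/-- `G.HasPath v w v'`: there is a path in `G` from `v` to `v'` with label `w`. -/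
def HasPath (G : GraphDB V A) : V → List A → V → Prop
  | v, [], v' => v = v'
  | v, a :: w, v' => ∃ u, (v, a, u) ∈ G.edge ∧ HasPath G u w v'

/-- The evaluation of a regular path query: the pairs of nodes that are linked by a path whose label
satisfies the regular expression. -/
def rpq (G : GraphDB V A) (L : RegularExpression A) : Set (V × V) :=
  {x | ∃ w ∈ L.matches', G.HasPath x.1 w x.2}

end GraphDB

/-- A conjunctive regular path query `∃ z̄ (L₁(x₁, y₁) ∧ … ∧ Lₘ(xₘ, yₘ))` over the alphabet `A`
with an `n`-tuple of free variables. Its variables are those that occur in an atom; the variables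
that are not listed in `free` are the existentially quantified ones. -/
structure CRPQ (A : Type) (n : ℕ) where
  /-- the number of variables -/
  numVars : ℕ
  /-- the number of atoms -/
  numAtoms : ℕ
  /-- the regular expression of an atom -/
  expr : Fin numAtoms → RegularExpression A
  /-- the first variable of an atom -/
  src : Fin numAtoms → Fin numVars
  /-- the second variable of an atom -/
  tgt : Fin numAtoms → Fin numVars
  /-- every variable occurs in some atom -/
  occurs : ∀ x, ∃ i, x = src i ∨ x = tgt i
  /-- the tuple of free variables -/
  free : Fin n → Fin numVars

namespace CRPQ

variable {V A : Type} {n : ℕ}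

/-- Homomorphisms from a query to a graph database. -/
def IsHom (γ : CRPQ A n) (G : GraphDB V A) (h : Fin γ.numVars → V) : Prop :=
  ∀ i, (h (γ.src i), h (γ.tgt i)) ∈ G.rpq (γ.expr i)

/-- The evaluation of a query over a graph database. -/
def eval (γ : CRPQ A n) (G : GraphDB V A) : Set (Fin n → V) :=
  {b | ∃ h, γ.IsHom G h ∧ b = fun j => h (γ.free j)}

/-- `γ` explains the positive examples `P` and the negative examples `N` over `G`. -/
def IsExplanation (γ : CRPQ A n) (G : GraphDB V A) (P N : Set (Fin n → V)) : Prop :=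
  P ⊆ γ.eval G ∧ γ.eval G ∩ N = ∅

/-- `γ` defines the relation `P` over `G`. -/
def IsDefinition (γ : CRPQ A n) (G : GraphDB V A) (P : Set (Fin n → V)) : Prop :=
  γ.eval G = P

end CRPQ

/-! ### The decision problems -/

/-- An input of the definability problem: a graph database with nodes `0, …, nodes - 1` over an
alphabet with `letters` letters, given by a list of its edges, and a relation of the given arity
over its nodes, given by a list of its tuples. -/
structure DefInput where
  nodes : ℕ
  letters : ℕ
  arity : ℕ
  edges : List (Fin nodes × Fin letters × Fin nodes)
  pos : List (Fin arity → Fin nodes)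

/-- An input of the query-by-example problem: additionally a relation of negative examples. -/
structure QBEInput extends DefInput where
  neg : List (Fin arity → Fin nodes)

/-- The graph database of an input. -/
def DefInput.graph (I : DefInput) : GraphDB (Fin I.nodes) (Fin I.letters) :=
  ⟨{e | e ∈ I.edges}⟩

/-- There is a CRPQ-definition of the given relation. -/
def DefInput.Definable (I : DefInput) : Prop :=
  ∃ γ : CRPQ (Fin I.letters) I.arity, γ.IsDefinition I.graph {t | t ∈ I.pos}

/-- There is a CRPQ-explanation for the given positive and negative examples. -/
def QBEInput.Explainable (I : QBEInput) : Prop :=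
  ∃ γ : CRPQ (Fin I.letters) I.arity, γ.IsExplanation I.graph {t | t ∈ I.pos} {t | t ∈ I.neg}

/-- The alphabet in which inputs are written down. -/
inductive InputSym where
  /-- a stroke of a unary numeral -/
  | one
  /-- the end of a numeral -/
  | sep
  /-- the start of a list entry -/
  | item
  /-- the end of a list -/
  | close
  deriving DecidableEq

namespace InputSym

instance : Fintype InputSym := ⟨{one, sep, item, close}, fun x => by cases x <;> simp⟩

/-- The name of a number, in unary (node sets and alphabets are listed explicitly in an input, so
that this is polynomially equivalent to binary names). -/
def num (m : ℕ) : List InputSym := List.replicate m one ++ [sep]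

/-- A list of edges. -/
def edgeList {N k : ℕ} (E : List (Fin N × Fin k × Fin N)) : List InputSym :=
  (E.flatMap fun e => item :: (num e.1 ++ num e.2.1 ++ num e.2.2)) ++ [close]

/-- A list of tuples. -/
def tupleList {N n : ℕ} (S : List (Fin n → Fin N)) : List InputSym :=
  (S.flatMap fun t => item :: (List.ofFn t).flatMap fun v : Fin N => num v) ++ [close]

end InputSym

/-- The word that represents an input of the definability problem. -/
def DefInput.encode (I : DefInput) : List InputSym :=
  InputSym.num I.nodes ++ InputSym.num I.letters ++ InputSym.num I.arity ++
    InputSym.edgeList I.edges ++ InputSym.tupleList I.pos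

/-- The word that represents an input of the query-by-example problem. -/
def QBEInput.encode (I : QBEInput) : List InputSym :=
  I.toDefInput.encode ++ InputSym.tupleList I.neg

/-- CRPQ-query-by-example, as a language. -/
def crpqQueryByExample : Language InputSym :=
  {w | ∃ I : QBEInput, I.Explainable ∧ I.encode = w}

/-- CRPQ-definability, as a language. -/
def crpqDefinability : Language InputSym :=
  {w | ∃ I : DefInput, I.Definable ∧ I.encode = w}

/-! ### Regular expressions denote regular languages -/

namespace Language

open scoped Computability

variable {α β : Type}

/-! Let `V` be the set of nodes and `k` the number of positive examples. Call a map `g : V^k → V`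
transferring (`GraphDB.Transfers`) if for all `u, v ∈ V^k` there is a coordinate `i` such that every
label of a path from `u i` to `v i` also labels a path from `g u` to `g v`. A tuple lies in every
CRPQ answer that contains the positive examples iff it arises by applying some transferring `g`
componentwise to those examples. Indeed, `g` applied to `k` homomorphisms of a query is again a
homomorphism (`Transfers.mem_eval`). Conversely, the canonical query with variable set `V^k` has one
atom for every non-transferring map, so that its homomorphisms are exactly transferring maps
(`exists_canonical`). Hence an input of query-by-example is negative iff some such forced tuple is a
negative example, and an input of definability is negative iff some forced tuple is not a positive
example.

The table of `g` has `|V|^k` entries, which is exponential in the input length, and can be guessed.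
Transferring quantifies over infinitely many words, but a word `w` matters only through its
endpoints and the set `T = {y | w labels a path from y to y'}`. The triples and sets that occur are
closed under prepending a letter, and there are at most `2^|V|` sets. Numbering tuples of nodes and
sets of nodes by `0, …, B` for a singly exponential `B` turns the certificate into bit arrays, and
its correctness into one fixed first-order formula over `{0, …, B}` (`Cert`, `eval_cert`; soundness
is `Cert.exists_forced`, completeness is `cert_of_transfers`). Nested loops evaluate the formula in
time polynomial in `B` (`Form.does_prog`).

Programs are regular expressions over elementary operations on counters and bit arrays. Their
languages are regular, so a finite automaton serves as the control of a Turing machine that guesses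
and executes a word of operations (`mem_NEXP_of_isRegular`). The bound `B` is guessed too: soundness
holds for every `B`, and only completeness needs a large one. The complement also contains the words
that encode nothing. Those of the wrong shape form a regular language; those with numbers out of
range are caught by the formula. -/

theorem IsRegular.mul {L M : Language α} (hL : L.IsRegular) (hM : M.IsRegular) :
    (L * M).IsRegular := by
  apply IsRegular.of_finite_range_leftQuotient
  have h1 := hL.finite_range_leftQuotient
  have h2 := hM.finite_range_leftQuotient
  -- By Myhill–Nerode it suffices that there are finitely many left quotients. The quotient of `L *
  -- M` by `x` depends only on the quotient of `L` by `x` and on the set of quotients of `M` by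
  -- those `b` with `x = a ++ b`, `a ∈ L`.
  let F : Language α × Set (Language α) → Language α :=
    fun p => p.1 * M + (show Language α from {x | ∃ K ∈ p.2, x ∈ K})
  refine ((h1.prod h2.finite_subsets).image F).subset ?_
  rintro _ ⟨x, rfl⟩
  refine ⟨(L.leftQuotient x, {K | ∃ a ∈ L, ∃ b, a ++ b = x ∧ K = M.leftQuotient b}),
    ⟨⟨x, rfl⟩, ?_⟩, ?_⟩
  · rintro _ ⟨a, -, b, -, rfl⟩
    exact ⟨b, rfl⟩
  · ext y
    simp only [F, mem_mul, mem_leftQuotient]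
    constructor
    · rintro (⟨a, ha, b, hb, rfl⟩ | ⟨K, ⟨a, ha, b, rfl, rfl⟩, hy⟩)
      · exact ⟨x ++ a, ha, b, hb, by simp⟩
      · exact ⟨a, ha, b ++ y, hy, by simp⟩
    · rintro ⟨a, ha, b, hb, hab⟩
      rcases List.append_eq_append_iff.1 hab with ⟨c, rfl, rfl⟩ | ⟨c, rfl, rfl⟩
      · exact Or.inr ⟨_, ⟨a, ha, c, rfl, rfl⟩, hb⟩
      · exact Or.inl ⟨c, ha, b, hb, rfl⟩

theorem append_mem_kstar {L : Language α} {a b : List α} (ha : a ∈ L∗) (hb : b ∈ L∗) :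
    a ++ b ∈ L∗ := by
  rw [mem_kstar] at *
  obtain ⟨l, rfl, hl⟩ := ha
  obtain ⟨m, rfl, hm⟩ := hb
  refine ⟨l ++ m, by simp, fun y hy => ?_⟩
  rcases List.mem_append.1 hy with h | h
  · exact hl y h
  · exact hm y h

theorem cons_mem_kstar {L : Language α} {a b : List α} (ha : a ∈ L) (hb : b ∈ L∗) :
    a ++ b ∈ L∗ :=
  append_mem_kstar (mem_kstar.2 ⟨[a], by simp, by simpa⟩) hb

/-- Unless `x` is empty, some factor `b ++ c` of the decomposition covers the last letter of `x`,
and the cut between `x` and `y` splits it. This shows that a quotient of the star is determined by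
quotients of `L`. -/
theorem append_mem_kstar_iff {L : Language α} {x y : List α} :
    x ++ y ∈ L∗ ↔ (x = [] ∧ y ∈ L∗) ∨
      ∃ a ∈ L∗, ∃ b, a ++ b = x ∧ ∃ c d, b ++ c ∈ L ∧ d ∈ L∗ ∧ c ++ d = y := by
  constructor
  · rw [mem_kstar]
    rintro ⟨l, hl, h⟩
    induction l generalizing x with
    | nil =>
      simp only [List.flatten_nil, List.append_eq_nil_iff] at hl
      obtain ⟨rfl, rfl⟩ := hl
      exact Or.inl ⟨rfl, nil_mem_kstar L⟩
    | cons a l ih =>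
      simp only [List.flatten_cons] at hl
      have hl' : l.flatten ∈ L∗ := mem_kstar.2 ⟨l, rfl, fun y hy => h y (by simp [hy])⟩
      have ha : a ∈ L := h a (by simp)
      rcases List.append_eq_append_iff.1 hl with ⟨c, rfl, rfl⟩ | ⟨c, rfl, hc⟩
      · exact Or.inr ⟨[], nil_mem_kstar L, x, rfl, c, _, ha, hl', rfl⟩
      · rcases ih hc.symm (fun y hy => h y (by simp [hy])) with
          ⟨rfl, hy⟩ | ⟨a', ha', b, rfl, c', d, hb, hd, rfl⟩
        · refine Or.inr ⟨[], nil_mem_kstar L, a, by simp, [], y, by simpa using ha, hy, rfl⟩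
        · exact Or.inr ⟨a ++ a', cons_mem_kstar ha ha', b, by simp, c', d, hb, hd, rfl⟩
  · rintro (⟨rfl, hy⟩ | ⟨a, ha, b, rfl, c, d, hb, hd, rfl⟩)
    · simpa
    · have := append_mem_kstar ha (cons_mem_kstar hb hd)
      simpa using this

theorem IsRegular.kstar {L : Language α} (hL : L.IsRegular) : (L∗).IsRegular := by
  apply IsRegular.of_finite_range_leftQuotient
  have h1 := hL.finite_range_leftQuotient
  let F : Prop × Set (Language α) → Language α :=
    fun p => (show Language α from {y | p.1 ∧ y ∈ L∗}) +
      (show Language α from {y | ∃ K ∈ p.2, y ∈ K * L∗})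
  refine (((Set.finite_univ (α := Prop)).prod h1.finite_subsets).image F).subset ?_
  rintro _ ⟨x, rfl⟩
  refine ⟨(x = [], {K | ∃ a ∈ L∗, ∃ b, a ++ b = x ∧ K = L.leftQuotient b}),
    ⟨trivial, ?_⟩, ?_⟩
  · rintro _ ⟨a, -, b, -, rfl⟩
    exact ⟨b, rfl⟩
  · ext y
    rw [mem_leftQuotient, append_mem_kstar_iff]
    simp only [F]
    refine or_congr Iff.rfl ?_
    constructor
    · rintro ⟨_, ⟨a, ha, b, rfl, rfl⟩, hy⟩
      obtain ⟨c, hc, d, hd, rfl⟩ := mem_mul.1 hy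
      exact ⟨a, ha, b, rfl, c, d, hc, hd, rfl⟩
    · rintro ⟨a, ha, b, rfl, c, d, hc, hd, rfl⟩
      exact ⟨_, ⟨a, ha, b, rfl, rfl⟩, append_mem_mul hc hd⟩

/-- A quotient by a word in the image of `f` is the image of a quotient, by injectivity; a quotient
by any other word is empty. It is applied to the words of `read` operations. -/
theorem IsRegular.map {L : Language α} (hL : L.IsRegular) {f : α → β}
    (hf : Function.Injective f) : (Language.map f L).IsRegular := by
  apply IsRegular.of_finite_range_leftQuotient
  have h1 := hL.finite_range_leftQuotient
  refine ((h1.image (Language.map f)).union (Set.finite_singleton (0 : Language β))).subset ?_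
  rintro _ ⟨x, rfl⟩
  by_cases hx : ∃ y : List α, x = y.map f
  · obtain ⟨y, rfl⟩ := hx
    refine Or.inl ⟨_, ⟨y, rfl⟩, ?_⟩
    ext z
    constructor
    · rintro ⟨u, hu, rfl⟩
      exact ⟨y ++ u, hu, by simp⟩
    · rintro ⟨u, hu, hz⟩
      obtain ⟨a, b, rfl, ha, rfl⟩ := List.map_eq_append_iff.1 hz
      obtain rfl := (List.map_injective_iff.2 hf) ha
      exact ⟨b, hu, rfl⟩
  · right
    ext z
    refine ⟨fun ⟨u, hu, hz⟩ => (hx ?_).elim, fun h => h.elim⟩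
    obtain ⟨a, b, rfl, ha, rfl⟩ := List.map_eq_append_iff.1 hz
    exact ⟨a, ha.symm⟩

theorem isRegular_of_finite {L : Language α} (hL : Set.Finite (L : Set (List α))) :
    L.IsRegular := by
  apply IsRegular.of_finite_range_leftQuotient
  have : (Set.Finite {x : List α | ∃ y ∈ L, x <:+ y}) := by
    have : {x : List α | ∃ y ∈ L, x <:+ y} = ⋃ y ∈ (L : Set (List α)), {x | x ∈ y.tails} := by
      ext x; simp
    rw [this]
    exact hL.biUnion fun y _ => y.tails.finite_toSet
  refine this.finite_subsets.subset ?_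
  rintro _ ⟨x, rfl⟩ y hy
  exact ⟨x ++ y, hy, x, rfl⟩

end Language

/-- This is what turns a program, written as a regular expression over operations, into the finite
control of a machine. -/
theorem RegularExpression.isRegular_matches' {α : Type} (P : RegularExpression α) :
    P.matches'.IsRegular := by
  induction P with
  | zero => exact Language.isRegular_of_finite Set.finite_empty
  | epsilon => exact Language.isRegular_of_finite (Set.finite_singleton _)
  | char a => exact Language.isRegular_of_finite (Set.finite_singleton _)
  | plus P Q hP hQ => exact hP.add hQ
  | comp P Q hP hQ => exact hP.mul hQ
  | star P hP => exact hP.kstar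

/-! ### Executions of nondeterministic programs -/

section Programs

variable {α S : Type} {step : α → S → S → Prop}

/-- The executions of a sequence of operations. -/
def Exec (step : α → S → S → Prop) : List α → S → S → Prop
  | [], s, s' => s = s'
  | a :: l, s, s' => ∃ u, step a s u ∧ Exec step l u s'

theorem exec_append {l m : List α} {s s' : S} :
    Exec step (l ++ m) s s' ↔ ∃ u, Exec step l s u ∧ Exec step m u s' := by
  induction l generalizing s with
  | nil => simp [Exec]
  | cons a l ih =>
    simp only [List.cons_append, Exec, ih]
    constructor
    · rintro ⟨u, hu, v, hv, h⟩
      exact ⟨v, ⟨u, hu, hv⟩, h⟩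
    · rintro ⟨v, ⟨u, hu, hv⟩, h⟩
      exact ⟨u, hu, v, hv, h⟩

/-- The program `P`, a regular expression over the operations, leads from `s` to `s'` in at most
`T` steps. -/
def Reaches (step : α → S → S → Prop) (P : RegularExpression α) (T : ℕ) (s s' : S) : Prop :=
  ∃ l ∈ P.matches', l.length ≤ T ∧ Exec step l s s'

/-- The program `P` leads from `s` to `s'`. -/
def Leads (step : α → S → S → Prop) (P : RegularExpression α) (s s' : S) : Prop :=
  ∃ l ∈ P.matches', Exec step l s s'

theorem Reaches.leads {P : RegularExpression α} {T : ℕ} {s s' : S} (h : Reaches step P T s s') :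
    Leads step P s s' :=
  let ⟨l, h1, _, h2⟩ := h
  ⟨l, h1, h2⟩

theorem Reaches.mono {P : RegularExpression α} {T T' : ℕ} {s s' : S}
    (h : Reaches step P T s s') (hT : T ≤ T') : Reaches step P T' s s' :=
  let ⟨l, h1, h3, h2⟩ := h
  ⟨l, h1, h3.trans hT, h2⟩

theorem leads_char {a : α} {s s' : S} :
    Leads step (RegularExpression.char a) s s' ↔ step a s s' := by
  constructor
  · rintro ⟨l, hl, h⟩
    obtain rfl : l = [a] := hl
    obtain ⟨u, hu, rfl⟩ := h
    exact hu
  · exact fun h => ⟨[a], rfl, s', h, rfl⟩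

theorem reaches_char {a : α} {s s' : S} (h : step a s s') :
    Reaches step (RegularExpression.char a) 1 s s' :=
  ⟨[a], rfl, le_rfl, s', h, rfl⟩

theorem leads_mul {P Q : RegularExpression α} {s s' : S} :
    Leads step (P * Q) s s' ↔ ∃ u, Leads step P s u ∧ Leads step Q u s' := by
  constructor
  · rintro ⟨_, ⟨l, hl, m, hm, rfl⟩, h⟩
    obtain ⟨u, h1, h2⟩ := exec_append.1 h
    exact ⟨u, ⟨l, hl, h1⟩, ⟨m, hm, h2⟩⟩
  · rintro ⟨u, ⟨l, hl, h1⟩, ⟨m, hm, h2⟩⟩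
    exact ⟨_, ⟨l, hl, m, hm, rfl⟩, exec_append.2 ⟨u, h1, h2⟩⟩

theorem Reaches.mul {P Q : RegularExpression α} {T T' : ℕ} {s u s' : S}
    (h : Reaches step P T s u) (h' : Reaches step Q T' u s') :
    Reaches step (P * Q) (T + T') s s' := by
  obtain ⟨l, hl, hT, h1⟩ := h
  obtain ⟨m, hm, hT', h2⟩ := h'
  exact ⟨_, ⟨l, hl, m, hm, rfl⟩, by simp; omega, exec_append.2 ⟨u, h1, h2⟩⟩

theorem leads_add {P Q : RegularExpression α} {s s' : S} :
    Leads step (P + Q) s s' ↔ Leads step P s s' ∨ Leads step Q s s' := by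
  constructor
  · rintro ⟨l, hl | hl, h⟩
    · exact Or.inl ⟨l, hl, h⟩
    · exact Or.inr ⟨l, hl, h⟩
  · rintro (⟨l, hl, h⟩ | ⟨l, hl, h⟩)
    · exact ⟨l, Or.inl hl, h⟩
    · exact ⟨l, Or.inr hl, h⟩

theorem Reaches.inl {P Q : RegularExpression α} {T : ℕ} {s s' : S}
    (h : Reaches step P T s s') : Reaches step (P + Q) T s s' :=
  let ⟨l, h1, h2⟩ := h
  ⟨l, Or.inl h1, h2⟩

theorem Reaches.inr {P Q : RegularExpression α} {T : ℕ} {s s' : S}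
    (h : Reaches step Q T s s') : Reaches step (P + Q) T s s' :=
  let ⟨l, h1, h2⟩ := h
  ⟨l, Or.inr h1, h2⟩

theorem Leads.star_induction {P : RegularExpression α} {C : S → S → Prop}
    (refl : ∀ s, C s s) (head : ∀ s u s', Leads step P s u → C u s' → C s s')
    {s s' : S} (h : Leads step P.star s s') : C s s' := by
  obtain ⟨_, ⟨L, rfl, hL⟩, h⟩ := h
  induction L generalizing s with
  | nil =>
    obtain rfl : s = s' := h
    exact refl s
  | cons l L ih =>
    rw [List.flatten_cons, exec_append] at h
    obtain ⟨u, h1, h2⟩ := h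
    exact head _ u _ ⟨l, hL l (by simp), h1⟩ (ih (fun y hy => hL y (by simp [hy])) h2)

theorem Leads.star_invariant {P : RegularExpression α} {I : S → Prop}
    (step' : ∀ s u, I s → Leads step P s u → I u)
    {s s' : S} (h : Leads step P.star s s') (hs : I s) : I s' :=
  Leads.star_induction (C := fun s s' => I s → I s') (fun _ => id)
    (fun _ _ _ h1 h2 h3 => h2 (step' _ _ h3 h1)) h hs

theorem reaches_star_refl {P : RegularExpression α} (T : ℕ) (s : S) :
    Reaches step P.star T s s :=
  ⟨[], Language.nil_mem_kstar _, Nat.zero_le _, rfl⟩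

theorem Reaches.star_head {P : RegularExpression α} {T T' : ℕ} {s u s' : S}
    (h : Reaches step P T s u) (h' : Reaches step P.star T' u s') :
    Reaches step P.star (T + T') s s' := by
  obtain ⟨l, hl, hT, h1⟩ := h
  obtain ⟨m, hm, hT', h2⟩ := h'
  exact ⟨l ++ m, Language.cons_mem_kstar (L := P.matches') hl hm, by simp; omega,
    exec_append.2 ⟨u, h1, h2⟩⟩

theorem reaches_star_of_chain {P : RegularExpression α} {T n : ℕ} (f : ℕ → S)
    (h : ∀ i < n, Reaches step P T (f i) (f (i + 1))) :
    Reaches step P.star (n * T) (f 0) (f n) := by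
  induction n generalizing f with
  | zero => exact reaches_star_refl _ _
  | succ n ih =>
    have := (h 0 (by omega)).star_head
      (ih (fun i => f (i + 1)) fun i hi => h (i + 1) (by omega))
    rwa [Nat.add_comm, ← Nat.succ_mul] at this

/-- The program `P` leads from `s` to exactly the states in `Q`, and it can do so in `X ^ d`
steps. -/
def Exact (step : α → S → S → Prop) (X d : ℕ) (P : RegularExpression α) (s : S)
    (Q : S → Prop) : Prop :=
  ∀ s', (Leads step P s s' → Q s') ∧ (Q s' → Reaches step P (X ^ d) s s')

variable {X : ℕ}

theorem Exact.congr {d d' : ℕ} {P : RegularExpression α} {s : S} {Q Q' : S → Prop}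
    (h : Exact step X d P s Q) (hX : 2 ≤ X) (hd : d ≤ d') (hQ : ∀ s', Q s' ↔ Q' s') :
    Exact step X d' P s Q' := fun s' =>
  ⟨fun h1 => (hQ s').1 ((h s').1 h1), fun h1 => ((h s').2 ((hQ s').2 h1)).mono
    (Nat.pow_le_pow_right (by omega) hd)⟩

/-- Running times are measured by exponents of a common base `X > B`. Sequencing adds exponents, so
the exponent of a fixed program is a constant that does not depend on the input, and crude estimates
of it suffice. -/
theorem pow_add_pow_le_pow (hX : 2 ≤ X) (a b : ℕ) : X ^ a + X ^ b ≤ X ^ (a + b + 1) := by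
  have h1 : X ^ a ≤ X ^ (a + b) := Nat.pow_le_pow_right (by omega) (by omega)
  have h2 : X ^ b ≤ X ^ (a + b) := Nat.pow_le_pow_right (by omega) (by omega)
  rw [pow_succ]
  have := Nat.mul_le_mul_left (X ^ (a + b)) hX
  omega

theorem exact_char {a : α} {s : S} : Exact step X 0 (RegularExpression.char a) s (step a s) :=
  fun _ => ⟨leads_char.1, fun h => by simpa using reaches_char h⟩

theorem Exact.mul {a b : ℕ} {P P' : RegularExpression α} {s : S} {Q : S → Prop}
    {Q' : S → S → Prop} (hX : 2 ≤ X) (h : Exact step X a P s Q)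
    (h' : ∀ u, Q u → Exact step X b P' u (Q' u)) :
    Exact step X (a + b + 1) (P * P') s fun s' => ∃ u, Q u ∧ Q' u s' := by
  intro s'
  constructor
  · intro hs
    obtain ⟨u, h1, h2⟩ := leads_mul.1 hs
    have := (h u).1 h1
    exact ⟨u, this, (h' u this s').1 h2⟩
  · rintro ⟨u, h1, h2⟩
    exact (((h u).2 h1).mul ((h' u h1 s').2 h2)).mono (pow_add_pow_le_pow hX a b)

/-- The case of a deterministic first part guarded by a test `p`; the second part needs to be
analysed only at the single state `u` and only under `p`. -/
theorem Exact.seq {a b : ℕ} {P P' : RegularExpression α} {s u : S} {p : Prop}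
    {Q' : S → Prop} (hX : 2 ≤ X) (h : Exact step X a P s fun s' => p ∧ s' = u)
    (h' : p → Exact step X b P' u Q') :
    Exact step X (a + b + 1) (P * P') s fun s' => p ∧ Q' s' := by
  refine (Exact.mul (Q' := fun _ => Q') hX h ?_).congr hX le_rfl ?_
  · rintro _ ⟨hp, rfl⟩
    exact h' hp
  · intro s'
    constructor
    · rintro ⟨_, ⟨hp, -⟩, hq⟩
      exact ⟨hp, hq⟩
    · rintro ⟨hp, hq⟩
      exact ⟨u, ⟨hp, rfl⟩, hq⟩

theorem Exact.add {a b : ℕ} {P P' : RegularExpression α} {s : S} {Q Q' : S → Prop}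
    (hX : 2 ≤ X) (h : Exact step X a P s Q) (h' : Exact step X b P' s Q') :
    Exact step X (a + b + 1) (P + P') s fun s' => Q s' ∨ Q' s' := by
  intro s'
  rw [leads_add]
  constructor
  · rintro (hs | hs)
    · exact Or.inl ((h s').1 hs)
    · exact Or.inr ((h' s').1 hs)
  · rintro (hs | hs)
    · exact (((h s').2 hs).mono (Nat.pow_le_pow_right (by omega) (by omega))).inl
    · exact (((h' s').2 hs).mono (Nat.pow_le_pow_right (by omega) (by omega))).inr

/-- The results of iterating a nondeterministic operation with a list of parameters. -/
def Steps {β : Type} (G : S → β → S → Prop) : S → List β → S → Prop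
  | s, [], s' => s = s'
  | s, b :: l, s' => ∃ u, G s b u ∧ Steps G u l s'

/-- For parsing loops: one round consumes one item `b`, and the list of parameters is what has been
read. The bound on the number of rounds will come from a counter that grows in every round and
cannot exceed `B`. -/
theorem Exact.star {β : Type} {G : S → β → S → Prop} {I : S → Prop} {a c : ℕ}
    {P : RegularExpression α} {s : S}
    (h : ∀ s, I s → Exact step X a P s fun u => ∃ b, G s b u)
    (hI : ∀ s b u, I s → G s b u → I u) (hs : I s)
    (hl : ∀ l s', Steps G s l s' → l.length ≤ X ^ c) :
    Exact step X (a + c) P.star s fun s' => ∃ l, Steps G s l s' := by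
  intro s'
  constructor
  · clear hl
    intro hr
    refine Leads.star_induction (C := fun s s' => I s → ∃ l, Steps G s l s')
      (fun s _ => ⟨[], rfl⟩) ?_ hr hs
    intro s u s' h1 h2 h3
    obtain ⟨b, hb⟩ := (h s h3 u).1 h1
    obtain ⟨l, hl⟩ := h2 (hI s b u h3 hb)
    exact ⟨b :: l, u, hb, hl⟩
  · rintro ⟨l, hr⟩
    have hlen := hl l s' hr
    clear hl
    refine Reaches.mono (T := l.length * X ^ a) ?_
      ((Nat.mul_le_mul_right _ hlen).trans_eq (by rw [pow_add, mul_comm]))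
    clear hlen
    induction l generalizing s with
    | nil =>
      obtain rfl : s = s' := hr
      exact reaches_star_refl _ _
    | cons b l ih =>
      obtain ⟨u, hb, hr⟩ := hr
      have := ((h s hs u).2 ⟨b, hb⟩).star_head (ih (hI s b u hs hb) hr)
      refine this.mono (le_of_eq ?_)
      simp [Nat.succ_mul, Nat.add_comm]

end Programs

/-! ### A machine with counters and bit arrays -/

/-- The counters. -/
inductive Reg where
  | addr | aux | tmp | cnt
  | nodes | letters | arity | numEdges | numPos | numNeg
  | idx | val | one | two | three
  | var (i : Fin 12)
  deriving DecidableEq, Fintype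

/-- The bit arrays. -/
inductive Arr where
  | edge | edgeLen | pos | posLen | neg | negLen
  | digit | image | reach | mem | goal
  deriving DecidableEq

instance : Fintype Arr :=
  ⟨{.edge, .edgeLen, .pos, .posLen, .neg, .negLen, .digit, .image, .reach, .mem, .goal},
    fun x => by cases x <;> simp⟩

namespace Reg

/-- The counters that range over `0, …, B`. -/
def Bounded (r : Reg) : Prop := r ≠ addr ∧ r ≠ aux ∧ r ≠ tmp

instance : DecidablePred Bounded := fun _ => inferInstanceAs (Decidable (_ ∧ _ ∧ _))

end Reg

/-- The arrays that hold a guessed certificate. -/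
def Arr.IsCert (f : Arr) : Bool :=
  match f with
  | digit | image | reach | mem | goal => true
  | _ => false

/-- The operations. -/
inductive Op where
  | shift (d : Reg → Option Turing.Dir)
  | isZero (r : Reg) (b : Bool)
  | isMax (r : Reg)
  | read (a : InputSym)
  | eof
  | bit (f : Arr) (b : Bool)
  | set (f : Arr)
  | guess
  | setMax

/-- The states: the unread part of the input, the values of the counters, the arrays, and the
marked values of the counters. -/
@[ext] structure St where
  inp : List InputSym
  reg : Reg → ℕ
  arr : Arr → ℕ → Bool
  mark : Reg → ℕ → Bool

/-- The effect of moving counters up and down. -/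
def shiftReg (d : Reg → Option Turing.Dir) (v : Reg → ℕ) (r : Reg) : ℕ :=
  match d r with
  | none => v r
  | some Turing.Dir.left => v r - 1
  | some Turing.Dir.right => v r + 1

/-- The effect of an operation. -/
def Op.Step : Op → St → St → Prop
  | .shift d, s, s' => (∀ r, d r = some Turing.Dir.left → s.reg r ≠ 0) ∧
      (∀ r, d r = some Turing.Dir.right → s.mark r (s.reg r) = false) ∧
      s' = { s with reg := shiftReg d s.reg }
  | .isZero r b, s, s' => decide (s.reg r = 0) = b ∧ s' = s
  | .isMax r, s, s' => s.mark r (s.reg r) = true ∧ s' = s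
  | .read a, s, s' => ∃ l, s.inp = a :: l ∧ s' = { s with inp := l }
  | .eof, s, s' => s.inp = [] ∧ s' = s
  | .bit f b, s, s' => s.arr f (s.reg .addr) = b ∧ s' = s
  | .set f, s, s' => s' = { s with
      arr := fun g a => if g = f ∧ a = s.reg .addr then true else s.arr g a }
  | .guess, s, s' => ∃ c : Arr → Bool, s' = { s with
      arr := fun g a => if g.IsCert = true ∧ a = s.reg .addr then c g else s.arr g a }
  | .setMax, s, s' => s' = { s with
      mark := fun r i => if r.Bounded ∧ i = s.reg r then true else s.mark r i }

/-- Tape symbols: an input letter, marks for the cell `0` and for the maximal cell, and a bit for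
every array. -/
abbrev Symb : Type := Option InputSym × Bool × Bool × (Arr → Bool)

/-- The tapes: the input tape and one tape for every counter. -/
abbrev TapeName : Type := Option Reg

/-- The transitions of a Turing machine that implement an operation. -/
def Op.Trans (h : TapeName → Symb) : Op → (TapeName → Symb × Option Turing.Dir) → Prop
  | .shift d, o => (∀ r, d r = some Turing.Dir.left → (h (some r)).2.1 = false) ∧
      (∀ r, d r = some Turing.Dir.right → (h (some r)).2.2.1 = false) ∧
      o = fun k => (h k, k.bind d)
  | .isZero r b, o => (h (some r)).2.1 = b ∧ o = fun k => (h k, none)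
  | .isMax r, o => (h (some r)).2.2.1 = true ∧ o = fun k => (h k, none)
  | .read a, o => (h none).1 = some a ∧
      o = fun k => (h k, if k = none then some Turing.Dir.right else none)
  | .eof, o => (h none).1 = none ∧ o = fun k => (h k, none)
  | .bit f b, o => (h (some .addr)).2.2.2 f = b ∧ o = fun k => (h k, none)
  | .set f, o => o = fun k => (if k = some .addr then
      ((h k).1, (h k).2.1, (h k).2.2.1, fun g => if g = f then true else (h k).2.2.2 g)
      else h k, none)
  | .guess, o => ∃ c : Arr → Bool, o = fun k => (if k = some .addr then
      ((h k).1, (h k).2.1, (h k).2.2.1, fun g => if g.IsCert = true then c g else (h k).2.2.2 g)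
      else h k, none)
  | .setMax, o => o = fun k => (match k with
      | none => h none
      | some r => if r.Bounded then ((h k).1, (h k).2.1, true, (h k).2.2.2) else h k, none)

/-- The contents of the tape of a counter. -/
def St.cell (s : St) (r : Reg) (i : ℤ) : Symb :=
  (none, decide (i = 0), decide (0 ≤ i) && s.mark r i.toNat,
    fun f => decide (r = .addr ∧ 0 ≤ i) && s.arr f i.toNat)

/-- The tapes represent the state. -/
def St.Rep (s : St) (T : TapeName → Turing.Tape Symb) : Prop :=
  (∀ i : ℕ, (T none).nth i = (s.inp[i]?, false, false, fun _ => false)) ∧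
    ∀ r (i : ℤ), (T (some r)).nth i = s.cell r (i + s.reg r)

/-- The displacement of the head. -/
def disp : Option Turing.Dir → ℤ
  | none => 0
  | some Turing.Dir.left => -1
  | some Turing.Dir.right => 1

/-! ### Simulation of the operations on tapes -/

theorem NTM.nth_act {Γ : Type} [Inhabited Γ] (x : Γ × Option Turing.Dir) (T : Turing.Tape Γ)
    (i : ℤ) : (NTM.act x T).nth i = if i + disp x.2 = 0 then x.1 else T.nth (i + disp x.2) := by
  obtain ⟨g, _ | _ | _⟩ := x
  · simp [NTM.act, disp]
  · simp only [NTM.act, disp, Turing.Tape.move_left_nth, Turing.Tape.write_nth]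
    rfl
  · simp only [NTM.act, disp, Turing.Tape.move_right_nth, Turing.Tape.write_nth]
    rfl

theorem St.Rep.head {s : St} {T : TapeName → Turing.Tape Symb} (h : s.Rep T) (r : Reg) :
    (T (some r)).head = s.cell r (s.reg r) := by
  rw [← Turing.Tape.nth_zero, h.2, zero_add]

theorem St.Rep.head_none {s : St} {T : TapeName → Turing.Tape Symb} (h : s.Rep T) :
    (T none).head = (s.inp[0]?, false, false, fun _ => false) := by
  rw [← Turing.Tape.nth_zero]
  exact h.1 0

/-- The value of a counter is the position of its head, and tape positions are counted from the
head. So a head move that matches the change of the counter leaves absolute cells in place, and only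
the scanned cell can change. On the input tape nothing is required to the left of the head, so
moving right amounts to dropping a letter. -/
theorem St.Rep.act {s s' : St} {T : TapeName → Turing.Tape Symb} (h : s.Rep T)
    {o : TapeName → Symb × Option Turing.Dir}
    (h0 : (o none = ((T none).head, none) ∧ s'.inp = s.inp) ∨
      (o none = ((T none).head, some Turing.Dir.right) ∧ ∃ a, s.inp = a :: s'.inp))
    (h1 : ∀ r, (s'.reg r : ℤ) = s.reg r + disp (o (some r)).2)
    (h2 : ∀ r i, s'.cell r i = if i = s.reg r then (o (some r)).1 else s.cell r i) :
    s'.Rep fun k => NTM.act (o k) (T k) := by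
  constructor
  · intro i
    rw [NTM.nth_act]
    rcases h0 with ⟨h0, h3⟩ | ⟨h0, a, h3⟩
    · simp only [h0, disp, add_zero, h.1, h.head_none, h3]
      split_ifs with hi
      · obtain rfl : i = 0 := by omega
        rfl
      · rfl
    · simp only [h0, disp]
      rw [if_neg (by omega), show (i : ℤ) + 1 = ((i + 1 : ℕ) : ℤ) by push_cast; rfl, h.1, h3]
      simp
  · intro r i
    rw [NTM.nth_act, h2, h1, h.2]
    have : i + (s.reg r + disp (o (some r)).2) = s.reg r ↔ i + disp (o (some r)).2 = 0 := by omega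
    rw [add_assoc, add_comm (disp _), if_congr this rfl rfl]

theorem St.cell_zero {s : St} {r : Reg} : (s.cell r (s.reg r)).2.1 = decide (s.reg r = 0) := by
  simp [St.cell]

theorem St.cell_mark {s : St} {r : Reg} :
    (s.cell r (s.reg r)).2.2.1 = s.mark r (s.reg r) := by
  simp [St.cell]

theorem St.cell_addr {s : St} {f : Arr} :
    (s.cell .addr (s.reg .addr)).2.2.2 f = s.arr f (s.reg .addr) := by
  simp [St.cell]

theorem St.Rep.stay {s : St} {T : TapeName → Turing.Tape Symb} (h : s.Rep T) :
    s.Rep fun k => NTM.act ((T k).head, none) (T k) := by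
  refine h.act (Or.inl ⟨rfl, rfl⟩) (by simp [disp]) fun r i => ?_
  split_ifs with hi
  · rw [hi, h.head]
  · rfl

/-- All arrays are tracks of the tape of `addr`, so that array access happens at the address under a
single head. -/
theorem St.Rep.write {s : St} {T : TapeName → Turing.Tape Symb} (h : s.Rep T)
    {A : Arr → ℕ → Bool} {c : Arr → Bool}
    (hA : ∀ f a, A f a = if a = s.reg .addr then c f else s.arr f a) :
    St.Rep { s with arr := A } fun k => NTM.act ((if k = some .addr then
      ((T k).head.1, (T k).head.2.1, (T k).head.2.2.1, c) else (T k).head), none) (T k) := by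
  refine h.act (Or.inl ⟨by simp, rfl⟩) (by simp [disp]) fun r i => ?_
  by_cases hr : r = .addr
  · subst hr
    by_cases hi : i = s.reg .addr
    · subst hi
      simp only [if_true, h.head]
      ext <;> simp [St.cell, hA]
    · rw [if_neg hi]
      simp only [St.cell]
      refine Prod.ext rfl (Prod.ext rfl (Prod.ext rfl ?_))
      funext f
      by_cases hi0 : 0 ≤ i
      · have : i.toNat ≠ s.reg .addr := by omega
        simp [hA, this]
      · simp [hi0]
  · simp only [Option.some.injEq, hr, if_false]
    split_ifs with hi
    · rw [h.head, hi]
      simp [St.cell, hr]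
    · simp [St.cell, hr]

theorem St.Rep.shift {s : St} {T : TapeName → Turing.Tape Symb} (h : s.Rep T)
    {d : Reg → Option Turing.Dir} (hd : ∀ r, d r = some Turing.Dir.left → s.reg r ≠ 0) :
    St.Rep { s with reg := shiftReg d s.reg } fun k =>
      NTM.act ((T k).head, k.bind d) (T k) := by
  refine h.act (Or.inl ⟨rfl, rfl⟩) (fun r => ?_) fun r i => ?_
  · have := hd r
    simp only [shiftReg, Option.bind_some]
    rcases hr : d r with _ | _ | _
    · simp [disp]
    · have := this hr
      simp only [disp]
      omega
    · simp [disp]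
  · split_ifs with hi
    · rw [h.head, hi]; rfl
    · rfl

/-- Tapes and states are bisimilar: the guards of an operation are visible in the scanned symbols
through the marks for zero and for the maximal value. One direction gives soundness of the machine,
the other completeness. -/
theorem St.Rep.trans_iff {s : St} {T : TapeName → Turing.Tape Symb} (h : s.Rep T) (op : Op) :
    (∀ o, op.Trans (fun k => (T k).head) o →
      ∃ s', op.Step s s' ∧ s'.Rep fun k => NTM.act (o k) (T k)) ∧
    (∀ s', op.Step s s' → ∃ o, op.Trans (fun k => (T k).head) o ∧
      s'.Rep fun k => NTM.act (o k) (T k)) := by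
  cases op with
  | shift d =>
    have key1 : ∀ r, (T (some r)).head.2.1 = false ↔ s.reg r ≠ 0 := fun r => by
      rw [h.head, St.cell_zero]; simp
    have key2 : ∀ r, (T (some r)).head.2.2.1 = s.mark r (s.reg r) := fun r => by
      rw [h.head, St.cell_mark]
    simp only [Op.Trans, Op.Step, key1, key2]
    constructor
    · rintro _ ⟨h1, h2, rfl⟩
      exact ⟨_, ⟨h1, h2, rfl⟩, h.shift h1⟩
    · rintro _ ⟨h1, h2, rfl⟩
      exact ⟨_, ⟨h1, h2, rfl⟩, h.shift h1⟩
  | isZero r b =>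
    simp only [Op.Trans, Op.Step, h.head, St.cell_zero]
    exact ⟨fun _ ⟨h1, h2⟩ => ⟨s, ⟨h1, rfl⟩, h2 ▸ h.stay⟩,
      fun _ ⟨h1, h2⟩ => ⟨_, ⟨h1, rfl⟩, h2 ▸ h.stay⟩⟩
  | isMax r =>
    simp only [Op.Trans, Op.Step, h.head, St.cell_mark]
    exact ⟨fun _ ⟨h1, h2⟩ => ⟨s, ⟨h1, rfl⟩, h2 ▸ h.stay⟩,
      fun _ ⟨h1, h2⟩ => ⟨_, ⟨h1, rfl⟩, h2 ▸ h.stay⟩⟩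
  | read a =>
    have key : ∀ l, s.inp = a :: l → St.Rep { s with inp := l } fun k => NTM.act
        ((T k).head, if k = none then some Turing.Dir.right else none) (T k) := by
      intro l hl
      refine h.act (Or.inr ⟨rfl, a, hl⟩) (by simp [disp]) fun r i => ?_
      by_cases hi : i = s.reg r
      · rw [if_pos hi, h.head, hi]; rfl
      · rw [if_neg hi]; rfl
    simp only [Op.Trans, Op.Step, h.head_none]
    constructor
    · rintro _ ⟨h1, rfl⟩
      obtain ⟨l, hl⟩ : ∃ l, s.inp = a :: l := by
        cases hs : s.inp with
        | nil => simp [hs] at h1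
        | cons b l => simp [hs] at h1; exact ⟨l, by rw [h1]⟩
      exact ⟨_, ⟨l, hl, rfl⟩, key l hl⟩
    · rintro _ ⟨l, hl, rfl⟩
      exact ⟨_, ⟨by simp [hl], rfl⟩, key l hl⟩
  | eof =>
    simp only [Op.Trans, Op.Step, h.head_none]
    exact ⟨fun _ ⟨h1, h2⟩ => ⟨s, ⟨by simpa using h1, rfl⟩, h2 ▸ h.stay⟩,
      fun _ ⟨h1, h2⟩ => ⟨_, ⟨by simpa using h1, rfl⟩, h2 ▸ h.stay⟩⟩
  | bit f b =>
    simp only [Op.Trans, Op.Step, h.head, St.cell_addr]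
    exact ⟨fun _ ⟨h1, h2⟩ => ⟨s, ⟨h1, rfl⟩, h2 ▸ h.stay⟩,
      fun _ ⟨h1, h2⟩ => ⟨_, ⟨h1, rfl⟩, h2 ▸ h.stay⟩⟩
  | set f =>
    have key := h.write (A := fun g a => if g = f ∧ a = s.reg .addr then true else s.arr g a)
      (c := fun g => if g = f then true else (T (some .addr)).head.2.2.2 g) (fun g a => by
        rw [h.head, St.cell_addr]
        by_cases ha : a = s.reg .addr <;> simp [ha])
    -- `write` takes the new bits from the tape of `addr`, the transition from tape `k`; they agree
    -- in the only branch where they matter.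
    have key2 : ∀ k : TapeName, (if k = some .addr then
      ((T k).head.1, (T k).head.2.1, (T k).head.2.2.1,
        fun g => if g = f then true else (T (some .addr)).head.2.2.2 g) else (T k).head) =
      (if k = some .addr then
      ((T k).head.1, (T k).head.2.1, (T k).head.2.2.1,
        fun g => if g = f then true else (T k).head.2.2.2 g) else (T k).head) := by
      intro k
      split_ifs with hk
      · rw [hk]
      · rfl
    simp only [key2] at key
    simp only [Op.Trans, Op.Step]
    exact ⟨fun _ h2 => ⟨_, rfl, h2 ▸ key⟩, fun _ h2 => ⟨_, rfl, h2 ▸ key⟩⟩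
  | guess =>
    have key := fun c : Arr → Bool => h.write
      (A := fun g a => if g.IsCert = true ∧ a = s.reg .addr then c g else s.arr g a)
      (c := fun g => if g.IsCert = true then c g else (T (some .addr)).head.2.2.2 g) (fun g a => by
        rw [h.head, St.cell_addr]
        by_cases ha : a = s.reg .addr <;> simp [ha])
    have key2 : ∀ (c : Arr → Bool) (k : TapeName), (if k = some .addr then
      ((T k).head.1, (T k).head.2.1, (T k).head.2.2.1,
        fun g => if g.IsCert = true then c g else (T (some .addr)).head.2.2.2 g) else (T k).head) =
      (if k = some .addr then
      ((T k).head.1, (T k).head.2.1, (T k).head.2.2.1,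
        fun g => if g.IsCert = true then c g else (T k).head.2.2.2 g) else (T k).head) := by
      intro c k
      split_ifs with hk
      · rw [hk]
      · rfl
    simp only [key2] at key
    simp only [Op.Trans, Op.Step]
    exact ⟨fun _ ⟨c, h2⟩ => ⟨_, ⟨c, rfl⟩, h2 ▸ key c⟩, fun _ ⟨c, h2⟩ => ⟨_, ⟨c, rfl⟩, h2 ▸ key c⟩⟩
  | setMax =>
    have key : St.Rep { s with
        mark := fun r i => if r.Bounded ∧ i = s.reg r then true else s.mark r i } fun k =>
        NTM.act (match k with
          | none => (T none).head
          | some r => if r.Bounded then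
            ((T k).head.1, (T k).head.2.1, true, (T k).head.2.2.2)
            else (T k).head, none) (T k) := by
      refine h.act (Or.inl ⟨rfl, rfl⟩) (by simp [disp]) fun r i => ?_
      by_cases hi : i = s.reg r
      · subst hi
        rw [if_pos rfl]
        dsimp only
        rw [h.head]
        by_cases hr : r.Bounded <;> simp [St.cell, hr]
      · rw [if_neg hi]
        simp only [St.cell]
        refine Prod.ext rfl (Prod.ext rfl (Prod.ext ?_ rfl))
        by_cases hi0 : 0 ≤ i
        · have : i.toNat ≠ s.reg r := by omega
          simp [this]
        · simp [hi0]
    simp only [Op.Trans, Op.Step]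
    exact ⟨fun _ h2 => ⟨_, rfl, h2 ▸ key⟩, fun _ h2 => ⟨_, rfl, h2 ▸ key⟩⟩

/-! ### Turing machines from regular sets of operation sequences -/

/-- A step of the tapes. -/
def TapeStep (op : Op) (T T' : TapeName → Turing.Tape Symb) : Prop :=
  ∃ o, op.Trans (fun k => (T k).head) o ∧ T' = fun k => NTM.act (o k) (T k)

theorem St.Rep.exists_exec_iff {s : St} {T : TapeName → Turing.Tape Symb} (h : s.Rep T)
    (l : List Op) : (∃ T', Exec TapeStep l T T') ↔ ∃ s', Exec Op.Step l s s' := by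
  induction l generalizing s T with
  | nil => simp [Exec]
  | cons op l ih =>
    simp only [Exec]
    constructor
    · rintro ⟨T', _, ⟨o, ho, rfl⟩, h2⟩
      obtain ⟨u, hu, hr⟩ := (h.trans_iff op).1 o ho
      obtain ⟨s', hs'⟩ := (ih hr).1 ⟨T', h2⟩
      exact ⟨s', u, hu, hs'⟩
    · rintro ⟨s', u, hu, h2⟩
      obtain ⟨o, ho, hr⟩ := (h.trans_iff op).2 u hu
      obtain ⟨T', hT'⟩ := (ih hr).2 ⟨s', h2⟩
      exact ⟨T', _, ⟨o, ho, rfl⟩, hT'⟩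

/-- The tape symbol of an input letter. -/
def Symb.ofLetter (a : InputSym) : Symb := (some a, false, false, fun _ => false)

/-- The machine that marks the cell `0` of every counter and then performs a sequence of operations
accepted by the automaton. -/
def machine {σ : Type} [Fintype σ] (D : DFA Op σ) : NTM InputSym where
  Q := Option σ
  K := TapeName
  Γ := Symb
  inputTape := none
  letter := Symb.ofLetter
  letter_injective := fun a b h => by simpa [Symb.ofLetter] using h
  letter_ne_blank := fun a h => by
    have : (some a : Option InputSym) = none := congrArg Prod.fst h
    cases this
  start := none
  accept := {q | ∃ p ∈ D.accept, q = some p}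
  trans := fun q h => match q with
    | none => {(some D.start, fun k => (match k with
        | none => h none
        | some _ => (none, true, false, fun _ => false), none))}
    | some p => {x | ∃ op, x.1 = some (D.step p op) ∧ op.Trans h x.2}

/-- The initial state. -/
def St.start (w : List InputSym) : St := ⟨w, fun _ => 0, fun _ _ => false, fun _ _ => false⟩

/-- A configuration of the machine. -/
def machineCfg {σ : Type} [Fintype σ] (D : DFA Op σ) (q : Option σ)
    (T : TapeName → Turing.Tape Symb) : (machine D).Cfg := ⟨q, T⟩

/-- The machine guesses the next operation and feeds it to the automaton while executing it, so
accepting computations are accepted words of operations that can be executed. -/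
theorem machine_acceptsWithin_some {σ : Type} [Fintype σ] (D : DFA Op σ) (t : ℕ) (p : σ)
    (T : TapeName → Turing.Tape Symb) :
    (machine D).AcceptsWithin t (machineCfg D (some p) T) ↔
      ∃ l ∈ D.acceptsFrom p, l.length ≤ t ∧ ∃ T', Exec TapeStep l T T' := by
  have hacc : ∀ q T, (machineCfg D (some q) T).state ∈ (machine D).accept ↔ q ∈ D.accept :=
    fun q T => ⟨fun ⟨p, hp, h⟩ => by cases h; exact hp, fun h => ⟨q, h, rfl⟩⟩
  induction t generalizing p T with
  | zero =>
    rw [NTM.AcceptsWithin, hacc]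
    constructor
    · exact fun h => ⟨[], h, le_rfl, T, rfl⟩
    · rintro ⟨l, hl, hlen, -⟩
      obtain rfl := List.length_eq_zero_iff.1 (Nat.le_zero.1 hlen)
      exact hl
  | succ t ih =>
    rw [NTM.AcceptsWithin, hacc]
    constructor
    · rintro (h | ⟨c, ⟨⟨q, o⟩, ⟨op, hx, hop⟩, hc⟩, h⟩)
      · exact ⟨[], h, Nat.zero_le _, T, rfl⟩
      · have hc' : c = machineCfg D (some (D.step p op)) fun k => NTM.act (o k) (T k) := by
          rw [hc, ← hx]; rfl
        rw [hc'] at h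
        obtain ⟨l, hl, hlen, T', hT'⟩ := (ih _ _).1 h
        exact ⟨op :: l, hl, by simpa using hlen, T', _, ⟨o, hop, rfl⟩, hT'⟩
    · rintro ⟨_ | ⟨op, l⟩, hl, hlen, T', hT'⟩
      · exact Or.inl hl
      · obtain ⟨_, ⟨o, ho, rfl⟩, h⟩ := hT'
        refine Or.inr ⟨machineCfg D (some (D.step p op)) fun k => NTM.act (o k) (T k),
          ⟨(some (D.step p op), o), ⟨op, rfl, ho⟩, rfl⟩, ?_⟩
        exact (ih _ _).2 ⟨l, hl, by simpa using hlen, T', h⟩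

/-- The additional step writes the zero marks; only afterwards do the tapes represent `St.start w`.
-/
theorem machine_acceptsWithin_init {σ : Type} [Fintype σ] (D : DFA Op σ) (t : ℕ)
    (w : List InputSym) :
    (machine D).AcceptsWithin (t + 1) ((machine D).init w) ↔
      ∃ l ∈ D.accepts, l.length ≤ t ∧ ∃ s', Exec Op.Step l (St.start w) s' := by
  let T : TapeName → Turing.Tape Symb := ((machine D).init w).tape
  let o : TapeName → Symb × Option Turing.Dir := fun k => (match k with
        | none => (T none).head
        | some _ => (none, true, false, fun _ => false), none)
  have hrep : (St.start w).Rep fun k => NTM.act (o k) (T k) := by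
    constructor
    · intro i
      rw [NTM.nth_act]
      have hT : T none = Turing.Tape.mk₁ (w.map Symb.ofLetter) := rfl
      have : (T none).nth i = (w[i]?, false, false, fun _ => false) := by
        rw [hT, Turing.Tape.mk₁, Turing.Tape.mk₂, Turing.Tape.mk'_nth_nat, Turing.ListBlank.nth_mk,
          List.getI_eq_getElem?_getD, List.getElem?_map]
        cases w[i]? <;> rfl
      simp only [o, disp, add_zero, this]
      split_ifs with hi
      · obtain rfl : i = 0 := by omega
        rw [← Turing.Tape.nth_zero]
        exact this
      · rfl
    · intro r i
      have hT : T (some r) = Turing.Tape.mk₁ [] := rfl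
      have : ∀ j, (T (some r)).nth j = default := by
        intro j
        rw [hT]
        rcases j with (_ | j) | j <;> rfl
      rw [NTM.nth_act, this]
      by_cases hi : i = 0 <;> simp [o, disp, St.start, St.cell, hi] <;> rfl
  have h1 : (machine D).AcceptsWithin (t + 1) ((machine D).init w) ↔
      (machine D).AcceptsWithin t (machineCfg D (some D.start) fun k => NTM.act (o k) (T k)) := by
    have hs : ((machine D).init w).state ∉ (machine D).accept := by
      rintro ⟨p, -, hp⟩
      cases hp
    rw [NTM.AcceptsWithin, or_iff_right hs]
    constructor
    · rintro ⟨c, ⟨x, hx, rfl⟩, h⟩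
      obtain rfl := hx
      exact h
    · exact fun h => ⟨_, ⟨_, rfl, rfl⟩, h⟩
  rw [h1, machine_acceptsWithin_some]
  refine exists_congr fun l => and_congr Iff.rfl (and_congr Iff.rfl ?_)
  exact hrep.exists_exec_iff l

/-- From here on no Turing machine appears: membership in `NEXP` is reduced to a regular set of
operation words. The summand `1` in the time pays for the marking step. -/
theorem mem_NEXP_of_isRegular {L : Language InputSym} {P : Language Op} (hP : P.IsRegular)
    (p : Polynomial ℕ)
    (sound : ∀ w, ∀ l ∈ P, ∀ s', Exec Op.Step l (St.start w) s' → w ∈ L)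
    (complete : ∀ w ∈ L, ∃ l ∈ P, l.length + 1 ≤ 2 ^ p.eval w.length ∧
      ∃ s', Exec Op.Step l (St.start w) s') : L ∈ NEXP InputSym := by
  obtain ⟨σ, _, D, rfl⟩ := hP
  refine ⟨machine D, p, fun w => ⟨fun hw => ?_, fun hw t ht => ?_⟩⟩
  · obtain ⟨l, hl, hlen, hs⟩ := complete w hw
    have := (machine_acceptsWithin_init D (2 ^ p.eval w.length - 1) w).2 ⟨l, hl, by omega, hs⟩
    rwa [Nat.sub_add_cancel (by omega)] at this
  · cases t with
    | zero =>
      obtain ⟨p, -, hp⟩ := ht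
      cases hp
    | succ t =>
      obtain ⟨l, hl, -, s', hs⟩ := (machine_acceptsWithin_init D t w).1 ht
      exact hw (sound w l hl s' hs)

/-! ### Loops -/

section Loops

variable {α S : Type} {step : α → S → S → Prop} {X : ℕ}

/-- The body can only proceed along the chain `f`, so the only freedom of the star is when to stop.
-/
theorem exact_star_chain {a c n : ℕ} {P : RegularExpression α} (f : ℕ → S) (p : ℕ → Prop)
    (hP : ∀ i ≤ n, Exact step X a P (f i) fun s' => i < n ∧ p i ∧ s' = f (i + 1))
    (hn : n ≤ X ^ c) :
    Exact step X (a + c) P.star (f 0) fun s' => ∃ i ≤ n, (∀ j < i, p j) ∧ s' = f i := by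
  intro s'
  constructor
  · intro h
    refine Leads.star_invariant (I := fun s' => ∃ i ≤ n, (∀ j < i, p j) ∧ s' = f i) ?_ h
      ⟨0, Nat.zero_le _, by simp, rfl⟩
    rintro _ u ⟨i, hi, hp, rfl⟩ hu
    obtain ⟨h1, h2, rfl⟩ := (hP i hi u).1 hu
    refine ⟨i + 1, h1, fun j hj => ?_, rfl⟩
    rcases Nat.lt_succ_iff_lt_or_eq.1 hj with h | rfl
    · exact hp j h
    · exact h2
  · rintro ⟨i, hi, hp, rfl⟩
    refine (reaches_star_of_chain (T := X ^ a) f fun j hj =>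
      (hP j (by omega) _).2 ⟨by omega, hp j hj, rfl⟩).mono ?_
    rw [pow_add, mul_comm]
    exact Nat.mul_le_mul_left _ (hi.trans hn)

/-- The exit `E` fails before the end of the chain, which removes the freedom to stop early: a
counting loop. -/
theorem exact_loop {a b c n : ℕ} {P E : RegularExpression α} (hX : 2 ≤ X) (f : ℕ → S)
    (p : ℕ → Prop) (Q : S → Prop)
    (hP : ∀ i ≤ n, Exact step X a P (f i) fun s' => i < n ∧ p i ∧ s' = f (i + 1))
    (hE : ∀ i ≤ n, Exact step X b E (f i) fun s' => i = n ∧ Q s')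
    (hn : n ≤ X ^ c) :
    Exact step X (a + c + b + 1) (P.star * E) (f 0) fun s' => (∀ i < n, p i) ∧ Q s' := by
  refine (Exact.mul (Q' := fun u s' => u = f n ∧ Q s') hX (exact_star_chain f p hP hn) ?_).congr
    hX le_rfl ?_
  · rintro _ ⟨i, hi, -, rfl⟩
    intro s'
    constructor
    · intro h
      obtain ⟨rfl, h⟩ := (hE i hi s').1 h
      exact ⟨rfl, h⟩
    · rintro ⟨h1, h2⟩
      rw [h1]
      exact (hE n le_rfl s').2 ⟨rfl, h2⟩
  · intro s'
    constructor
    · rintro ⟨_, ⟨i, hi, hp, rfl⟩, h, hQ⟩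
      have h' : Reaches step E (X ^ b) (f i) s' := by
        rw [h]
        exact (hE n le_rfl s').2 ⟨rfl, hQ⟩
      obtain ⟨rfl, -⟩ := (hE i hi s').1 h'.leads
      exact ⟨hp, hQ⟩
    · rintro ⟨hp, hQ⟩
      exact ⟨f n, ⟨n, le_rfl, hp, rfl⟩, rfl, hQ⟩

end Loops

/-! ### Arithmetic of counters -/

/-- Programs. -/
abbrev Prog : Type := RegularExpression Op

/-- The effect of programs. -/
abbrev Does (X d : ℕ) (P : Prog) (s : St) (Q : St → Prop) : Prop := Exact Op.Step X d P s Q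

namespace Prog

/-- The program of a single operation. -/
abbrev op (o : Op) : Prog := RegularExpression.char o

/-- Decrease some counters and increase others. -/
def move (dn up : List Reg) : Prog :=
  op (.shift fun r => if r ∈ dn then some Turing.Dir.left else
    if r ∈ up then some Turing.Dir.right else none)

/-- Move counters until the counter `x` is zero. -/
def drain (x : Reg) (dn up : List Reg) : Prog := (move (x :: dn) up).star * op (.isZero x true)

/-- Move counters until the counter `x` is maximal. -/
def climb (x : Reg) (up : List Reg) : Prog := (move [] (x :: up)).star * op (.isMax x)

end Prog

namespace St

/-- Decrease some counters and increase others by `n`. -/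
def mv (dn up : List Reg) (n : ℕ) (s : St) : St :=
  { s with reg := fun r => if r ∈ dn then s.reg r - n else
      if r ∈ up then s.reg r + n else s.reg r }

/-- Set a counter. -/
def setReg (s : St) (x : Reg) (v : ℕ) : St := { s with reg := Function.update s.reg x v }

/-- Exactly the value `B` of the bounded counters is marked. -/
def Marked (B : ℕ) (s : St) : Prop := ∀ r i, s.mark r i = decide (r.Bounded ∧ i = B)

theorem mv_zero (dn up : List Reg) (s : St) : s.mv dn up 0 = s := by
  ext <;> simp [mv]

end St

variable {B X : ℕ}

theorem does_op (o : Op) (s : St) : Does X 0 (Prog.op o) s (o.Step s) := exact_char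

theorem does_isZero (hX : 2 ≤ X) (x : Reg) (b : Bool) (s : St) :
    Does X 0 (Prog.op (.isZero x b)) s fun s' => (s.reg x = 0 ↔ b = true) ∧ s' = s :=
  (does_op _ s).congr hX le_rfl fun s' => by
    cases b <;> simp [Op.Step]

theorem does_isMax (hX : 2 ≤ X) (x : Reg) {s : St} (hs : s.Marked B) :
    Does X 0 (Prog.op (.isMax x)) s fun s' => (x.Bounded ∧ s.reg x = B) ∧ s' = s :=
  (does_op _ s).congr hX le_rfl fun s' => by
    simp [Op.Step, hs x]

/-- A counter in both lists is lowered, whence `r ∉ dn` in the second guard. Only bounded counters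
carry a maximal mark and can block. -/
theorem does_move (hX : 2 ≤ X) (dn up : List Reg) {s : St} (hs : s.Marked B) :
    Does X 0 (Prog.move dn up) s fun s' => ((∀ r ∈ dn, s.reg r ≠ 0) ∧
      ∀ r ∈ up, r ∉ dn → r.Bounded → s.reg r ≠ B) ∧ s' = s.mv dn up 1 :=
  (does_op _ s).congr hX le_rfl fun s' => by
    simp only [Op.Step, and_assoc]
    refine and_congr (forall_congr' fun r => ?_) (and_congr (forall_congr' fun r => ?_) ?_)
    · by_cases h1 : r ∈ dn <;> by_cases h2 : r ∈ up <;> simp [h1, h2]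
    · rw [hs]
      by_cases h1 : r ∈ dn <;> by_cases h2 : r ∈ up <;> simp [h1, h2]
    · have : ({ s with reg := shiftReg (fun r => if r ∈ dn then some Turing.Dir.left else
          if r ∈ up then some Turing.Dir.right else none) s.reg } : St) = s.mv dn up 1 := by
        ext r <;> try rfl
        simp only [St.mv, shiftReg]
        by_cases h1 : r ∈ dn <;> by_cases h2 : r ∈ up <;> simp [h1, h2]
      rw [this]

theorem St.mv_mv_one (dn up : List Reg) (n : ℕ) (s : St) :
    (s.mv dn up n).mv dn up 1 = s.mv dn up (n + 1) := by
  ext r <;> try rfl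
  simp only [mv]
  split_ifs <;> omega

/-- There are exactly `s.reg x` rounds, and a counter in `dn` blocks iff it runs out before `x`
does. With `dn` empty this moves or clears a counter; with `dn` nonempty it compares counters. -/
theorem does_drain (hX : 2 ≤ X) (x : Reg) (dn up : List Reg) {s : St} (hs : s.Marked B) {c : ℕ}
    (hup : ∀ r ∈ up, r ∉ x :: dn → r.Bounded → s.reg r + s.reg x ≤ B) (hc : s.reg x ≤ X ^ c) :
    Does X (c + 1) (Prog.drain x dn up) s fun s' =>
      (∀ r ∈ dn, s.reg x ≤ s.reg r) ∧ s' = s.mv (x :: dn) up (s.reg x) := by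
  have := exact_loop (step := Op.Step) (a := 0) (b := 0) (P := Prog.move (x :: dn) up)
    (E := Prog.op (.isZero x true)) hX (fun i => s.mv (x :: dn) up i)
    (fun i => ∀ r ∈ dn, i < s.reg r) (fun s' => s' = s.mv (x :: dn) up (s.reg x)) ?_ ?_ hc
  · rw [St.mv_zero] at this
    refine this.congr hX (by omega) fun s' => and_congr_left fun _ => ?_
    constructor
    · intro h r hr
      by_contra hlt
      exact lt_irrefl _ (h (s.reg r) (by omega) r hr)
    · exact fun h i hi r hr => hi.trans_le (h r hr)
  · intro i hi
    refine (does_move (s := s.mv (x :: dn) up i) hX (x :: dn) up hs).congr hX le_rfl fun s' => ?_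
    rw [St.mv_mv_one, ← and_assoc]
    refine and_congr_left fun _ => ?_
    constructor
    · rintro ⟨h1, -⟩
      have h3 : ∀ r ∈ x :: dn, i < s.reg r := fun r hr => by
        have := h1 r hr
        simp only [St.mv, hr, if_true] at this
        omega
      exact ⟨h3 x (by simp), fun r hr => h3 r (by simp [hr])⟩
    · rintro ⟨h1, h2⟩
      constructor
      · intro r hr
        simp only [St.mv, hr, if_true]
        rcases List.mem_cons.1 hr with rfl | h
        · omega
        · have := h2 r h
          omega
      · intro r hr h3 hb
        simp only [St.mv, hr, if_true, h3, if_false]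
        have := hup r hr h3 hb
        omega
  · intro i hi
    refine (does_isZero hX x true _).congr hX le_rfl fun s' => ?_
    simp only [St.mv, List.mem_cons, true_or, if_true, iff_true]
    constructor
    · rintro ⟨h1, rfl⟩
      obtain rfl : i = s.reg x := by omega
      exact ⟨rfl, rfl⟩
    · rintro ⟨rfl, rfl⟩
      exact ⟨by omega, rfl⟩

theorem does_climb (hX : B + 2 ≤ X) (x : Reg) (up : List Reg) {s : St} (hs : s.Marked B)
    (hx : x.Bounded) (h0 : s.reg x = 0) (hup : ∀ r ∈ up, r.Bounded → s.reg r = 0) :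
    Does X 2 (Prog.climb x up) s fun s' => s' = s.mv [] (x :: up) B := by
  have hX' : 2 ≤ X := by omega
  have := exact_loop (step := Op.Step) (a := 0) (b := 0) (c := 1) (n := B)
    (P := Prog.move [] (x :: up))
    (E := Prog.op (.isMax x)) hX' (fun i => s.mv [] (x :: up) i)
    (fun _ => True) (fun s' => s' = s.mv [] (x :: up) B) ?_ ?_ (by simp; omega)
  · rw [St.mv_zero] at this
    exact this.congr hX' (by omega) fun s' => by simp
  · intro i hi
    refine (does_move (s := s.mv [] (x :: up) i) hX' [] (x :: up) hs).congr hX' le_rfl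
      fun s' => ?_
    rw [St.mv_mv_one, ← and_assoc]
    refine and_congr_left fun _ => ?_
    constructor
    · rintro ⟨-, h1⟩
      have := h1 x (by simp) (by simp) hx
      simp [St.mv, h0] at this
      exact ⟨by omega, trivial⟩
    · rintro ⟨h1, -⟩
      refine ⟨by simp, fun r hr _ hb => ?_⟩
      have : s.reg r = 0 := by
        rcases List.mem_cons.1 hr with rfl | h
        · exact h0
        · exact hup r h hb
      simp only [St.mv, hr, List.not_mem_nil, if_false, if_true]
      omega
  · intro i hi
    refine (does_isMax (s := s.mv [] (x :: up) i) hX' x hs).congr hX' le_rfl fun s' => ?_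
    simp only [St.mv, List.mem_cons, true_or, if_true, List.not_mem_nil, if_false, h0, hx]
    constructor
    · rintro ⟨⟨-, h1⟩, rfl⟩
      obtain rfl : i = B := by omega
      exact ⟨rfl, rfl⟩
    · rintro ⟨rfl, rfl⟩
      exact ⟨⟨trivial, by omega⟩, rfl⟩

/-- The states in which all working counters are zero. -/
structure St.Ready (B : ℕ) (s : St) : Prop where
  marked : s.Marked B
  addr : s.reg .addr = 0
  aux : s.reg .aux = 0
  tmp : s.reg .tmp = 0
  cnt : s.reg .cnt = 0
  le : ∀ r : Reg, r.Bounded → s.reg r ≤ B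

/-- The counters that are available to programs. -/
def Reg.Free (r : Reg) : Prop := r.Bounded ∧ r ≠ cnt

instance : DecidablePred Reg.Free := fun _ => inferInstanceAs (Decidable (_ ∧ _))

namespace Prog

/-- Test whether `x ≤ y`. -/
def le (x y : Reg) : Bool → Prog
  | true => drain x [y] [.tmp] * drain .tmp [] [x, y]
  | false => drain y [x] [.tmp] * (op (.isZero x false) * drain .tmp [] [x, y])

/-- Add `B + 1` to `aux` for every unit of `addr`. -/
def scale : Prog :=
  (move [.addr] [.aux] * (climb .cnt [.aux] * drain .cnt [] [])).star * op (.isZero .addr true)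

/-- Replace `addr` by `addr * (B + 1) + x`. -/
def push (x : Reg) : Prog :=
  scale * (drain .aux [] [.addr] * (drain x [] [.tmp, .addr] * drain .tmp [] [x]))

/-- Push several counters. -/
def pushAll : List Reg → Prog
  | [] => 1
  | x :: xs => push x * pushAll xs

/-- Test an array. -/
def test (f : Arr) (xs : List Reg) (b : Bool) : Prog :=
  pushAll xs * (op (.bit f b) * drain .addr [] [])

/-- Write to an array. -/
def write (f : Arr) (xs : List Reg) : Prog :=
  pushAll xs * (op (.set f) * drain .addr [] [])

end Prog

/-- Subtract the counter claimed to be smaller from both, logging the amount in `tmp`, and add it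
back. For the negative answer the remainder of `x` must be nonzero, which makes the inequality
strict. -/
theorem does_le (hX : B + 2 ≤ X) {x y : Reg} (hx : x.Free) (hy : y.Free) (b : Bool) {s : St}
    (hs : s.Ready B) :
    Does X 7 (Prog.le x y b) s fun s' => (s.reg x ≤ s.reg y ↔ b = true) ∧ s' = s := by
  have hX' : 2 ≤ X := by omega
  have hxt : Reg.tmp ≠ x := fun h => hx.1.2.2 h.symm
  have hyt : Reg.tmp ≠ y := fun h => hy.1.2.2 h.symm
  have hxB := hs.le x hx.1
  have hyB := hs.le y hy.1
  have ht := hs.tmp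
  have hXB : B ≤ X ^ 1 := by simp; omega
  cases b with
  | true =>
    refine ((does_drain (c := 1) hX' x [y] [.tmp] hs.marked ?_ (hxB.trans hXB)).seq hX'
      fun hle => does_drain (c := 1) (s := s.mv [x, y] [.tmp] (s.reg x)) hX' .tmp [] [x, y]
        hs.marked ?_ ?_).congr hX' (by omega) fun s' => ?_
    · simp [Reg.Bounded]
    · simp at hle
      intro r hr _ hb
      have : r = x ∨ r = y := by simpa using hr
      rcases this with rfl | rfl <;> simp [St.mv, hxt, hyt, ht] <;> omega
    · simp [St.mv, hxt, hyt, ht]; omega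
    · have : s.reg x ≤ s.reg y → (s.mv [x, y] [.tmp] (s.reg x)).mv [.tmp] [x, y]
          ((s.mv [x, y] [.tmp] (s.reg x)).reg .tmp) = s := by
        intro hle
        ext r <;> try rfl
        simp only [St.mv, List.mem_cons, List.not_mem_nil, or_false, hxt, hyt, if_false, if_true,
          ht]
        by_cases h1 : r = .tmp
        · simp [h1, hxt, hyt, ht]
        · by_cases h2 : r = x
          · simp [h2, hxt.symm]
          · by_cases h3 : r = y
            · simp [h3, hyt.symm]; omega
            · simp [h1, h2, h3]
      simp only [List.mem_singleton, forall_eq, List.not_mem_nil, false_imp_iff, implies_true,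
        true_and, iff_true]
      exact and_congr_right fun h => by rw [this h]
  | false =>
    refine ((does_drain (c := 1) hX' y [x] [.tmp] hs.marked ?_ (hyB.trans hXB)).seq hX'
      fun hle => (does_isZero hX' x false _).seq hX' fun hz =>
        does_drain (c := 1) (s := s.mv [y, x] [.tmp] (s.reg y)) hX' .tmp [] [x, y]
        hs.marked ?_ ?_).congr hX' (by omega) fun s' => ?_
    · simp [Reg.Bounded]
    · simp at hle
      intro r hr _ hb
      have : r = x ∨ r = y := by simpa using hr
      rcases this with rfl | rfl <;> simp [St.mv, hxt, hyt, ht] <;> omega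
    · simp [St.mv, hxt, hyt, ht]; omega
    · have : s.reg y ≤ s.reg x → (s.mv [y, x] [.tmp] (s.reg y)).mv [.tmp] [x, y]
          ((s.mv [y, x] [.tmp] (s.reg y)).reg .tmp) = s := by
        intro hle
        ext r <;> try rfl
        simp only [St.mv, List.mem_cons, List.not_mem_nil, or_false, hxt, hyt, if_false, if_true,
          ht]
        by_cases h1 : r = .tmp
        · simp [h1, hxt, hyt, ht]
        · by_cases h2 : r = x
          · simp [h2, hxt.symm]; omega
          · by_cases h3 : r = y
            · simp [h3, hyt.symm]
            · simp [h1, h2, h3]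
      simp only [List.mem_singleton, forall_eq, List.not_mem_nil, false_imp_iff, implies_true,
        true_and, iff_false, Bool.false_eq_true]
      rw [← and_assoc]
      have h3 : (s.mv [y, x] [.tmp] (s.reg y)).reg x = s.reg x - s.reg y := by
        simp [St.mv]
      rw [h3]
      constructor
      · rintro ⟨⟨h1, h2⟩, rfl⟩
        exact ⟨by omega, this h1⟩
      · rintro ⟨h1, rfl⟩
        exact ⟨⟨by omega, by omega⟩, (this (by omega)).symm⟩

/-! ### Array access -/

/-- The address of an array entry. -/
def address (B : ℕ) (a : ℕ) (l : List ℕ) : ℕ := l.foldl (fun a x => a * (B + 1) + x) a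

theorem address_lt {B : ℕ} {l : List ℕ} (hl : ∀ x ∈ l, x ≤ B) (a : ℕ) :
    address B a l < (a + 1) * (B + 1) ^ l.length := by
  induction l generalizing a with
  | nil => simp [address]
  | cons x l ih =>
    have := ih (fun y hy => hl y (by simp [hy])) (a * (B + 1) + x)
    simp only [address, List.foldl_cons, List.length_cons] at this ⊢
    refine this.trans_le ?_
    rw [pow_succ', ← mul_assoc]
    refine Nat.mul_le_mul_right _ ?_
    have := hl x (by simp)
    nlinarith

/-- Uniqueness of digits in base `B + 1`, with `a` and `b` as leading parts. Equal lengths are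
required because leading zeros leave no trace. -/
theorem address_injective {B : ℕ} {l m : List ℕ} (hlen : l.length = m.length)
    (hl : ∀ x ∈ l, x ≤ B) (hm : ∀ x ∈ m, x ≤ B) {a b : ℕ}
    (h : address B a l = address B b m) : a = b ∧ l = m := by
  induction l generalizing m a b with
  | nil =>
    obtain rfl := List.length_eq_zero_iff.1 hlen.symm
    exact ⟨h, rfl⟩
  | cons x l ih =>
    cases m with
    | nil => simp at hlen
    | cons y m =>
      obtain ⟨h1, h2⟩ := ih (m := m) (a := a * (B + 1) + x) (b := b * (B + 1) + y)
        (by simpa using hlen) (fun z hz => hl z (by simp [hz]))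
        (fun z hz => hm z (by simp [hz])) h
      have hx := hl x (by simp)
      have hy := hm y (by simp)
      have h3 : x = y := by
        have := congrArg (· % (B + 1)) h1
        simpa [Nat.add_mod, Nat.mod_eq_of_lt (Nat.lt_succ_of_le hx),
          Nat.mod_eq_of_lt (Nat.lt_succ_of_le hy)] using this
      subst h3
      have h4 : a = b := by
        have : a * (B + 1) = b * (B + 1) := by omega
        exact Nat.eq_of_mul_eq_mul_right (by omega) this
      exact ⟨h4, by rw [h2]⟩

theorem Exact.then {α S : Type} {step : α → S → S → Prop} {X a b : ℕ}
    {P P' : RegularExpression α} {s u : S}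
    {Q' : S → Prop} (hX : 2 ≤ X) (h : Exact step X a P s fun s' => s' = u)
    (h' : Exact step X b P' u Q') : Exact step X (a + b + 1) (P * P') s Q' :=
  (Exact.seq (p := True) hX (h.congr hX le_rfl fun _ => by simp) fun _ => h').congr hX le_rfl
    fun _ => by simp

/-- Multiplication by `B + 1`, where `B` is available only as a mark: each unit of `addr`
contributes one unit to `aux` by the move and `B` more while `cnt` climbs from zero to its mark. -/
theorem does_scale (hX : B + 2 ≤ X) {s : St} (hs : s.Marked B) (hcnt : s.reg .cnt = 0) {c : ℕ}
    (hc : s.reg .addr ≤ X ^ c) :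
    Does X (c + 9) Prog.scale s fun s' =>
      s' = (s.setReg .aux (s.reg .aux + s.reg .addr * (B + 1))).setReg .addr 0 := by
  have hX' : 2 ≤ X := by omega
  have := exact_loop (step := Op.Step) (a := 6) (b := 0)
    (P := Prog.move [.addr] [.aux] * (Prog.climb .cnt [.aux] * Prog.drain .cnt [] []))
    (E := Prog.op (.isZero .addr true)) hX'
    (fun i => (s.setReg .aux (s.reg .aux + i * (B + 1))).setReg .addr (s.reg .addr - i))
    (fun _ => True)
    (fun s' => s' = (s.setReg .aux (s.reg .aux + s.reg .addr * (B + 1))).setReg .addr 0) ?_ ?_ hc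
  · have h0 : (s.setReg .aux (s.reg .aux + 0 * (B + 1))).setReg .addr (s.reg .addr - 0) = s := by
      simp [St.setReg]
    rw [h0] at this
    exact this.congr hX' (by omega) fun s' => by simp
  · intro i hi
    set s1 := (s.setReg .aux (s.reg .aux + i * (B + 1))).setReg .addr (s.reg .addr - i) with hs1
    have h1 : Does X 2 (Prog.climb .cnt [.aux]) (s1.mv [.addr] [.aux] 1) fun s' =>
        s' = (s1.mv [.addr] [.aux] 1).mv [] [.cnt, .aux] B :=
      does_climb hX .cnt [.aux] hs (by decide)
        (by simp [hs1, St.mv, St.setReg, Function.update_apply, hcnt]) (by simp [Reg.Bounded])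
    have h2 := does_drain (c := 1) (s := (s1.mv [.addr] [.aux] 1).mv [] [.cnt, .aux] B)
      hX' .cnt [] [] hs (by simp) (by
        simp [hs1, St.mv, St.setReg, Function.update_apply, hcnt]
        omega)
    have h3 : Does X 0 (Prog.move [.addr] [.aux]) s1 _ := does_move hX' [.addr] [.aux] hs
    refine (h3.seq hX' fun _ => h1.then hX' h2).congr hX' le_rfl fun s' => ?_
    · have hS : ((s1.mv [.addr] [.aux] 1).mv [] [.cnt, .aux] B).mv [.cnt] []
          (((s1.mv [.addr] [.aux] 1).mv [] [.cnt, .aux] B).reg .cnt) =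
          ((s.setReg .aux (s.reg .aux + (i + 1) * (B + 1))).setReg .addr
            (s.reg .addr - (i + 1))) := by
        ext r <;> try rfl
        simp only [hs1, St.mv, St.setReg, Function.update_apply]
        by_cases h1 : r = .addr
        · simp [h1]; omega
        · by_cases h2 : r = .aux
          · simp [h2]; ring
          · by_cases h3 : r = .cnt
            · simp [h3, hcnt]
            · simp [h1, h2, h3]
      simp only [hS, List.mem_singleton, forall_eq, List.not_mem_nil, false_imp_iff, implies_true,
        true_and]
      refine and_congr_left fun _ => ?_
      simp [hs1, St.setReg, Reg.Bounded]
      omega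
  · intro i hi
    refine (does_isZero hX' .addr true _).congr hX' le_rfl fun s' => ?_
    simp only [St.setReg, Function.update_self, iff_true]
    constructor
    · rintro ⟨h1, rfl⟩
      obtain rfl : i = s.reg .addr := by omega
      simp
    · rintro ⟨rfl, rfl⟩
      simp

/-- All working counters but `addr` are zero. -/
structure St.Working (B : ℕ) (s : St) : Prop where
  marked : s.Marked B
  aux : s.reg .aux = 0
  tmp : s.reg .tmp = 0
  cnt : s.reg .cnt = 0
  le : ∀ r : Reg, r.Bounded → s.reg r ≤ B

theorem St.Ready.working {s : St} (hs : s.Ready B) : s.Working B :=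
  ⟨hs.marked, hs.aux, hs.tmp, hs.cnt, hs.le⟩

theorem St.Working.setAddr {s : St} (hs : s.Working B) (a : ℕ) : (s.setReg .addr a).Working B :=
  ⟨hs.marked, by simp [St.setReg, hs.aux], by simp [St.setReg, hs.tmp],
    by simp [St.setReg, hs.cnt], fun r hr => by
      have := hs.le r hr
      simpa [St.setReg, Function.update_apply, hr.1] using this⟩

/-- Addresses exceed `B`, so `addr` and `aux` must be unbounded counters. The digit `x` is added to
`addr` and restored from its copy in `tmp`. -/
theorem does_push (hX : B + 2 ≤ X) {x : Reg} (hx : x.Free) {s : St} (hs : s.Working B) {c : ℕ}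
    (hc : s.reg .addr ≤ X ^ c) :
    Does X (2 * c + 20) (Prog.push x) s fun s' =>
      s' = s.setReg .addr (s.reg .addr * (B + 1) + s.reg x) := by
  have hX' : 2 ≤ X := by omega
  have hxa : x ≠ .addr := hx.1.1
  have hxu : x ≠ .aux := hx.1.2.1
  have hxt : x ≠ .tmp := hx.1.2.2
  have hxB := hs.le x hx.1
  set s1 := (s.setReg .aux (s.reg .aux + s.reg .addr * (B + 1))).setReg .addr 0 with hs1
  have h1 := does_scale hX hs.marked hs.cnt hc
  have h2 : Does X (c + 2) (Prog.drain .aux [] [.addr]) s1 fun s' =>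
      s' = s1.mv [.aux] [.addr] (s.reg .addr * (B + 1)) := by
    refine (does_drain (c := c + 1) (s := s1) hX' .aux [] [.addr] hs.marked
      (by simp [Reg.Bounded]) ?_).congr hX' (by omega) ?_
    · simp [hs1, St.setReg, hs.aux]
      rw [pow_succ]
      exact Nat.mul_le_mul hc (by omega)
    · simp [hs1, St.setReg, hs.aux]
  set s2 := s1.mv [.aux] [.addr] (s.reg .addr * (B + 1)) with hs2
  have h3 : Does X 2 (Prog.drain x [] [.tmp, .addr]) s2 fun s' =>
      s' = s2.mv [x] [.tmp, .addr] (s.reg x) := by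
    refine (does_drain (c := 1) (s := s2) hX' x [] [.tmp, .addr] hs.marked
        (by simp [Reg.Bounded]) ?_).congr hX' (by omega) ?_
    · simp [hs2, hs1, St.mv, St.setReg, hxa, hxu]
      omega
    · simp [hs2, hs1, St.mv, St.setReg, hxa, hxu]
  set s3 := s2.mv [x] [.tmp, .addr] (s.reg x) with hs3
  have h4 : Does X 2 (Prog.drain .tmp [] [x]) s3 fun s' => s' = s3.mv [.tmp] [x] (s.reg x) := by
    refine (does_drain (c := 1) (s := s3) hX' .tmp [] [x] hs.marked ?_ ?_).congr hX' (by omega) ?_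
    · simp [hs3, hs2, hs1, St.mv, St.setReg, hxa, hxu, hxt, hs.tmp, hxt.symm]
      omega
    · simp [hs3, hs2, hs1, St.mv, St.setReg, hs.tmp, hxt.symm]
      omega
    · simp [hs3, hs2, hs1, St.mv, St.setReg, hs.tmp, hxt.symm]
  refine (h1.then hX' (h2.then hX' (h3.then hX' h4))).congr hX' (by omega) fun s' =>
    Eq.congr_right ?_
  ext r <;> try rfl
  simp only [hs3, hs2, hs1, St.mv, St.setReg, Function.update_apply]
  by_cases h1 : r = .addr
  · simp [h1, hxa.symm]
  · by_cases h2 : r = .aux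
    · simp [h2, hxu.symm, hs.aux]
    · by_cases h3 : r = .tmp
      · simp [h3, hxt.symm, hs.tmp]
      · by_cases h4 : r = x
        · simp [h4, hxa, hxu, hxt]
        · simp [h1, h2, h3, h4]

theorem does_pushAll (hX : B + 2 ≤ X) {xs : List Reg} (hxs : ∀ x ∈ xs, x.Free) {s : St}
    (hs : s.Working B) {c : ℕ} (hc : s.reg .addr < X ^ c) :
    Does X ((2 * (c + xs.length) + 21) * xs.length) (Prog.pushAll xs) s fun s' =>
      s' = s.setReg .addr (address B (s.reg .addr) (xs.map s.reg)) := by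
  have hX' : 2 ≤ X := by omega
  induction xs generalizing s c with
  | nil =>
    intro s'
    have : s.setReg .addr (address B (s.reg .addr) (List.map s.reg [])) = s := by
      simp [address, St.setReg]
    rw [this]
    constructor
    · rintro ⟨l, hl, h⟩
      obtain rfl : l = [] := hl
      exact Eq.symm h
    · rintro rfl
      exact ⟨[], rfl, Nat.zero_le _, rfl⟩
  | cons x xs ih =>
    have hx := hxs x (by simp)
    -- Each digit multiplies the address by at most `X`, hence `c + 1`; the growing exponents sum up
    -- to a quadratic one.
    have h := (does_push hX hx hs hc.le).then hX' (ih
      (s := s.setReg .addr (s.reg .addr * (B + 1) + s.reg x)) (c := c + 1)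
      (fun y hy => hxs y (by simp [hy])) (hs.setAddr _) (by
        have := hs.le x hx.1
        simp only [St.setReg, Function.update_self]
        rw [pow_succ]
        nlinarith))
    refine h.congr hX' ?_ fun s' => Eq.congr_right ?_
    · simp only [List.length_cons]
      nlinarith
    · have h1 : xs.map (s.setReg .addr (s.reg .addr * (B + 1) + s.reg x)).reg = xs.map s.reg := by
        refine List.map_congr_left fun y hy => ?_
        have := (hxs y (by simp [hy])).1.1
        simp [St.setReg, this]
      rw [h1]
      ext r <;> try rfl
      simp only [St.setReg, Function.update_apply, address]
      by_cases h1 : r = .addr <;> simp [h1]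

/-- An exponent for the time of an array access. -/
def accessTime (n : ℕ) : ℕ := (2 * n + 21) * n + n + 5

theorem address_reg_lt (hX : B + 2 ≤ X) {xs : List Reg} (hxs : ∀ x ∈ xs, x.Free) {s : St}
    (hs : s.Ready B) : address B 0 (xs.map s.reg) < X ^ xs.length := by
  have := address_lt (B := B) (l := xs.map s.reg) (by
    simp only [List.mem_map]
    rintro _ ⟨x, hx, rfl⟩
    exact hs.le x (hxs x hx).1) 0
  simp only [zero_add, one_mul, List.length_map] at this
  exact this.trans_le (Nat.pow_le_pow_left (by omega) _)

theorem does_test (hX : B + 2 ≤ X) {xs : List Reg} (hxs : ∀ x ∈ xs, x.Free) {s : St}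
    (hs : s.Ready B) (f : Arr) (b : Bool) :
    Does X (accessTime xs.length) (Prog.test f xs b) s fun s' =>
      s.arr f (address B 0 (xs.map s.reg)) = b ∧ s' = s := by
  have hX' : 2 ≤ X := by omega
  have h := does_pushAll (c := 0) hX hxs hs.working (by simp [hs.addr])
  rw [hs.addr] at h
  refine (h.then hX' ((does_op (.bit f b) _).seq hX' fun _ =>
    does_drain (c := xs.length) (s := s.setReg .addr (address B 0 (xs.map s.reg))) hX' .addr [] []
      hs.marked (by simp) ?_)).congr hX' ?_ fun s' => ?_
  · simp only [St.setReg, Function.update_self]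
    exact (address_reg_lt hX hxs hs).le
  · simp [accessTime]
    omega
  · simp only [St.setReg, Function.update_self, List.not_mem_nil, false_imp_iff, implies_true,
        true_and]
    refine and_congr_right fun _ => Eq.congr_right ?_
    ext r <;> try rfl
    simp only [St.mv, Function.update_apply]
    by_cases h1 : r = .addr
    · simp [h1, hs.addr]
    · simp [h1]

/-- Set an array entry. -/
def St.setBit (s : St) (f : Arr) (a : ℕ) : St :=
  { s with arr := fun g i => if g = f ∧ i = a then true else s.arr g i }

theorem does_write (hX : B + 2 ≤ X) {xs : List Reg} (hxs : ∀ x ∈ xs, x.Free) {s : St}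
    (hs : s.Ready B) (f : Arr) :
    Does X (accessTime xs.length) (Prog.write f xs) s fun s' =>
      s' = s.setBit f (address B 0 (xs.map s.reg)) := by
  have hX' : 2 ≤ X := by omega
  have h := does_pushAll (c := 0) hX hxs hs.working (by simp [hs.addr])
  rw [hs.addr] at h
  refine (h.then hX' (Exact.then (a := 0) hX' ((does_op (.set f) _).congr hX' le_rfl fun s' => by
      simp [Op.Step, St.setBit, St.setReg])
    (does_drain (c := xs.length)
      (s := (s.setReg .addr (address B 0 (xs.map s.reg))).setBit f (address B 0 (xs.map s.reg)))
      hX' .addr [] [] hs.marked (by simp) ?_))).congr hX' ?_ fun s' => ?_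
  · simp only [St.setBit, St.setReg, Function.update_self]
    exact (address_reg_lt hX hxs hs).le
  · simp [accessTime]
    omega
  · simp only [St.setBit, St.setReg, Function.update_self, List.not_mem_nil, false_imp_iff,
      implies_true, true_and]
    refine Eq.congr_right ?_
    ext r <;> try rfl
    simp only [St.mv, Function.update_apply]
    by_cases h1 : r = .addr
    · simp [h1, hs.addr]
    · simp [h1]

/-! ### Formulas -/

/-- First-order formulas over `{0, …, B}` with bounded quantifiers, in negation normal form. -/
inductive Form where
  | le (x y : Reg) (b : Bool)
  | rel (f : Arr) (xs : List Reg) (b : Bool)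
  | and (φ ψ : Form)
  | or (φ ψ : Form)
  | all (i : Fin 12) (φ : Form)
  | ex (i : Fin 12) (φ : Form)

namespace Form

/-- The truth of a formula. -/
def Eval (B : ℕ) (A : Arr → ℕ → Bool) : Form → (Reg → ℕ) → Prop
  | le x y b, v => v x ≤ v y ↔ b = true
  | rel f xs b, v => A f (address B 0 (xs.map v)) = b
  | and φ ψ, v => φ.Eval B A v ∧ ψ.Eval B A v
  | or φ ψ, v => φ.Eval B A v ∨ ψ.Eval B A v
  | all i φ, v => ∀ a ≤ B, φ.Eval B A (Function.update v (.var i) a)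
  | ex i φ, v => ∃ a ≤ B, φ.Eval B A (Function.update v (.var i) a)

/-- The negation of a formula. -/
def neg : Form → Form
  | le x y b => le x y !b
  | rel f xs b => rel f xs !b
  | and φ ψ => or φ.neg ψ.neg
  | or φ ψ => and φ.neg ψ.neg
  | all i φ => ex i φ.neg
  | ex i φ => all i φ.neg

theorem eval_neg {A : Arr → ℕ → Bool} (φ : Form) (v : Reg → ℕ) :
    φ.neg.Eval B A v ↔ ¬ φ.Eval B A v := by
  induction φ generalizing v with
  | le x y b => cases b <;> simp [neg, Eval]
  | rel f xs b => cases b <;> simp [neg, Eval]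
  | and φ ψ h1 h2 => simp only [neg, Eval, h1, h2]; tauto
  | or φ ψ h1 h2 => simp only [neg, Eval, h1, h2]; tauto
  | all i φ h => simp [neg, Eval, h]
  | ex i φ h => simp [neg, Eval, h]

/-- Implication. -/
def imp (φ ψ : Form) : Form := or φ.neg ψ

theorem eval_imp {A : Arr → ℕ → Bool} (φ ψ : Form) (v : Reg → ℕ) :
    (φ.imp ψ).Eval B A v ↔ (φ.Eval B A v → ψ.Eval B A v) := by
  simp only [imp, Eval, eval_neg]
  tauto

/-- The bound variables of a formula. -/
def bound : Form → List (Fin 12)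
  | le _ _ _ => []
  | rel _ _ _ => []
  | and φ ψ => φ.bound ++ ψ.bound
  | or φ ψ => φ.bound ++ ψ.bound
  | all i φ => i :: φ.bound
  | ex i φ => i :: φ.bound

/-- No variable is bound twice on a branch, and only available counters occur. -/
def Ok : Form → Prop
  | le x y _ => x.Free ∧ y.Free
  | rel _ xs _ => ∀ x ∈ xs, x.Free
  | and φ ψ => φ.Ok ∧ ψ.Ok
  | or φ ψ => φ.Ok ∧ ψ.Ok
  | all i φ => i ∉ φ.bound ∧ φ.Ok
  | ex i φ => i ∉ φ.bound ∧ φ.Ok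

instance decidableOk : DecidablePred Ok
  | le _ _ _ => inferInstanceAs (Decidable (_ ∧ _))
  | rel _ xs _ => inferInstanceAs (Decidable (∀ x ∈ xs, x.Free))
  | and φ ψ => @instDecidableAnd _ _ (decidableOk φ) (decidableOk ψ)
  | or φ ψ => @instDecidableAnd _ _ (decidableOk φ) (decidableOk ψ)
  | all _ φ => @instDecidableAnd _ _ _ (decidableOk φ)
  | ex _ φ => @instDecidableAnd _ _ _ (decidableOk φ)

/-- The program that checks a formula. -/
def prog : Form → Prog
  | le x y b => Prog.le x y b
  | rel f xs b => Prog.test f xs b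
  | and φ ψ => φ.prog * ψ.prog
  | or φ ψ => φ.prog + ψ.prog
  | all i φ => (φ.prog * Prog.move [] [.var i]).star *
      (φ.prog * (Prog.op (.isMax (.var i)) * Prog.drain (.var i) [] []))
  | ex i φ => (Prog.move [] [.var i]).star * (φ.prog * Prog.drain (.var i) [] [])

/-- An exponent for the time of the check. -/
def time : Form → ℕ
  | le _ _ _ => 7
  | rel _ xs _ => accessTime xs.length
  | and φ ψ => φ.time + ψ.time + 1
  | or φ ψ => φ.time + ψ.time + 1
  | all _ φ => 2 * φ.time + 10
  | ex _ φ => φ.time + 10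

end Form

theorem St.Ready.setVar {s : St} (hs : s.Ready B) (i : Fin 12) {a : ℕ} (ha : a ≤ B) :
    (s.setReg (.var i) a).Ready B :=
  ⟨hs.marked, by simp [St.setReg, hs.addr], by simp [St.setReg, hs.aux],
    by simp [St.setReg, hs.tmp], by simp [St.setReg, hs.cnt], fun r hr => by
      by_cases h : r = .var i
      · simp [St.setReg, h, ha]
      · simpa [St.setReg, h] using hs.le r hr⟩

theorem St.mv_var {s : St} {i : Fin 12} {a : ℕ} :
    (s.setReg (.var i) a).mv [] [.var i] 1 = s.setReg (.var i) (a + 1) := by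
  ext r <;> try rfl
  by_cases h : r = .var i <;> simp [St.mv, St.setReg, h]

theorem St.mv_var_zero {s : St} {i : Fin 12} {a : ℕ} (h0 : s.reg (.var i) = 0) :
    (s.setReg (.var i) a).mv [.var i] [] a = s := by
  ext r <;> try rfl
  by_cases h : r = .var i <;> simp [St.mv, St.setReg, h, h0]

/-- A universal quantifier is a counting loop over its variable, an existential one a guess by
counting up to an arbitrary value. Each variable starts at zero and is cleared afterwards, so the
check leaves the state unchanged; this is why a variable must not be bound again inside its own
scope. -/
theorem Form.does_prog (hX : B + 2 ≤ X) (φ : Form) (hφ : φ.Ok) {s : St} (hs : s.Ready B)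
    (h0 : ∀ i ∈ φ.bound, s.reg (.var i) = 0) :
    Does X φ.time φ.prog s fun s' => φ.Eval B s.arr s.reg ∧ s' = s := by
  have hX' : 2 ≤ X := by omega
  induction φ generalizing s with
  | le x y b => exact does_le hX hφ.1 hφ.2 b hs
  | rel f xs b => exact does_test hX hφ hs f b
  | and φ ψ h1 h2 =>
    exact ((h1 hφ.1 hs fun i hi => h0 i (by simp [bound, hi])).seq hX' fun _ =>
      h2 hφ.2 hs fun i hi => h0 i (by simp [bound, hi])).congr hX' le_rfl fun s' => by
        simp only [Eval, and_assoc]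
  | or φ ψ h1 h2 =>
    exact ((h1 hφ.1 hs fun i hi => h0 i (by simp [bound, hi])).add hX'
      (h2 hφ.2 hs fun i hi => h0 i (by simp [bound, hi]))).congr hX' le_rfl fun s' => by
        simp only [Eval, or_and_right]
  | all i φ h =>
    have hi0 : s.reg (.var i) = 0 := h0 i (by simp [bound])
    have hbody : ∀ a ≤ B, Does X φ.time φ.prog (s.setReg (.var i) a) fun s' =>
        φ.Eval B s.arr (Function.update s.reg (.var i) a) ∧ s' = s.setReg (.var i) a :=
      fun a ha => h hφ.2 (hs.setVar i ha) fun j hj => by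
        have hji : j ≠ i := fun h => hφ.1 (h ▸ hj)
        have := h0 j (by simp [bound, hj])
        simp [St.setReg, hji, this]
    -- The value `B` is checked by the exit, since the increment at the end of a round would block
    -- there.
    have := exact_loop (step := Op.Step) (a := φ.time + 1) (b := φ.time + 4) (c := 1) (n := B)
      (P := φ.prog * Prog.move [] [.var i])
      (E := φ.prog * (Prog.op (.isMax (.var i)) * Prog.drain (.var i) [] [])) hX'
      (fun a => s.setReg (.var i) a)
      (fun a => φ.Eval B s.arr (Function.update s.reg (.var i) a))
      (fun s' => φ.Eval B s.arr (Function.update s.reg (.var i) B) ∧ s' = s) ?_ ?_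
      (by simp; omega)
    · have h1 : s.setReg (.var i) 0 = s := by
        rw [← hi0]
        simp [St.setReg]
      rw [h1] at this
      refine this.congr hX' (by simp [time]; omega) fun s' => ?_
      rw [← and_assoc]
      refine and_congr_left fun _ => ?_
      constructor
      · rintro ⟨h1, h2⟩ a ha
        rcases ha.lt_or_eq with h | rfl
        · exact h1 a h
        · exact h2
      · exact fun h => ⟨fun a ha => h a ha.le, h B le_rfl⟩
    · intro a ha
      refine ((hbody a ha).seq hX' fun _ => does_move hX' [] [.var i] (s := s.setReg (.var i) a)
        hs.marked).congr hX' le_rfl fun s' => ?_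
      rw [St.mv_var]
      simp [St.setReg, Reg.Bounded]
      constructor
      · rintro ⟨h1, h2, h3⟩
        exact ⟨by omega, h1, h3⟩
      · rintro ⟨h1, h2, h3⟩
        exact ⟨h2, by omega, h3⟩
    · intro a ha
      refine ((hbody a ha).seq hX' fun _ => (does_isMax hX' (.var i) (s := s.setReg (.var i) a)
        hs.marked).seq hX' fun _ => does_drain (c := 1) hX' (.var i) [] []
          (s := s.setReg (.var i) a) hs.marked (by simp) ?_).congr hX' (by omega) fun s' => ?_
      · simp [St.setReg]
        omega
      · have h2 : (s.setReg (.var i) a).reg (.var i) = a := by simp [St.setReg]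
        rw [h2, St.mv_var_zero hi0]
        simp [Reg.Bounded]
        constructor
        · rintro ⟨h1, rfl, h3⟩
          exact ⟨rfl, h1, h3⟩
        · rintro ⟨rfl, h2, h3⟩
          exact ⟨h2, rfl, h3⟩
  | ex i φ h =>
    have hi0 : s.reg (.var i) = 0 := h0 i (by simp [bound])
    have hbody : ∀ a ≤ B, Does X φ.time φ.prog (s.setReg (.var i) a) fun s' =>
        φ.Eval B s.arr (Function.update s.reg (.var i) a) ∧ s' = s.setReg (.var i) a :=
      fun a ha => h hφ.2 (hs.setVar i ha) fun j hj => by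
        have hji : j ≠ i := fun h => hφ.1 (h ▸ hj)
        have := h0 j (by simp [bound, hj])
        simp [St.setReg, hji, this]
    have h1 : s.setReg (.var i) 0 = s := by
      rw [← hi0]
      simp [St.setReg]
    have := exact_star_chain (step := Op.Step) (X := X) (a := 0) (c := 1) (n := B)
      (P := Prog.move [] [.var i]) (fun a => s.setReg (.var i) a) (fun _ => True) ?_
      (by simp; omega)
    · rw [h1] at this
      refine (Exact.mul (b := φ.time + 3) (Q' := fun u s' => φ.Eval B u.arr u.reg ∧ s' = s)
        hX' this ?_).congr hX' (by simp [time]; omega) fun s' => ?_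
      · rintro _ ⟨a, ha, -, rfl⟩
        refine ((hbody a ha).seq hX' fun _ => does_drain (c := 1) hX' (.var i) [] []
          (s := s.setReg (.var i) a) hs.marked (by simp) ?_).congr hX' (by omega) fun s' => ?_
        · simp [St.setReg]
          omega
        · have h2 : (s.setReg (.var i) a).reg (.var i) = a := by simp [St.setReg]
          rw [h2, St.mv_var_zero hi0]
          simp [St.setReg]
      · constructor
        · rintro ⟨_, ⟨a, ha, -, rfl⟩, h3, h4⟩
          exact ⟨⟨a, ha, h3⟩, h4⟩
        · rintro ⟨⟨a, ha, h3⟩, h4⟩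
          exact ⟨_, ⟨a, ha, by simp, rfl⟩, h3, h4⟩
    · intro a ha
      refine (does_move hX' [] [.var i] (s := s.setReg (.var i) a)
        hs.marked).congr hX' le_rfl fun s' => ?_
      rw [St.mv_var]
      simp [St.setReg, Reg.Bounded]
      intro _
      omega

/-! ### The initialization -/

/-- A state with cleared counters. -/
def St.base (B : ℕ) (A : Arr → ℕ → Bool) (w : List InputSym) : St :=
  ⟨w, fun _ => 0, A, fun r i => decide (r.Bounded ∧ i = B)⟩

/-- The list of the bounded counters. -/
noncomputable def boundedRegs : List Reg := (Finset.univ.filter Reg.Bounded).toList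

theorem mem_boundedRegs {r : Reg} : r ∈ boundedRegs ↔ r.Bounded := by
  simp [boundedRegs]

namespace Prog

/-- Choose a maximal value for the bounded counters. -/
noncomputable def chooseMax : Prog :=
  (move [] boundedRegs).star * (op .setMax * drain .cnt boundedRegs [])

/-- Choose the contents of the certificate arrays. -/
def chooseCert : Prog := (op .guess * move [] [.addr]).star * drain .addr [] []

end Prog

/-- The bounded counters rise in parallel without marks, the common value is then marked, and all of
them are cleared. Nothing forces `B` to be large, so everything that follows must be sound for every
`B`. -/
theorem leads_chooseMax {w : List InputSym} {s' : St}
    (h : Leads Op.Step Prog.chooseMax (St.start w) s') :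
    ∃ B, s' = St.base B (fun _ _ => false) w := by
  obtain ⟨s1, h1, h2⟩ := leads_mul.1 h
  obtain ⟨s2, h2, h3⟩ := leads_mul.1 h2
  obtain ⟨B, rfl⟩ : ∃ B, s1 = { St.start w with reg := fun r => if r.Bounded then B else 0 } := by
    refine Leads.star_invariant (I := fun s1 => ∃ B, s1 = { St.start w with
      reg := fun r => if r.Bounded then B else 0 }) ?_ h1 ⟨0, by simp [St.start]⟩
    rintro _ u ⟨B, rfl⟩ hu
    obtain ⟨-, -, rfl⟩ := leads_char.1 hu
    refine ⟨B + 1, ?_⟩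
    ext r <;> try rfl
    by_cases hr : r.Bounded <;> simp [shiftReg, hr, mem_boundedRegs]
  refine ⟨B, ?_⟩
  obtain rfl := leads_char.1 h2
  -- Only the untimed half of the specification is used, so any admissible base will do.
  have := ((does_drain (B := B) (X := B + 2) (c := 1) (by omega) .cnt boundedRegs [] (by
    intro r i
    by_cases hr : r.Bounded <;> simp [St.start, hr]) (by simp) (by
      simp [Reg.Bounded])) _).1 h3
  rw [this.2]
  ext r <;> try rfl
  · by_cases hr : r.Bounded <;> simp [St.mv, St.base, mem_boundedRegs, hr]
    · simp [Reg.Bounded]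
  · rename_i i
    by_cases hr : r.Bounded <;> simp [St.mv, St.base, St.start, hr]

theorem reaches_chooseMax (hX : B + 2 ≤ X) (w : List InputSym) :
    Reaches Op.Step Prog.chooseMax (X ^ 6) (St.start w) (St.base B (fun _ _ => false) w) := by
  have hX' : 2 ≤ X := by omega
  let s1 : ℕ → St := fun i => { St.start w with reg := fun r => if r.Bounded then i else 0 }
  have h1 : Reaches Op.Step (Prog.move [] boundedRegs).star (B * 1) (s1 0) (s1 B) := by
    refine reaches_star_of_chain s1 fun i hi => reaches_char ⟨by simp, by simp [s1, St.start], ?_⟩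
    ext r <;> try rfl
    by_cases hr : r.Bounded <;> simp [s1, shiftReg, hr, mem_boundedRegs]
  have h0 : s1 0 = St.start w := by simp [s1, St.start]
  rw [h0] at h1
  let s2 : St := { s1 B with mark := fun r i => decide (r.Bounded ∧ i = B) }
  have h2 : Reaches Op.Step (Prog.op .setMax) 1 (s1 B) s2 := by
    refine reaches_char ?_
    ext r <;> try rfl
    rename_i i
    by_cases hr : r.Bounded <;> simp [s1, s2, St.start, hr]
  have h3 := ((does_drain (s := s2) (B := B) (X := X) (c := 1) hX' .cnt boundedRegs []
    (fun _ _ => rfl) (by simp) (by simp [s1, s2, Reg.Bounded]; omega))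
      (St.base B (fun _ _ => false) w)).2 (by
        constructor
        · intro r hr
          simp [s1, s2, mem_boundedRegs.1 hr]
          simp [Reg.Bounded]
        · ext r <;> try rfl
          by_cases hr : r.Bounded <;> simp [St.mv, St.base, s1, s2, mem_boundedRegs, hr]
          · simp [Reg.Bounded])
  refine (h1.mul (h2.mul h3)).mono ?_
  have e1 := pow_add_pow_le_pow hX' 1 4
  have e2 := pow_add_pow_le_pow hX' 1 2
  rw [pow_one] at e1 e2
  norm_num at e1 e2 ⊢
  omega

/-- The input arrays stay empty while the certificate is guessed, so that later they contain exactly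
what the parser writes. -/
theorem leads_chooseCert {w : List InputSym} {s' : St}
    (h : Leads Op.Step Prog.chooseCert (St.base B (fun _ _ => false) w) s') :
    ∃ A : Arr → ℕ → Bool, (∀ f a, f.IsCert = false → A f a = false) ∧ s' = St.base B A w := by
  obtain ⟨s1, h1, h2⟩ := leads_mul.1 h
  obtain ⟨M, A, hA, rfl⟩ : ∃ (M : ℕ) (A : Arr → ℕ → Bool),
      (∀ f a, f.IsCert = false → A f a = false) ∧ s1 = (St.base B A w).setReg .addr M := by
    refine Leads.star_invariant (I := fun s1 => ∃ (M : ℕ) (A : Arr → ℕ → Bool),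
      (∀ f a, f.IsCert = false → A f a = false) ∧ s1 = (St.base B A w).setReg .addr M) ?_ h1
      ⟨0, _, fun _ _ _ => rfl, by simp [St.base, St.setReg]⟩
    rintro _ u ⟨M, A, hA, rfl⟩ hu
    obtain ⟨v, hv, hu⟩ := leads_mul.1 hu
    obtain ⟨c, rfl⟩ := leads_char.1 hv
    obtain ⟨-, -, rfl⟩ := leads_char.1 hu
    refine ⟨M + 1, fun g a => if g.IsCert = true ∧ a = M then c g else A g a, ?_, ?_⟩
    · intro f a hf
      simp [hf, hA]
    · ext r <;> try rfl
      by_cases hr : r = .addr <;> simp [St.setReg, shiftReg, St.base, hr]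
  refine ⟨A, hA, ?_⟩
  have := ((does_drain (B := B) (X := M + 2) (c := 1) (by omega) .addr [] [] (fun _ _ => rfl)
    (by simp) (by simp [St.setReg])) _).1 h2
  rw [this.2]
  ext r <;> try rfl
  by_cases hr : r = .addr <;> simp [St.mv, St.base, St.setReg, hr]

theorem reaches_chooseCert (hX : 2 ≤ X) (w : List InputSym) {A : Arr → ℕ → Bool}
    (hA : ∀ f a, f.IsCert = false → A f a = false) {c : ℕ} (hc : ∀ f a, X ^ c ≤ a → A f a = false) :
    Reaches Op.Step Prog.chooseCert (X ^ (2 * c + 5)) (St.base B (fun _ _ => false) w)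
      (St.base B A w) := by
  let s1 : ℕ → St := fun i =>
    (St.base B (fun f a => if a < i then A f a else false) w).setReg .addr i
  have h1 : Reaches Op.Step (Prog.op .guess * Prog.move [] [.addr]).star (X ^ c * (1 + 1)) (s1 0)
      (s1 (X ^ c)) := by
    refine reaches_star_of_chain s1 fun i hi => ?_
    refine Reaches.mul (u := (St.base B (fun f a => if a < i + 1 then A f a else false) w).setReg
      .addr i) (reaches_char ⟨fun f => A f i, ?_⟩) (reaches_char ⟨by simp, ?_, ?_⟩)
    · ext f a <;> try rfl
      simp only [s1, St.base, St.setReg, Function.update_self]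
      by_cases ha : a = i
      · subst ha
        cases hf : f.IsCert <;> simp [hA, hf]
      · have : a < i + 1 ↔ a < i := by omega
        simp [ha, this]
    · intro r hr
      have : r = .addr := by
        by_contra h
        simp [h] at hr
      subst this
      simp [St.base, St.setReg, Reg.Bounded]
    · ext r <;> try rfl
      by_cases hr : r = .addr <;> simp [s1, St.base, St.setReg, shiftReg, hr]
  have h0 : s1 0 = St.base B (fun _ _ => false) w := by
    simp [s1, St.base, St.setReg]
  rw [h0] at h1
  have h3 := ((does_drain (s := s1 (X ^ c)) (B := B) (X := X) (c := c) hX .addr [] []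
    (fun _ _ => rfl) (by simp) (by simp [s1, St.setReg]))
      (St.base B A w)).2 (by
        refine ⟨by simp, ?_⟩
        ext r <;> try rfl
        · by_cases hr : r = .addr <;> simp [s1, St.base, St.setReg, St.mv, hr]
        · rename_i a
          simp only [s1, St.base, St.setReg, St.mv]
          split_ifs with ha
          · rfl
          · exact hc _ _ (by omega))
  refine (h1.mul h3).mono ?_
  have e1 := pow_add_pow_le_pow hX (c + 1) (c + 1)
  have e2 : X ^ c * (1 + 1) ≤ X ^ (c + 1) := by
    rw [pow_succ]
    exact Nat.mul_le_mul_left _ hX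
  refine (Nat.add_le_add_right e2 _).trans (e1.trans (Nat.pow_le_pow_right (by omega) (by omega)))

/-! ### Parsing the input -/

/-- The word for a list of tuples of numbers. -/
def rawList (L : List (List ℕ)) : List InputSym :=
  (L.flatMap fun t => InputSym.item :: t.flatMap InputSym.num) ++ [InputSym.close]

namespace St

/-- Replace the unread input. -/
def setInp (s : St) (l : List InputSym) : St := { s with inp := l }

open Classical in
/-- Set a set of bits. -/
noncomputable def setBits (s : St) (p : Arr → ℕ → Prop) : St :=
  { s with arr := fun g i => if p g i then true else s.arr g i }

theorem setBit_eq (s : St) (f : Arr) (a : ℕ) :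
    s.setBit f a = s.setBits fun g i => g = f ∧ i = a := by
  ext <;> try rfl
  simp [setBit, setBits]

/-- Replace the unread input, set bits, and set a counter. -/
noncomputable def put (s : St) (l : List InputSym) (p : Arr → ℕ → Prop) (x : Reg) (v : ℕ) : St :=
  ((s.setInp l).setBits p).setReg x v

theorem put_put (s : St) (l l' : List InputSym) (p q : Arr → ℕ → Prop) (x : Reg) (v v' : ℕ) :
    (s.put l p x v).put l' q x v' = s.put l' (fun g i => p g i ∨ q g i) x v' := by
  ext g a <;> try rfl
  · simp [put, setInp, setBits, setReg]
  · by_cases h2 : p g a <;> by_cases h3 : q g a <;>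
      simp [put, setInp, setBits, setReg, h2, h3]

theorem put_self (s : St) (x : Reg) : s.put s.inp (fun _ _ => False) x (s.reg x) = s := by
  ext g a <;> try rfl
  · simp [put, setInp, setBits, setReg]
  · simp [put, setInp, setBits, setReg]

theorem Ready.setInp {s : St} (hs : s.Ready B) (l : List InputSym) : (s.setInp l).Ready B :=
  ⟨hs.marked, hs.addr, hs.aux, hs.tmp, hs.cnt, hs.le⟩

theorem Ready.setBits {s : St} (hs : s.Ready B) (p : Arr → ℕ → Prop) :
    (s.setBits p).Ready B :=
  ⟨hs.marked, hs.addr, hs.aux, hs.tmp, hs.cnt, hs.le⟩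

theorem Ready.setReg {s : St} (hs : s.Ready B) {x : Reg} (hx : x.Free) {a : ℕ} (ha : a ≤ B) :
    (s.setReg x a).Ready B := by
  obtain ⟨⟨h1, h2, h3⟩, h4⟩ := hx
  refine ⟨hs.marked, ?_, ?_, ?_, ?_, fun r hr => ?_⟩
  · simp [St.setReg, h1.symm, hs.addr]
  · simp [St.setReg, h2.symm, hs.aux]
  · simp [St.setReg, h3.symm, hs.tmp]
  · simp [St.setReg, h4.symm, hs.cnt]
  · by_cases h : r = x
    · simp [St.setReg, h, ha]
    · simpa [St.setReg, h] using hs.le r hr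

theorem Ready.put {s : St} (hs : s.Ready B) (l : List InputSym) (p : Arr → ℕ → Prop) {x : Reg}
    (hx : x.Free) {a : ℕ} (ha : a ≤ B) : (s.put l p x a).Ready B :=
  ((hs.setInp l).setBits p).setReg hx ha

end St

namespace Prog

/-- Read a number. -/
def num (x : Reg) : Prog := (op (.read .one) * move [] [x]).star * op (.read .sep)

/-- Read an entry of a tuple. -/
def entry (f : Arr) (c : Reg) : Prog :=
  num .val * (write f [c, .idx, .val] * (drain .val [] [] * move [] [.idx]))

/-- Read a tuple. -/
def tuple (f g : Arr) (c : Reg) : Prog :=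
  op (.read .item) * ((entry f c).star * (write g [c, .idx] * (drain .idx [] [] * move [] [c])))

/-- Read a list of tuples. -/
def list (f g : Arr) (c : Reg) : Prog := (tuple f g c).star * op (.read .close)

end Prog

/-! ### Reading numbers, tuples and lists -/

theorem does_read (hX : 2 ≤ X) (a : InputSym) (s : St) :
    Does X 0 (Prog.op (.read a)) s fun s' => ∃ l, s.inp = a :: l ∧ s' = s.setInp l :=
  (does_op _ s).congr hX le_rfl fun _ => Iff.rfl

theorem does_inc (hX : 2 ≤ X) {x : Reg} (hx : x.Bounded) {s : St} (hs : s.Marked B) :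
    Does X 0 (Prog.move [] [x]) s fun s' => s.reg x ≠ B ∧ s' = s.setReg x (s.reg x + 1) := by
  refine (does_move hX [] [x] hs).congr hX le_rfl fun s' => ?_
  have : s.mv [] [x] 1 = s.setReg x (s.reg x + 1) := by
    ext r <;> try rfl
    by_cases h : r = x <;> simp [St.mv, St.setReg, h]
  rw [this]
  simp [hx]

theorem does_reset (hX : B + 2 ≤ X) {x : Reg} {s : St} (hs : s.Ready B) (hx : x.Bounded) :
    Does X 2 (Prog.drain x [] []) s fun s' => s' = s.setReg x 0 := by
  have hxB := hs.le x hx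
  refine (does_drain (c := 1) (by omega) x [] [] hs.marked (by simp) (by simp; omega)).congr
    (by omega) le_rfl fun s' => ?_
  have : s.mv [x] [] (s.reg x) = s.setReg x 0 := by
    ext r <;> try rfl
    by_cases h : r = x <;> simp [St.mv, St.setReg, h]
  rw [this]
  simp

/-- The counter blocks at `B`, so a larger number stops the run, and the loop has at most `B`
rounds. The rounds carry no data but their number, hence the parameter type `Unit`. -/
theorem does_num (hX : B + 2 ≤ X) {x : Reg} (hx : x.Free) {s : St} (hs : s.Ready B)
    (h0 : s.reg x = 0) :
    Does X 3 (Prog.num x) s fun s' => ∃ m rest, m ≤ B ∧ s.inp = InputSym.num m ++ rest ∧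
      s' = (s.setInp rest).setReg x m := by
  have hX' : 2 ≤ X := by omega
  let G : St → Unit → St → Prop := fun s _ u => ∃ l, s.inp = InputSym.one :: l ∧ s.reg x ≠ B ∧
    u = (s.setInp l).setReg x (s.reg x + 1)
  have hG : ∀ (l : List Unit) (s : St), s.Ready B → ∀ s', Steps G s l s' ↔
      ∃ rest, s.inp = List.replicate l.length InputSym.one ++ rest ∧ s.reg x + l.length ≤ B ∧
        s' = (s.setInp rest).setReg x (s.reg x + l.length) := by
    intro l
    induction l with
    | nil =>
      intro s hs s'
      constructor
      · rintro rfl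
        exact ⟨s.inp, rfl, hs.le x hx.1, by simp [St.setInp, St.setReg]⟩
      · rintro ⟨rest, h1, -, h3⟩
        have h1 : s.inp = rest := h1
        rw [h3, ← h1]
        simp [Steps, St.setInp, St.setReg]
    | cons b l ih =>
      intro s hs s'
      have hxB := hs.le x hx.1
      constructor
      · rintro ⟨u, ⟨r1, h1, h2, rfl⟩, h3⟩
        obtain ⟨rest, h4, h5, rfl⟩ := (ih _ ((hs.setInp _).setReg hx (by omega)) s').1 h3
        refine ⟨rest, ?_, ?_, ?_⟩
        · have h4 : r1 = _ := h4
          rw [h1, h4]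
          rfl
        · simp [St.setReg] at h5 ⊢
          omega
        · simp [St.setInp, St.setReg, add_assoc, add_comm]
      · rintro ⟨rest, h1, h2, rfl⟩
        simp only [List.length_cons] at h1 h2
        refine ⟨_, ⟨List.replicate l.length InputSym.one ++ rest, h1, by omega, rfl⟩, ?_⟩
        refine (ih _ ((hs.setInp _).setReg hx (by omega)) _).2 ⟨rest, rfl, ?_, ?_⟩
        · simp [St.setReg]
          omega
        · simp [St.setInp, St.setReg, add_assoc, add_comm]
  have h1 := Exact.star (step := Op.Step) (X := X)
    (P := Prog.op (.read .one) * Prog.move [] [x]) (G := G) (a := 1)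
    (c := 1) (I := St.Ready B) (s := s) ?_ ?_ hs ?_
  · refine (h1.mul (b := 0) hX' fun u _ => does_read hX' .sep u).congr hX' (by omega) fun s' => ?_
    constructor
    · rintro ⟨u, ⟨l, hl⟩, rest, h3, rfl⟩
      obtain ⟨r1, h4, h5, rfl⟩ := (hG l s hs u).1 hl
      refine ⟨l.length, rest, by omega, ?_, ?_⟩
      · have h3 : r1 = _ := h3
        rw [h4, h3]
        simp [InputSym.num]
      · simp [St.setInp, St.setReg, h0]
    · rintro ⟨m, rest, h1, h2, rfl⟩
      refine ⟨(s.setInp (.sep :: rest)).setReg x m, ⟨List.replicate m (), ?_⟩, rest, rfl, rfl⟩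
      refine (hG _ s hs _).2 ⟨.sep :: rest, ?_, ?_, ?_⟩
      · simpa [InputSym.num] using h2
      · simpa [h0] using h1
      · simp [h0]
  · intro s hs
    refine ((does_read hX' .one s).mul hX' (b := 0) fun u hu => ?_).congr hX' le_rfl
      (Q := fun s' => ∃ u, (∃ l, s.inp = .one :: l ∧ u = s.setInp l) ∧
        u.reg x ≠ B ∧ s' = u.setReg x (u.reg x + 1)) fun s' => ?_
    · obtain ⟨l, -, rfl⟩ := hu
      exact does_inc hX' hx.1 (s := s.setInp l) hs.marked
    · constructor
      · rintro ⟨_, ⟨l, h1, rfl⟩, h2, h3⟩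
        exact ⟨(), l, h1, h2, h3⟩
      · rintro ⟨-, l, h1, h2, h3⟩
        exact ⟨_, ⟨l, h1, rfl⟩, h2, h3⟩
  · rintro s - u hs ⟨l, -, h2, rfl⟩
    have := hs.le x hx.1
    exact (hs.setInp _).setReg hx (by omega)
  · intro l s' hl
    obtain ⟨r1, h4, h5, rfl⟩ := (hG l s hs s').1 hl
    simp
    omega

/-- A list of tuples is stored as a ternary relation: list position, index in the tuple, value. The
time exponents here and below are rounded-up constants. -/
theorem does_entry (hX : B + 2 ≤ X) (f : Arr) {c : Reg} (hc : c.Free)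
    (hcv : c ≠ .val) {s : St} (hs : s.Ready B) (h0 : s.reg .val = 0) :
    Does X 100 (Prog.entry f c) s fun s' => ∃ m rest, m ≤ B ∧ s.reg .idx ≠ B ∧
      s.inp = InputSym.num m ++ rest ∧
      s' = s.put rest (fun g i => g = f ∧ i = address B 0 [s.reg c, s.reg .idx, m]) .idx
        (s.reg .idx + 1) := by
  have hX' : 2 ≤ X := by omega
  have key : ∀ m rest, ((((s.setInp rest).setReg .val m).setBits fun g i => g = f ∧ i = address B 0
        [((s.setInp rest).setReg .val m).reg c, ((s.setInp rest).setReg .val m).reg .idx,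
          ((s.setInp rest).setReg .val m).reg .val]).setReg
        .val 0).setReg .idx (((s.setInp rest).setReg .val m).reg .idx + 1) =
      s.put rest (fun g i => g = f ∧ i = address B 0 [s.reg c, s.reg .idx, m]) .idx
        (s.reg .idx + 1) := by
    intro m rest
    ext r <;> try rfl
    · simp only [St.setReg, St.setBits, St.setInp, St.put, Function.update_apply]
      by_cases h5 : r = .idx
      · simp [h5]
      · by_cases h6 : r = .val
        · simp [h6, h0]
        · simp [h5, h6]
    · simp [St.setReg, St.setBits, St.setInp, St.put, hcv]
  refine ((does_num hX (x := .val) (by decide) hs h0).mul (b := 95) hX' (Q' := fun u s' =>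
      u.reg .idx ≠ B ∧ s' = ((u.setBits fun g i => g = f ∧
        i = address B 0 [u.reg c, u.reg .idx, u.reg .val]).setReg
        .val 0).setReg .idx (u.reg .idx + 1))
    fun u hu => ?_).congr hX' (by omega) fun s' => ?_
  · have hu' : u.Ready B := by
      obtain ⟨m, rest, h1, h2, rfl⟩ := hu
      exact (hs.setInp _).setReg (by decide) h1
    have hu2 : ((u.setBits fun g i => g = f ∧
        i = address B 0 [u.reg c, u.reg .idx, u.reg .val]).setReg .val 0).Ready B :=
      (hu'.setBits _).setReg (by decide) (Nat.zero_le _)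
    have h1 := does_write hX (xs := [c, .idx, .val]) (by simp [hc]; decide) hu' f
    rw [St.setBit_eq] at h1
    exact (h1.then hX' ((does_reset hX (hu'.setBits _) (by decide)).then hX'
      (does_inc hX' (B := B) (x := .idx) (by decide) hu2.marked))).congr hX'
        (by simp [accessTime]) fun s' => Iff.rfl
  · constructor
    · rintro ⟨u, ⟨m, rest, h1, h2, rfl⟩, h3, rfl⟩
      exact ⟨m, rest, h1, h3, h2, key m rest⟩
    · rintro ⟨m, rest, h1, h3, h2, rfl⟩
      exact ⟨_, ⟨m, rest, h1, h2, rfl⟩, h3, (key m rest).symm⟩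

theorem does_entries (hX : B + 2 ≤ X) (f : Arr) {c : Reg} (hc : c.Free)
    (hcv : c ≠ .val) (hci : c ≠ .idx) {s : St} (hs : s.Ready B) (h0 : s.reg .val = 0) :
    Does X 101 (Prog.entry f c).star s fun s' => ∃ (t : List ℕ) (rest : _), (∀ m ∈ t, m ≤ B) ∧
      s.reg .idx + t.length ≤ B ∧ s.inp = t.flatMap InputSym.num ++ rest ∧
      s' = s.put rest (fun g i => g = f ∧ ∃ j m, t[j]? = some m ∧
        i = address B 0 [s.reg c, s.reg .idx + j, m]) .idx (s.reg .idx + t.length) := by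
  have hX' : 2 ≤ X := by omega
  let G : St → ℕ → St → Prop := fun s m s' => ∃ rest, m ≤ B ∧ s.reg .idx ≠ B ∧
      s.inp = InputSym.num m ++ rest ∧
      s' = s.put rest (fun g i => g = f ∧ i = address B 0 [s.reg c, s.reg .idx, m]) .idx
        (s.reg .idx + 1)
  have hG : ∀ (t : List ℕ) (s : St), s.Ready B → ∀ s', Steps G s t s' ↔
      ∃ rest, (∀ m ∈ t, m ≤ B) ∧ s.reg .idx + t.length ≤ B ∧
        s.inp = t.flatMap InputSym.num ++ rest ∧
      s' = s.put rest (fun g i => g = f ∧ ∃ j m, t[j]? = some m ∧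
        i = address B 0 [s.reg c, s.reg .idx + j, m]) .idx (s.reg .idx + t.length) := by
    intro t
    induction t with
    | nil =>
      intro s hs s'
      constructor
      · rintro rfl
        exact ⟨s.inp, by simp, hs.le .idx (by decide), rfl, by simp [St.put_self]⟩
      · rintro ⟨rest, -, -, h1, h3⟩
        have h1 : s.inp = rest := h1
        rw [h3, ← h1]
        simp [Steps, St.put_self]
    | cons b t ih =>
      intro s hs s'
      have hiB := hs.le .idx (by decide)
      have key : ∀ r1 rest, (s.put r1 (fun g i => g = f ∧ i = address B 0 [s.reg c, s.reg .idx, b])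
          .idx (s.reg .idx + 1)).put rest (fun g i => g = f ∧ ∃ j m, t[j]? = some m ∧
            i = address B 0 [s.reg c, s.reg .idx + 1 + j, m]) .idx (s.reg .idx + 1 + t.length) =
          s.put rest (fun g i => g = f ∧ ∃ j m, (b :: t)[j]? = some m ∧
            i = address B 0 [s.reg c, s.reg .idx + j, m]) .idx
              (s.reg .idx + (b :: t).length) := by
        intro r1 rest
        rw [St.put_put, List.length_cons, Nat.add_assoc, Nat.add_comm 1]
        congr 1
        funext g i
        rw [← and_or_left]
        refine propext (and_congr_right fun _ => ?_)
        constructor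
        · rintro (rfl | ⟨j, m, h1, rfl⟩)
          · exact ⟨0, b, rfl, rfl⟩
          · exact ⟨j + 1, m, h1, by rw [Nat.add_assoc, Nat.add_comm 1]⟩
        · rintro ⟨_ | j, m, h1, rfl⟩
          · simp at h1
            exact Or.inl (by rw [h1]; rfl)
          · exact Or.inr ⟨j, m, h1, by rw [Nat.add_assoc, Nat.add_comm 1]⟩
      have hreg : ∀ r1 p v, (s.put r1 p .idx v).reg c = s.reg c := by
        intro r1 p v
        simp [St.put, St.setReg, hci, St.setBits, St.setInp]
      have hreg' : ∀ r1 p v, (s.put r1 p .idx v).reg .idx = v := by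
        intro r1 p v
        simp [St.put, St.setReg]
      constructor
      · rintro ⟨u, ⟨r1, h1, h2, h3, rfl⟩, h4⟩
        obtain ⟨rest, h5, h6, h7, rfl⟩ := (ih _ (hs.put _ _ (by decide) (by omega)) s').1 h4
        simp only [hreg, hreg'] at h6 ⊢
        refine ⟨rest, by simpa using ⟨h1, h5⟩, by simp; omega, ?_, key _ _⟩
        have h7 : r1 = _ := h7
        rw [h3, h7]
        simp
      · rintro ⟨rest, h1, h2, h3, rfl⟩
        simp only [List.length_cons] at h2
        refine ⟨_, ⟨t.flatMap InputSym.num ++ rest, h1 b (by simp), by omega, by simpa using h3,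
          rfl⟩, (ih _ (hs.put _ _ (by decide) (by omega)) _).2 ⟨rest,
            fun m hm => h1 m (by simp [hm]), ?_, rfl, ?_⟩⟩
        · simp only [hreg']
          omega
        · simp only [hreg, hreg']
          exact (key _ _).symm
  refine (Exact.star (step := Op.Step) (X := X) (P := Prog.entry f c) (G := G) (a := 100)
    (c := 1) (I := fun s => s.Ready B ∧ s.reg .val = 0) (s := s) ?_ ?_ ⟨hs, h0⟩ ?_).congr hX'
    le_rfl fun s' => exists_congr fun t => hG t s hs s'
  · rintro s ⟨hs, h0⟩
    exact does_entry hX f hc hcv hs h0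
  · rintro s b u ⟨hs, h0⟩ ⟨rest, h1, h2, h3, rfl⟩
    have hiB := hs.le .idx (by decide)
    exact ⟨hs.put _ _ (by decide) (by omega), h0⟩
  · intro t s' ht
    obtain ⟨rest, h1, h2, -⟩ := (hG t s hs s').1 ht
    simp
    omega

/-- The addresses of the bits that represent a list of tuples. -/
def tupleBits (B : ℕ) (f g : Arr) (k : ℕ) (L : List (List ℕ)) (h : Arr) (a : ℕ) : Prop :=
  (h = f ∧ ∃ i j t m, L[i]? = some t ∧ t[j]? = some m ∧ a = address B 0 [k + i, j, m]) ∨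
    (h = g ∧ ∃ i t, L[i]? = some t ∧ a = address B 0 [k + i, t.length])

theorem tupleBits_cons (B : ℕ) (f g : Arr) (k : ℕ) (t : List ℕ) (L : List (List ℕ)) :
    tupleBits B f g k (t :: L) = fun h a =>
      ((h = f ∧ ∃ j m, t[j]? = some m ∧ a = address B 0 [k, j, m]) ∨
        (h = g ∧ a = address B 0 [k, t.length])) ∨ tupleBits B f g (k + 1) L h a := by
  funext h a
  refine propext ?_
  constructor
  · rintro (⟨rfl, i, j, t', m, h1, h2, rfl⟩ | ⟨rfl, i, t', h1, rfl⟩)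
    · rcases i with _ | i
      · obtain rfl : t = t' := by simpa using h1
        exact Or.inl (Or.inl ⟨rfl, j, m, h2, rfl⟩)
      · exact Or.inr (Or.inl ⟨rfl, i, j, t', m, h1, h2, by rw [Nat.add_assoc, Nat.add_comm 1]⟩)
    · rcases i with _ | i
      · obtain rfl : t = t' := by simpa using h1
        exact Or.inl (Or.inr ⟨rfl, rfl⟩)
      · exact Or.inr (Or.inr ⟨rfl, i, t', h1, by rw [Nat.add_assoc, Nat.add_comm 1]⟩)
  · rintro ((⟨rfl, j, m, h1, rfl⟩ | ⟨rfl, rfl⟩) |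
      (⟨rfl, i, j, t', m, h1, h2, rfl⟩ | ⟨rfl, i, t', h1, rfl⟩))
    · exact Or.inl ⟨rfl, 0, j, t, m, rfl, h1, rfl⟩
    · exact Or.inr ⟨rfl, 0, t, rfl, rfl⟩
    · exact Or.inl ⟨rfl, i + 1, j, t', m, h1, h2, by rw [Nat.add_assoc, Nat.add_comm 1]⟩
    · exact Or.inr ⟨rfl, i + 1, t', h1, by rw [Nat.add_assoc, Nat.add_comm 1]⟩

/-- The parser accepts tuples of any length up to `B`; the length is recorded in `g` so that a
formula can detect a wrong arity later. -/
theorem does_tuple (hX : B + 2 ≤ X) (f g : Arr) {c : Reg} (hc : c.Free)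
    (hcv : c ≠ .val) (hci : c ≠ .idx) {s : St} (hs : s.Ready B) (h0 : s.reg .val = 0)
    (h0' : s.reg .idx = 0) :
    Does X 200 (Prog.tuple f g c) s fun s' => ∃ (t : List ℕ) (rest : _), ((∀ m ∈ t, m ≤ B) ∧
      t.length ≤ B) ∧ s.reg c ≠ B ∧ s.inp = InputSym.item :: (t.flatMap InputSym.num ++ rest) ∧
      s' = s.put rest (fun h a => (h = f ∧ ∃ j m, t[j]? = some m ∧
        a = address B 0 [s.reg c, j, m]) ∨ (h = g ∧ a = address B 0 [s.reg c, t.length])) c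
          (s.reg c + 1) := by
  have hX' : 2 ≤ X := by omega
  have key : ∀ (r1 rest : List InputSym) (t : List ℕ) (u : St),
      u = (s.setInp r1).put rest (fun h i => h = f ∧ ∃ j m, t[j]? = some m ∧
        i = address B 0 [(s.setInp r1).reg c, (s.setInp r1).reg .idx + j, m]) .idx
          ((s.setInp r1).reg .idx + t.length) → (((u.setBits fun h i => h = g ∧
            i = address B 0 [u.reg c, u.reg .idx]).setReg .idx 0).setReg c
          (u.reg c + 1)) = s.put rest (fun h a => (h = f ∧ ∃ j m, t[j]? = some m ∧
        a = address B 0 [s.reg c, j, m]) ∨ (h = g ∧ a = address B 0 [s.reg c, t.length])) c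
          (s.reg c + 1) := by
    rintro r1 rest t _ rfl
    simp only [show (s.setInp r1).reg .idx = 0 from h0', zero_add]
    ext r <;> try rfl
    · simp only [St.setReg, St.setBits, St.setInp, St.put, Function.update_apply]
      by_cases h5 : r = c
      · simp [h5, hci]
      · by_cases h6 : r = .idx
        · simp [h6, hci.symm, h0']
        · simp [h5, h6]
    · simp only [St.setReg, St.setBits, St.setInp, St.put, Function.update_apply, hci,
        if_false, if_true]
      rename_i a
      by_cases h5 : r = g ∧ a = address B 0 [s.reg c, t.length]
      · rw [if_pos h5, if_pos (Or.inr h5)]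
      · rw [if_neg h5]
        by_cases h6 : r = f ∧ ∃ j m, t[j]? = some m ∧ a = address B 0 [s.reg c, j, m]
        · exact (if_pos h6).trans (if_pos (Or.inl h6)).symm
        · exact (if_neg h6).trans (if_neg (not_or.2 ⟨h6, h5⟩)).symm
  refine ((does_read hX' .item s).mul (b := 198) hX' (Q' := fun u s' =>
    ∃ (t : List ℕ) (rest : _), ((∀ m ∈ t, m ≤ B) ∧
      t.length ≤ B) ∧ u.reg c ≠ B ∧ u.inp = t.flatMap InputSym.num ++ rest ∧
      s' = s.put rest (fun h a => (h = f ∧ ∃ j m, t[j]? = some m ∧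
        a = address B 0 [s.reg c, j, m]) ∨ (h = g ∧ a = address B 0 [s.reg c, t.length])) c
          (s.reg c + 1)) ?_).congr hX' (by omega) fun s' => ?_
  · rintro _ ⟨r1, -, rfl⟩
    refine ((does_entries hX f hc hcv hci (hs.setInp r1) h0).mul (b := 96) hX'
      (Q' := fun u s' => u.reg c ≠ B ∧ s' = (((u.setBits fun h i => h = g ∧
        i = address B 0 [u.reg c, u.reg .idx]).setReg .idx 0).setReg c
          (u.reg c + 1))) ?_).congr hX' (by omega) fun s' => ?_
    · intro u hu
      have hu' : u.Ready B := by
        obtain ⟨t, rest, h1, h2, -, rfl⟩ := hu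
        exact (hs.setInp r1).put _ _ (by decide) h2
      have h1 := does_write hX (xs := [c, .idx]) (by simp [hc]; decide) hu' g
      rw [St.setBit_eq] at h1
      have hu2 : ((u.setBits fun h i => h = g ∧
          i = address B 0 [u.reg c, u.reg .idx]).setReg .idx 0).Ready B :=
        (hu'.setBits _).setReg (by decide) (Nat.zero_le _)
      refine (h1.then hX' ((does_reset hX (hu'.setBits _) (by decide)).then hX'
        (does_inc hX' (B := B) (x := c) hc.1 hu2.marked))).congr hX'
          (by simp [accessTime]) fun s' => ?_
      simp [St.setReg, hci]
      exact Iff.rfl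
    · have hcr : ∀ rest p v, ((s.setInp r1).put rest p .idx v).reg c = s.reg c := by
        intro rest p v
        simp [St.put, St.setReg, hci, St.setBits, St.setInp]
      constructor
      · rintro ⟨u, ⟨t, rest, h1, h2, h3, hu⟩, h4, rfl⟩
        refine ⟨t, rest, ⟨h1, ?_⟩, ?_, h3, key _ _ _ _ hu⟩
        · have h2 : s.reg .idx + t.length ≤ B := h2
          omega
        · rw [hu, hcr] at h4
          exact h4
      · rintro ⟨t, rest, ⟨h1, h2⟩, h4, h3, rfl⟩
        refine ⟨_, ⟨t, rest, h1, ?_, h3, rfl⟩, ?_, (key _ _ _ _ rfl).symm⟩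
        · show s.reg .idx + t.length ≤ B
          omega
        · rw [hcr]
          exact h4
  · constructor
    · rintro ⟨_, ⟨r1, h1, rfl⟩, t, rest, h2, h3, h4, h5⟩
      have h4 : r1 = _ := h4
      exact ⟨t, rest, h2, h3, by rw [h1, h4], h5⟩
    · rintro ⟨t, rest, h2, h3, h4, h5⟩
      exact ⟨_, ⟨_, h4, rfl⟩, t, rest, h2, h3, rfl, h5⟩

/-- All numbers and lengths in a list of tuples are at most `B`. -/
def BoundedList (B : ℕ) (L : List (List ℕ)) : Prop :=
  L.length ≤ B ∧ ∀ t ∈ L, (∀ m ∈ t, m ≤ B) ∧ t.length ≤ B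

theorem does_list (hX : B + 2 ≤ X) (f g : Arr) {c : Reg} (hc : c.Free)
    (hcv : c ≠ .val) (hci : c ≠ .idx) {s : St} (hs : s.Ready B) (h0 : s.reg .val = 0)
    (h0' : s.reg .idx = 0) (hc0 : s.reg c = 0) :
    Does X 203 (Prog.list f g c) s fun s' => ∃ (L : List (List ℕ)) (rest : _), BoundedList B L ∧
      s.inp = rawList L ++ rest ∧ s' = s.put rest (tupleBits B f g 0 L) c L.length := by
  have hX' : 2 ≤ X := by omega
  let G : St → List ℕ → St → Prop := fun s t s' => ∃ rest, ((∀ m ∈ t, m ≤ B) ∧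
      t.length ≤ B) ∧ s.reg c ≠ B ∧ s.inp = InputSym.item :: (t.flatMap InputSym.num ++ rest) ∧
      s' = s.put rest (fun h a => (h = f ∧ ∃ j m, t[j]? = some m ∧
        a = address B 0 [s.reg c, j, m]) ∨ (h = g ∧ a = address B 0 [s.reg c, t.length])) c
          (s.reg c + 1)
  have hG : ∀ (L : List (List ℕ)) (s : St), s.Ready B → ∀ s', Steps G s L s' ↔
      ∃ rest, (s.reg c + L.length ≤ B ∧ ∀ t ∈ L, (∀ m ∈ t, m ≤ B) ∧ t.length ≤ B) ∧
      s.inp = (L.flatMap fun t => InputSym.item :: t.flatMap InputSym.num) ++ rest ∧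
      s' = s.put rest (tupleBits B f g (s.reg c) L) c (s.reg c + L.length) := by
    intro L
    induction L with
    | nil =>
      intro s hs s'
      have : tupleBits B f g (s.reg c) [] = fun _ _ => False := by
        funext h a
        simp [tupleBits]
      rw [this]
      constructor
      · rintro rfl
        exact ⟨s.inp, ⟨hs.le c hc.1, by simp⟩, rfl, by simp [St.put_self]⟩
      · rintro ⟨rest, -, h1, h3⟩
        have h1 : s.inp = rest := h1
        rw [h3, ← h1]
        simp [Steps, St.put_self]
    | cons t L ih =>
      intro s hs s'
      have hcB := hs.le c hc.1
      have hreg : ∀ r1 p v, (s.put r1 p c v).reg c = v := by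
        intro r1 p v
        simp [St.put, St.setReg]
      rw [tupleBits_cons]
      constructor
      · rintro ⟨u, ⟨r1, h1, h2, h3, rfl⟩, h4⟩
        obtain ⟨rest, ⟨h5, h6⟩, h7, rfl⟩ := (ih _ (hs.put _ _ hc (by omega)) s').1 h4
        simp only [hreg] at h5 ⊢
        refine ⟨rest, ⟨by simp; omega, by simpa using ⟨h1, h6⟩⟩, ?_, ?_⟩
        · have h7 : r1 = _ := h7
          rw [h3, h7]
          simp
        · rw [St.put_put, List.length_cons, Nat.add_assoc, Nat.add_comm 1]
      · rintro ⟨rest, ⟨h1, h2⟩, h3, rfl⟩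
        simp only [List.length_cons] at h1
        refine ⟨_, ⟨(L.flatMap fun t => InputSym.item :: t.flatMap InputSym.num) ++ rest,
          h2 t (by simp), by omega, by simpa using h3,
          rfl⟩, (ih _ (hs.put _ _ hc (by omega)) _).2 ⟨rest,
            ⟨?_, fun m hm => h2 m (by simp [hm])⟩, rfl, ?_⟩⟩
        · simp only [hreg]
          omega
        · simp only [hreg]
          rw [St.put_put, List.length_cons, Nat.add_assoc, Nat.add_comm 1]
  refine ((Exact.star (step := Op.Step) (X := X) (P := Prog.tuple f g c) (G := G) (a := 200)
    (c := 1) (I := fun s => s.Ready B ∧ s.reg .val = 0 ∧ s.reg .idx = 0) (s := s) ?_ ?_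
    ⟨hs, h0, h0'⟩ ?_).mul hX' (b := 0) fun u _ => does_read hX' .close u).congr hX'
    (by omega) fun s' => ?_
  · rintro s ⟨hs, h0, h0'⟩
    exact does_tuple hX f g hc hcv hci hs h0 h0'
  · rintro s b u ⟨hs, h0, h0'⟩ ⟨rest, h1, h2, h3, rfl⟩
    have hiB := hs.le c hc.1
    refine ⟨hs.put _ _ hc (by omega), ?_, ?_⟩
    · simpa [St.put, St.setReg, St.setBits, St.setInp, hcv.symm] using h0
    · simpa [St.put, St.setReg, St.setBits, St.setInp, hci.symm] using h0'
  · intro t s' ht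
    obtain ⟨rest, h1, h2, -⟩ := (hG t s hs s').1 ht
    simp
    omega
  · constructor
    · rintro ⟨u, ⟨L, hL⟩, rest, h1, rfl⟩
      obtain ⟨r1, h2, h3, rfl⟩ := (hG L s hs u).1 hL
      have h1 : r1 = _ := h1
      rw [hc0, zero_add] at h2
      refine ⟨L, rest, h2, ?_, ?_⟩
      · rw [h3, h1]
        simp [rawList]
      · rw [hc0, zero_add]
        rfl
    · rintro ⟨L, rest, h1, h2, rfl⟩
      refine ⟨s.put (.close :: rest) (tupleBits B f g 0 L) c L.length, ⟨L, (hG L s hs _).2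
        ⟨.close :: rest, ?_, ?_, ?_⟩⟩, rest, rfl, rfl⟩
      · rw [hc0, zero_add]
        exact h1
      · simpa [rawList] using h2
      · rw [hc0, zero_add]

/-! ### Characterization of explainability -/

/-- The canonical query needs only finite languages, namely finitely many witness words per atom. -/
theorem RegularExpression.exists_matches'_eq {A : Type} (l : List (List A)) :
    ∃ L : RegularExpression A, ∀ w, w ∈ L.matches' ↔ w ∈ l := by
  have word : ∀ w : List A, ∃ L : RegularExpression A, L.matches' = ({w} : Set (List A)) := by
    intro w
    induction w with
    | nil => exact ⟨1, rfl⟩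
    | cons a w ih =>
      obtain ⟨L, hL⟩ := ih
      refine ⟨char a * L, ?_⟩
      ext x
      change x ∈ (char a).matches' * L.matches' ↔ _
      rw [Language.mem_mul, hL]
      constructor
      · rintro ⟨_, rfl, _, rfl, rfl⟩
        rfl
      · rintro rfl
        exact ⟨[a], rfl, w, rfl, rfl⟩
  induction l with
  | nil => exact ⟨0, fun w => by simp⟩
  | cons a l ih =>
    obtain ⟨L, hL⟩ := ih
    obtain ⟨M, hM⟩ := word a
    refine ⟨M + L, fun w => ?_⟩
    change w ∈ M.matches' + L.matches' ↔ _
    rw [Language.mem_add, hL, hM, List.mem_cons]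
    exact Iff.rfl

namespace GraphDB

variable {V A : Type} {n k : ℕ}

/-- For all pairs of `k`-tuples, the labels of the paths between some of their components are
labels of paths between the images. -/
def Transfers (G : GraphDB V A) (g : (Fin k → V) → V) : Prop :=
  ∀ u v, ∃ i, ∀ w, G.HasPath (u i) w (v i) → G.HasPath (g u) w (g v)

/-- Apply `g` to the values of the `k` homomorphisms that witness `hP`. For each atom the
transferring property picks one of them, and the word this homomorphism uses also labels a path
between the images. -/
theorem Transfers.mem_eval {G : GraphDB V A} {g : (Fin k → V) → V} (hg : G.Transfers g)
    {γ : CRPQ A n} {P : Fin k → Fin n → V} (hP : ∀ i, P i ∈ γ.eval G) :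
    (fun j => g fun i => P i j) ∈ γ.eval G := by
  choose h hh hP using hP
  refine ⟨fun x => g fun i => h i x, fun m => ?_, ?_⟩
  · obtain ⟨i, hi⟩ := hg (fun i => h i (γ.src m)) (fun i => h i (γ.tgt m))
    obtain ⟨w, hw, hp⟩ := hh i m
    exact ⟨w, hw, hi w hp⟩
  · funext j
    congr 1
    funext i
    rw [hP i]

/-- The variables are the elements of `V^k`, so an assignment is a map `g`. Each non-transferring
`g` comes with a pair `u, v` and words `w i` that label paths from `u i` to `v i` but none from `g
u` to `g v`; the atom between `u` and `v` for the language of these words excludes `g`, while every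
projection satisfies it. There are finitely many maps `g`, hence finitely many atoms. -/
theorem exists_canonical [Finite V] (G : GraphDB V A) (P : Fin k → Fin n → V) :
    ∃ γ : CRPQ A n, (∀ i, P i ∈ γ.eval G) ∧
      ∀ b ∈ γ.eval G, ∃ g : (Fin k → V) → V, G.Transfers g ∧ b = fun j => g fun i => P i j := by
  classical
  have := Fintype.ofFinite V
  let D := {g : (Fin k → V) → V // ¬ G.Transfers g}
  have hD : ∀ g : D, ∃ (u v : Fin k → V) (L : RegularExpression A),
      (∀ i, ∃ w ∈ L.matches', G.HasPath (u i) w (v i)) ∧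
        ∀ w ∈ L.matches', ¬ G.HasPath (g.1 u) w (g.1 v) := by
    rintro ⟨g, hg⟩
    simp only [Transfers, not_forall, not_exists] at hg
    obtain ⟨u, v, h⟩ := hg
    choose w h1 h2 using h
    obtain ⟨L, hL⟩ := RegularExpression.exists_matches'_eq (List.ofFn w)
    refine ⟨u, v, L, fun i => ⟨w i, (hL _).2 (by simp), h1 i⟩, fun x hx => ?_⟩
    obtain ⟨i, rfl⟩ := List.mem_ofFn.1 ((hL x).1 hx)
    exact h2 i
  choose u v L h1 h2 using hD
  let e := Fintype.equivFin (Fin k → V)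
  let f := Fintype.equivFin (D ⊕ (Fin k → V))
  let γ : CRPQ A n :=
    -- The atoms indexed by `Fin k → V` are empty-word loops; they constrain nothing and make every
    -- variable occur.
    { numVars := Fintype.card (Fin k → V)
      numAtoms := Fintype.card (D ⊕ (Fin k → V))
      expr := fun m => Sum.elim L (fun _ => 1) (f.symm m)
      src := fun m => e (Sum.elim u id (f.symm m))
      tgt := fun m => e (Sum.elim v id (f.symm m))
      occurs := fun x => ⟨f (Sum.inr (e.symm x)), Or.inl (by simp)⟩
      free := fun j => e fun i => P i j }
  refine ⟨γ, fun i => ⟨fun x => e.symm x i, fun m => ?_, ?_⟩, ?_⟩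
  · simp only [γ, Equiv.symm_apply_apply]
    cases f.symm m with
    | inl g => exact h1 g i
    | inr x => exact ⟨[], rfl, rfl⟩
  · funext j
    simp [γ]
  · rintro b ⟨h, hh, rfl⟩
    refine ⟨fun x => h (e x), ?_, rfl⟩
    by_contra hg
    obtain ⟨w, hw, hp⟩ := hh (f (Sum.inl ⟨fun x => h (e x), hg⟩))
    simp only [γ, Equiv.symm_apply_apply, Sum.elim_inl] at hw hp
    exact h2 ⟨fun x => h (e x), hg⟩ w hw hp

end GraphDB

/-- The tuples that belong to the evaluation of every query that explains the positive examples. -/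
def DefInput.Forced (I : DefInput) (b : Fin I.arity → Fin I.nodes) : Prop :=
  ∃ g : (Fin I.pos.length → Fin I.nodes) → Fin I.nodes, I.graph.Transfers g ∧
    b = fun j => g fun i => I.pos.get i j

theorem QBEInput.explainable_iff (I : QBEInput) :
    I.Explainable ↔ ∀ b ∈ I.neg, ¬ I.toDefInput.Forced b := by
  constructor
  · rintro ⟨γ, hP, hN⟩ b hb ⟨g, hg, rfl⟩
    have : (fun j => g fun i => I.pos.get i j) ∈ γ.eval I.graph ∩ {t | t ∈ I.neg} :=
      ⟨hg.mem_eval fun i => hP (I.pos.get_mem i), hb⟩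
    rw [hN] at this
    exact this
  · intro h
    obtain ⟨γ, h1, h2⟩ := I.graph.exists_canonical I.pos.get
    refine ⟨γ, fun t ht => ?_, ?_⟩
    · obtain ⟨i, rfl⟩ := List.get_of_mem ht
      exact h1 i
    · ext b
      refine ⟨fun ⟨hb, hn⟩ => h b hn (h2 b hb), fun hb => hb.elim⟩

theorem DefInput.definable_iff (I : DefInput) :
    I.Definable ↔ ∀ b, I.Forced b → b ∈ I.pos := by
  constructor
  · rintro ⟨γ, hγ⟩ b ⟨g, hg, rfl⟩
    have hγ : γ.eval I.graph = {t | t ∈ I.pos} := hγ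
    have := hg.mem_eval (γ := γ) (P := I.pos.get) fun i => by
      rw [hγ]
      exact I.pos.get_mem i
    rw [hγ] at this
    exact this
  · intro h
    obtain ⟨γ, h1, h2⟩ := I.graph.exists_canonical I.pos.get
    refine ⟨γ, Set.Subset.antisymm (fun b hb => h b (h2 b hb)) fun t ht => ?_⟩
    obtain ⟨i, rfl⟩ := List.get_of_mem ht
    exact h1 i

/-! ### Raw inputs -/

/-- The numbers that are listed in an input, not necessarily within the required bounds. -/
@[ext] structure RawInput where
  nodes : ℕ
  letters : ℕ
  arity : ℕ
  edges : List (List ℕ)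
  pos : List (List ℕ)

/-- The word for a raw input. -/
def RawInput.encode (J : RawInput) : List InputSym :=
  InputSym.num J.nodes ++ (InputSym.num J.letters ++ (InputSym.num J.arity ++
    (rawList J.edges ++ rawList J.pos)))

theorem num_append_inj {m m' : ℕ} {r r' : List InputSym}
    (h : InputSym.num m ++ r = InputSym.num m' ++ r') : m = m' ∧ r = r' := by
  induction m generalizing m' with
  | zero =>
    cases m' with
    | zero => exact ⟨rfl, by simpa [InputSym.num] using h⟩
    | succ m' => simp [InputSym.num, List.replicate_succ] at h
  | succ m ih =>
    cases m' with
    | zero => simp [InputSym.num, List.replicate_succ] at h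
    | succ m' =>
      obtain ⟨rfl, rfl⟩ := ih (m' := m') (by simpa [InputSym.num, List.replicate_succ] using h)
      exact ⟨rfl, rfl⟩

theorem num_ne_cons {m : ℕ} {r r' : List InputSym} {a : InputSym}
    (ha : a = .item ∨ a = .close) : InputSym.num m ++ r ≠ a :: r' := by
  cases m <;> rcases ha with rfl | rfl <;> simp [InputSym.num, List.replicate_succ]

/-- The letter after a tuple cannot start a numeral, so the end of the tuple can be recognized. -/
theorem flatMap_num_append_inj {t t' : List ℕ} {r r' : List InputSym} {a a' : InputSym}
    (ha : a = .item ∨ a = .close) (ha' : a' = .item ∨ a' = .close)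
    (h : t.flatMap InputSym.num ++ a :: r = t'.flatMap InputSym.num ++ a' :: r') :
    t = t' ∧ a :: r = a' :: r' := by
  induction t generalizing t' with
  | nil =>
    cases t' with
    | nil => exact ⟨rfl, h⟩
    | cons m t' =>
      simp only [List.flatMap_cons, List.append_assoc] at h
      exact (num_ne_cons ha h.symm).elim
  | cons m t ih =>
    cases t' with
    | nil =>
      simp only [List.flatMap_cons, List.append_assoc] at h
      exact (num_ne_cons ha' h).elim
    | cons m' t' =>
      simp only [List.flatMap_cons, List.append_assoc] at h
      obtain ⟨rfl, h2⟩ := num_append_inj h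
      obtain ⟨rfl, h3⟩ := ih h2
      exact ⟨rfl, h3⟩

theorem rawList_append_inj {L L' : List (List ℕ)} {r r' : List InputSym}
    (h : rawList L ++ r = rawList L' ++ r') : L = L' ∧ r = r' := by
  have cons : ∀ t L r, rawList (t :: L) ++ r =
      InputSym.item :: (t.flatMap InputSym.num ++ (rawList L ++ r)) := by
    intro t L r
    simp [rawList]
  have head : ∀ L r, ∃ a l, rawList L ++ r = a :: l ∧ (a = .item ∨ a = .close) := by
    intro L r
    cases L with
    | nil => exact ⟨.close, r, rfl, Or.inr rfl⟩
    | cons t L => exact ⟨_, _, cons t L r, Or.inl rfl⟩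
  induction L generalizing L' with
  | nil =>
    cases L' with
    | nil => exact ⟨rfl, by simpa [rawList] using h⟩
    | cons t L' =>
      rw [cons] at h
      simp [rawList] at h
  | cons t L ih =>
    cases L' with
    | nil =>
      rw [cons] at h
      simp [rawList] at h
    | cons t' L' =>
      rw [cons, cons, List.cons_inj_right] at h
      obtain ⟨a, l, h1, ha⟩ := head L r
      obtain ⟨a', l', h1', ha'⟩ := head L' r'
      rw [h1, h1'] at h
      obtain ⟨rfl, h2⟩ := flatMap_num_append_inj ha ha' h
      rw [← h1, ← h1'] at h2
      obtain ⟨rfl, h3⟩ := ih h2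
      exact ⟨rfl, h3⟩

theorem RawInput.encode_append_inj {J J' : RawInput} {r r' : List InputSym}
    (h : J.encode ++ r = J'.encode ++ r') : J = J' ∧ r = r' := by
  simp only [encode, List.append_assoc] at h
  obtain ⟨h1, h⟩ := num_append_inj h
  obtain ⟨h2, h⟩ := num_append_inj h
  obtain ⟨h3, h⟩ := num_append_inj h
  obtain ⟨h4, h⟩ := rawList_append_inj h
  obtain ⟨h5, h⟩ := rawList_append_inj h
  exact ⟨RawInput.ext h1 h2 h3 h4 h5, h⟩

/-- The raw list of a list of edges. -/
def rawEdges {N k : ℕ} (E : List (Fin N × Fin k × Fin N)) : List (List ℕ) :=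
  E.map fun e => [e.1.1, e.2.1.1, e.2.2.1]

/-- The raw list of a list of tuples. -/
def rawTuples {N n : ℕ} (S : List (Fin n → Fin N)) : List (List ℕ) :=
  S.map fun t => List.ofFn fun j => (t j).1

theorem edgeList_eq {N k : ℕ} (E : List (Fin N × Fin k × Fin N)) :
    InputSym.edgeList E = rawList (rawEdges E) := by
  simp [InputSym.edgeList, rawList, rawEdges, List.flatMap_map]

theorem tupleList_eq {N n : ℕ} (S : List (Fin n → Fin N)) :
    InputSym.tupleList S = rawList (rawTuples S) := by
  simp only [InputSym.tupleList, rawList, rawTuples, List.flatMap_map]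
  congr 2
  funext t
  congr 1
  have : (List.ofFn fun j => (t j).1) = (List.ofFn t).map Fin.val := by
    rw [List.map_ofFn]
    rfl
  rw [this, List.flatMap_map]

/-- The raw form of an input. -/
def DefInput.raw (I : DefInput) : RawInput :=
  ⟨I.nodes, I.letters, I.arity, rawEdges I.edges, rawTuples I.pos⟩

theorem DefInput.encode_eq (I : DefInput) : I.encode = I.raw.encode := by
  simp [DefInput.encode, RawInput.encode, DefInput.raw, edgeList_eq, tupleList_eq]

theorem QBEInput.encode_eq (I : QBEInput) :
    I.encode = I.toDefInput.raw.encode ++ rawList (rawTuples I.neg) := by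
  rw [QBEInput.encode, DefInput.encode_eq, tupleList_eq]

/-- A raw list of tuples over `N` nodes. -/
def ValidTuples (N n : ℕ) (L : List (List ℕ)) : Prop :=
  ∀ t ∈ L, t.length = n ∧ ∀ x ∈ t, x < N

/-- A raw list of edges over `N` nodes and `k` letters. -/
def ValidEdges (N k : ℕ) (L : List (List ℕ)) : Prop :=
  ∀ t ∈ L, ∃ x a y, t = [x, a, y] ∧ x < N ∧ a < k ∧ y < N

theorem validTuples_iff {N n : ℕ} {L : List (List ℕ)} :
    ValidTuples N n L ↔ ∃ S : List (Fin n → Fin N), rawTuples S = L := by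
  constructor
  · intro h
    have : ∀ t ∈ L, ∃ s : Fin n → Fin N, (List.ofFn fun j => (s j).1) = t := by
      intro t ht
      obtain ⟨rfl, hx⟩ := h t ht
      exact ⟨fun j => ⟨t.get j, hx _ (t.get_mem j)⟩, by simp⟩
    clear h
    induction L with
    | nil => exact ⟨[], rfl⟩
    | cons t L ih =>
      obtain ⟨s, hs⟩ := this t (by simp)
      obtain ⟨S, hS⟩ := ih fun t ht => this t (by simp [ht])
      exact ⟨s :: S, by rw [← hs, ← hS]; rfl⟩
  · rintro ⟨S, rfl⟩ t ht
    obtain ⟨s, -, rfl⟩ := List.mem_map.1 ht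
    refine ⟨by simp, fun x hx => ?_⟩
    obtain ⟨j, rfl⟩ := List.mem_ofFn.1 hx
    exact (s j).2

theorem validEdges_iff {N k : ℕ} {L : List (List ℕ)} :
    ValidEdges N k L ↔ ∃ E : List (Fin N × Fin k × Fin N), rawEdges E = L := by
  constructor
  · intro h
    induction L with
    | nil => exact ⟨[], rfl⟩
    | cons t L ih =>
      obtain ⟨x, a, y, rfl, hx, ha, hy⟩ := h t (by simp)
      obtain ⟨S, hS⟩ := ih fun t ht => h t (by simp [ht])
      exact ⟨(⟨x, hx⟩, ⟨a, ha⟩, ⟨y, hy⟩) :: S, by rw [← hS]; rfl⟩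
  · rintro ⟨S, rfl⟩ t ht
    obtain ⟨e, -, rfl⟩ := List.mem_map.1 ht
    exact ⟨_, _, _, rfl, e.1.2, e.2.1.2, e.2.2.2⟩

/-- The raw inputs that come from an input. -/
def RawInput.Valid (J : RawInput) : Prop :=
  ValidEdges J.nodes J.letters J.edges ∧ ValidTuples J.nodes J.arity J.pos

theorem RawInput.valid_iff {J : RawInput} : J.Valid ↔ ∃ I : DefInput, I.raw = J := by
  constructor
  · rintro ⟨h1, h2⟩
    obtain ⟨E, hE⟩ := validEdges_iff.1 h1
    obtain ⟨S, hS⟩ := validTuples_iff.1 h2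
    exact ⟨⟨J.nodes, J.letters, J.arity, E, S⟩, RawInput.ext rfl rfl rfl hE hS⟩
  · rintro ⟨I, rfl⟩
    exact ⟨validEdges_iff.2 ⟨_, rfl⟩, validTuples_iff.2 ⟨_, rfl⟩⟩

/-! ### The shape of the encodings -/

open RegularExpression in
/-- The words of numbers. -/
def numShape : RegularExpression InputSym := (char InputSym.one).star * char InputSym.sep

open RegularExpression in
/-- The words of lists of tuples. -/
def listShape : RegularExpression InputSym :=
  (char InputSym.item * numShape.star).star * char InputSym.close

/-- The words of raw inputs. -/
def inputShape : RegularExpression InputSym :=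
  numShape * (numShape * (numShape * (listShape * listShape)))

theorem mem_kstar_iff_flatMap {α β : Type} {L : Language α} {f : β → List α}
    (h : ∀ w, w ∈ L ↔ ∃ b, w = f b) (w : List α) :
    w ∈ KStar.kstar L ↔ ∃ l : List β, w = l.flatMap f := by
  rw [Language.mem_kstar]
  constructor
  · rintro ⟨l, rfl, hl⟩
    induction l with
    | nil => exact ⟨[], rfl⟩
    | cons a l ih =>
      obtain ⟨b, rfl⟩ := (h a).1 (hl a (by simp))
      obtain ⟨m, hm⟩ := ih fun y hy => hl y (by simp [hy])
      exact ⟨b :: m, by simp [hm]⟩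
  · rintro ⟨l, rfl⟩
    refine ⟨l.map f, by simp [List.flatMap_def], fun y hy => ?_⟩
    obtain ⟨b, -, rfl⟩ := List.mem_map.1 hy
    exact (h _).2 ⟨b, rfl⟩

theorem mem_mul_iff_append {α β β' : Type} {L M : Language α} {f : β → List α} {g : β' → List α}
    (h : ∀ w, w ∈ L ↔ ∃ b, w = f b) (h' : ∀ w, w ∈ M ↔ ∃ b, w = g b) (w : List α) :
    w ∈ L * M ↔ ∃ b b', w = f b ++ g b' := by
  simp only [Language.mem_mul, h, h']
  constructor
  · rintro ⟨_, ⟨b, rfl⟩, _, ⟨b', rfl⟩, rfl⟩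
    exact ⟨b, b', rfl⟩
  · rintro ⟨b, b', rfl⟩
    exact ⟨_, ⟨b, rfl⟩, _, ⟨b', rfl⟩, rfl⟩

theorem mem_char_iff {α : Type} (a : α) (w : List α) :
    w ∈ (RegularExpression.char a).matches' ↔ ∃ _ : Unit, w = [a] :=
  ⟨fun h => ⟨(), h⟩, fun ⟨_, h⟩ => h⟩

theorem mem_numShape (w : List InputSym) : w ∈ numShape.matches' ↔ ∃ m, w = InputSym.num m := by
  refine (mem_mul_iff_append (mem_kstar_iff_flatMap (mem_char_iff .one)) (mem_char_iff .sep)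
    w).trans ?_
  constructor
  · rintro ⟨l, -, rfl⟩
    refine ⟨l.length, ?_⟩
    have : (l.flatMap fun _ => [InputSym.one]) = List.replicate l.length .one := by
      induction l with
      | nil => rfl
      | cons a l ih => simp [ih, List.replicate_succ]
    rw [this]
    rfl
  · rintro ⟨m, rfl⟩
    refine ⟨List.replicate m (), (), ?_⟩
    have : ((List.replicate m ()).flatMap fun _ => [InputSym.one]) = List.replicate m .one := by
      induction m with
      | zero => rfl
      | succ m ih => simp [ih, List.replicate_succ]
    rw [this]
    rfl

theorem mem_listShape (w : List InputSym) : w ∈ listShape.matches' ↔ ∃ L, w = rawList L := by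
  have h1 := mem_mul_iff_append (mem_char_iff InputSym.item) (mem_kstar_iff_flatMap mem_numShape)
  have h2 : ∀ w, w ∈ (RegularExpression.char InputSym.item * numShape.star).matches' ↔
      ∃ t : List ℕ, w = InputSym.item :: t.flatMap InputSym.num := fun w =>
    (h1 w).trans ⟨fun ⟨_, t, h⟩ => ⟨t, h⟩, fun ⟨t, h⟩ => ⟨(), t, h⟩⟩
  refine (mem_mul_iff_append (mem_kstar_iff_flatMap h2) (mem_char_iff .close) w).trans ?_
  constructor
  · rintro ⟨L, -, h⟩
    exact ⟨L, h⟩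
  · rintro ⟨L, h⟩
    exact ⟨L, (), h⟩

theorem mem_inputShape (w : List InputSym) :
    w ∈ inputShape.matches' ↔ ∃ J : RawInput, w = J.encode := by
  have pair : ∀ {α β β' : Type} {L M : Language α} {f : β → List α} {g : β' → List α},
      (∀ w, w ∈ L ↔ ∃ b, w = f b) → (∀ w, w ∈ M ↔ ∃ b, w = g b) →
      ∀ w, w ∈ L * M ↔ ∃ b : β × β', w = f b.1 ++ g b.2 := fun h h' w =>
    (mem_mul_iff_append h h' w).trans (by simp)
  refine (pair mem_numShape (pair mem_numShape (pair mem_numShape (pair mem_listShape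
    mem_listShape))) w).trans ?_
  constructor
  · rintro ⟨⟨a, b, c, d, e⟩, h⟩
    exact ⟨⟨a, b, c, d, e⟩, h⟩
  · rintro ⟨⟨a, b, c, d, e⟩, h⟩
    exact ⟨⟨a, b, c, d, e⟩, h⟩

theorem mem_inputShape_mul (w : List InputSym) :
    w ∈ (inputShape * listShape).matches' ↔ ∃ (J : RawInput) (L : _), w = J.encode ++ rawList L :=
  mem_mul_iff_append mem_inputShape mem_listShape w

/-! ### Parsing an input -/

namespace Prog

/-- Set three counters to `1`, `2` and `3`. -/
def constants : Prog :=
  move [] [.one, .two, .three] * (move [] [.two, .three] * move [] [.three])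

/-- Read the negative examples if there are any. -/
def tail : Bool → Prog
  | true => list .neg .negLen .numNeg
  | false => 1

/-- Read an input. -/
def parse (b : Bool) : Prog :=
  num .nodes * (num .letters * (num .arity * (list .edge .edgeLen .numEdges *
    (list .pos .posLen .numPos * (tail b * (op .eof * constants))))))

end Prog

/-- The word for the negative examples if there are any. -/
def rawTail : Bool → List (List ℕ) → List InputSym
  | true, L => rawList L
  | false, _ => []

/-- A number is stored in `x`. -/
def St.ReadNum (B : ℕ) (x : Reg) (s s' : St) : Prop :=
  ∃ m rest, m ≤ B ∧ s.inp = InputSym.num m ++ rest ∧ s' = (s.setInp rest).setReg x m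

/-- A list is stored in `f` and `g`, its length in `c`. -/
def St.ReadList (B : ℕ) (f g : Arr) (c : Reg) (s s' : St) : Prop :=
  ∃ (L : List (List ℕ)) (rest : _), BoundedList B L ∧
      s.inp = rawList L ++ rest ∧ s' = s.put rest (tupleBits B f g 0 L) c L.length

/-- The negative examples are stored if there are any. -/
def St.ReadTail (B : ℕ) (b : Bool) (s s' : St) : Prop :=
  ∃ (L : List (List ℕ)) (rest : _), BoundedList B L ∧ (b = false → L = []) ∧
    s.inp = rawTail b L ++ rest ∧ s' = s.put rest (tupleBits B .neg .negLen 0 L) .numNeg L.length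

/-- The working counters and a set of counters are zero. -/
def St.Zero (B : ℕ) (S : List Reg) (s : St) : Prop := s.Ready B ∧ ∀ r ∈ S, s.reg r = 0

theorem St.Zero.readNum {S : List Reg} {x : Reg} {s s' : St} (hs : s.Zero B (x :: S))
    (hx : x.Free) (hxS : x ∉ S) (h : s.ReadNum B x s') : s'.Zero B S := by
  obtain ⟨m, rest, hm, -, rfl⟩ := h
  refine ⟨(hs.1.setInp rest).setReg hx hm, fun r hr => ?_⟩
  have : r ≠ x := fun h => hxS (h ▸ hr)
  simpa [St.setReg, St.setInp, this] using hs.2 r (by simp [hr])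

theorem St.Zero.put {S : List Reg} {c : Reg} {s : St} (hs : s.Zero B (c :: S))
    (hc : c.Free) (hcS : c ∉ S) (l : List InputSym) (p : Arr → ℕ → Prop) {a : ℕ} (ha : a ≤ B) :
    (s.put l p c a).Zero B S := by
  refine ⟨hs.1.put l p hc ha, fun r hr => ?_⟩
  have : r ≠ c := fun h => hcS (h ▸ hr)
  simpa [St.put, St.setReg, St.setInp, St.setBits, this] using hs.2 r (by simp [hr])

theorem St.Zero.readList {S : List Reg} {c : Reg} {f g : Arr} {s s' : St}
    (hs : s.Zero B (c :: S)) (hc : c.Free) (hcS : c ∉ S) (h : s.ReadList B f g c s') :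
    s'.Zero B S := by
  obtain ⟨L, rest, hL, -, rfl⟩ := h
  exact hs.put hc hcS _ _ hL.1

theorem St.Zero.readTail {S : List Reg} {b : Bool} {s s' : St}
    (hs : s.Zero B (.numNeg :: S)) (hcS : .numNeg ∉ S) (h : s.ReadTail B b s') :
    s'.Zero B S := by
  obtain ⟨L, rest, hL, -, -, rfl⟩ := h
  exact hs.put (by decide) hcS _ _ hL.1

theorem does_tail (hX : B + 2 ≤ X) (b : Bool) {s : St} (hs : s.Ready B) (h0 : s.reg .val = 0)
    (h0' : s.reg .idx = 0) (hc0 : s.reg .numNeg = 0) :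
    Does X 203 (Prog.tail b) s (s.ReadTail B b) := by
  cases b with
  | true =>
    refine (does_list hX .neg .negLen (c := .numNeg) (by decide) (by decide) (by decide) hs h0 h0'
      hc0).congr (by omega) le_rfl fun s' => ?_
    simp [St.ReadTail, rawTail]
  | false =>
    have key : s.ReadTail B false = fun s' => s' = s := by
      funext s'
      have h1 : ∀ rest, rest = s.inp →
          s.put rest (tupleBits B .neg .negLen 0 []) .numNeg 0 = s := by
        rintro _ rfl
        have : tupleBits B .neg .negLen 0 [] = fun _ _ => False := by
          funext h a
          simp [tupleBits]
        rw [this]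
        conv_lhs => rw [← hc0]
        exact s.put_self .numNeg
      refine propext ⟨?_, ?_⟩
      · rintro ⟨L, rest, -, hL, h2, rfl⟩
        obtain rfl := hL rfl
        exact h1 rest h2.symm
      · rintro rfl
        exact ⟨[], s'.inp, ⟨by simp, by simp⟩, fun _ => rfl, rfl, (h1 _ rfl).symm⟩
    rw [key]
    intro s'
    constructor
    · rintro ⟨l, hl, h⟩
      obtain rfl : l = [] := hl
      exact Eq.symm h
    · rintro rfl
      exact ⟨[], rfl, Nat.zero_le _, rfl⟩

/-- The state after setting the constants. -/
def St.withConstants (s : St) : St := ((s.setReg .one 1).setReg .two 2).setReg .three 3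

/-- The bounded counter `three` is raised three times, so success certifies `3 ≤ B`. -/
theorem does_constants (hX : B + 2 ≤ X) {s : St} (hs : s.Zero B [.one, .two, .three]) :
    Does X 2 Prog.constants s fun s' => 3 ≤ B ∧ s' = s.withConstants := by
  have hX' : 2 ≤ X := by omega
  have h1 : s.reg .one = 0 := hs.2 _ (by simp)
  have h2 : s.reg .two = 0 := hs.2 _ (by simp)
  have h3 : s.reg .three = 0 := hs.2 _ (by simp)
  refine ((does_move hX' [] [.one, .two, .three] hs.1.marked).seq hX' fun _ =>
    (does_move (s := s.mv [] [.one, .two, .three] 1) hX' [] [.two, .three] hs.1.marked).seq hX'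
      fun _ => does_move (s := (s.mv [] [.one, .two, .three] 1).mv [] [.two, .three] 1) hX' []
        [.three] hs.1.marked).congr hX' le_rfl fun s' => ?_
  have : ((s.mv [] [.one, .two, .three] 1).mv [] [.two, .three] 1).mv [] [.three] 1 =
      s.withConstants := by
    ext r <;> try rfl
    simp only [St.mv, St.withConstants, St.setReg, Function.update_apply]
    by_cases h4 : r = .three
    · simp [h4, h3]
    · by_cases h5 : r = .two
      · simp [h5, h2]
      · by_cases h6 : r = .one
        · simp [h6, h1]
        · simp [h4, h5, h6]
  rw [this]
  simp only [← and_assoc]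
  refine and_congr_left fun _ => ?_
  simp [St.mv, h1, h2, h3, Reg.Bounded]
  omega

/-- All numbers and lengths in a raw input are at most `B`. -/
def RawInput.Fits (B : ℕ) (J : RawInput) : Prop :=
  J.nodes ≤ B ∧ J.letters ≤ B ∧ J.arity ≤ B ∧ BoundedList B J.edges ∧ BoundedList B J.pos

/-- The state after reading an input. -/
noncomputable def St.parsed (B : ℕ) (J : RawInput) (L : List (List ℕ)) (s : St) : St :=
  ((((((((s.setReg .nodes J.nodes).setReg .letters J.letters).setReg .arity J.arity).put []
    (tupleBits B .edge .edgeLen 0 J.edges) .numEdges J.edges.length).put []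
      (tupleBits B .pos .posLen 0 J.pos) .numPos J.pos.length).put []
        (tupleBits B .neg .negLen 0 L) .numNeg L.length)).withConstants)

theorem does_parse (hX : B + 2 ≤ X) (b : Bool) {s : St} (hs : s.Ready B) (h0 : ∀ r, s.reg r = 0) :
    Does X 2000 (Prog.parse b) s fun s' => ∃ J L, J.Fits B ∧ BoundedList B L ∧ 3 ≤ B ∧
      (b = false → L = []) ∧ s.inp = J.encode ++ rawTail b L ∧ s' = s.parsed B J L := by
  have hX' : 2 ≤ X := by omega
  have z0 : s.Zero B [.nodes, .letters, .arity, .numEdges, .numPos, .numNeg, .idx, .val, .one,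
    .two, .three] := ⟨hs, fun r _ => h0 r⟩
  refine ((does_num hX (by decide) z0.1 (z0.2 _ (by simp))).mul hX' fun u1 h1 =>
    have z1 := z0.readNum (by decide) (by decide) h1
    (does_num hX (by decide) z1.1 (z1.2 _ (by simp))).mul hX' fun u2 h2 =>
    have z2 := z1.readNum (by decide) (by decide) h2
    (does_num hX (by decide) z2.1 (z2.2 _ (by simp))).mul hX' fun u3 h3 =>
    have z3 := z2.readNum (by decide) (by decide) h3
    (does_list hX .edge .edgeLen (by decide) (by decide) (by decide) z3.1 (z3.2 _ (by simp))
      (z3.2 _ (by simp)) (z3.2 _ (by simp))).mul hX' fun u4 h4 =>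
    have z4 := z3.readList (by decide) (by decide) h4
    (does_list hX .pos .posLen (by decide) (by decide) (by decide) z4.1 (z4.2 _ (by simp))
      (z4.2 _ (by simp)) (z4.2 _ (by simp))).mul hX' fun u5 h5 =>
    have z5 := z4.readList (by decide) (by decide) h5
    (does_tail hX b z5.1 (z5.2 _ (by simp)) (z5.2 _ (by simp)) (z5.2 _ (by simp))).mul hX'
      fun u6 h6 =>
    have z6 := z5.readTail (by decide) h6
    (does_op .eof u6).seq hX' fun _ => does_constants hX ⟨z6.1, fun r hr => z6.2 r (by
      simp at hr ⊢
      tauto)⟩).congr hX' (by norm_num) fun s' => ?_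
  constructor
  · rintro ⟨_, ⟨n, r1, h1, e1, rfl⟩, _, ⟨k, r2, h2, e2, rfl⟩, _, ⟨a, r3, h3, e3, rfl⟩, _,
      ⟨E, r4, h4, e4, rfl⟩, _, ⟨S, r5, h5, e5, rfl⟩, _, ⟨L, r6, h6, hb, e6, rfl⟩, e7, h7, rfl⟩
    have e2 : r1 = _ := e2
    have e3 : r2 = _ := e3
    have e4 : r3 = _ := e4
    have e5 : r4 = _ := e5
    have e6 : r5 = _ := e6
    obtain rfl : r6 = [] := e7
    refine ⟨⟨n, k, a, E, S⟩, L, ⟨h1, h2, h3, h4, h5⟩, h6, h7, hb, ?_, rfl⟩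
    rw [e1, e2, e3, e4, e5, e6]
    simp [RawInput.encode]
  · rintro ⟨⟨n, k, a, E, S⟩, L, ⟨h1, h2, h3, h4, h5⟩, h6, h7, hb, e, rfl⟩
    refine ⟨_, ⟨n, _, h1, ?_, rfl⟩, _, ⟨k, _, h2, rfl, rfl⟩, _, ⟨a, _, h3, rfl, rfl⟩, _,
      ⟨E, _, h4, rfl, rfl⟩, _, ⟨S, _, h5, rfl, rfl⟩, _, ⟨L, [], h6, hb, rfl, rfl⟩, rfl, h7, rfl⟩
    rw [e]
    simp [RawInput.encode]

/-! ### The formulas for a certificate -/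

variable {A : Arr → ℕ → Bool}

namespace Form

/-- Strict inequality. -/
def lt (x y : Reg) : Form := le y x false

/-- Equality. -/
def eq (x y : Reg) : Form := and (le x y true) (le y x true)

/-- Membership in an array. -/
def mem (f : Arr) (xs : List Reg) : Form := rel f xs true

theorem eval_lt (x y : Reg) (v : Reg → ℕ) : (lt x y).Eval B A v ↔ v x < v y := by
  simp [lt, Eval]

theorem eval_eq (x y : Reg) (v : Reg → ℕ) : (eq x y).Eval B A v ↔ v x = v y := by
  simp only [eq, Eval, iff_true]
  omega

end Form

/-- Membership in an array. -/
def InArr (B : ℕ) (A : Arr → ℕ → Bool) (f : Arr) (l : List ℕ) : Prop :=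
  A f (address B 0 l) = true

theorem Form.eval_mem (f : Arr) (xs : List Reg) (v : Reg → ℕ) :
    (mem f xs).Eval B A v ↔ InArr B A f (xs.map v) := Iff.rfl

open Form Reg

/-- The conditions on a certificate: `digit` describes the columns, `image` their images, `goal` the
images of the columns of the positive examples; `reach` and `mem` describe the sets of nodes from
which there is a path to a given node with the label of a given path. -/
structure Cert (B N k n : ℕ) (R : Arr → List ℕ → Prop) : Prop where
  digit : ∀ u ≤ B, ∀ i ≤ B, ∀ x ≤ B, i < k → x < N → ∃ u' ≤ B, R .digit [u', i, x] ∧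
    ∀ j ≤ B, ∀ y ≤ B, j < k → y < N → ¬ j = i → R .digit [u, j, y] → R .digit [u', j, y]
  image : ∀ u ≤ B, (∀ i ≤ B, i < k → ∃ x ≤ B, x < N ∧ R .digit [u, i, x]) →
    ∃ x ≤ B, x < N ∧ R .image [u, x]
  goal : ∀ j ≤ B, ∀ u ≤ B, ∀ x ≤ B, j < n → R .image [u, x] →
    (∀ i ≤ B, i < k → ∃ y ≤ B, R .pos [i, j, y] ∧ R .digit [u, i, y]) → R .goal [j, x]
  transfer : ∀ u ≤ B, ∀ v ≤ B, ∃ i ≤ B, i < k ∧ ∀ x ≤ B, ∀ y ≤ B, ∀ x' ≤ B, ∀ y' ≤ B,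
    R .digit [u, i, x] → R .image [u, y] → R .digit [v, i, x'] → R .image [v, y'] →
      ∀ T ≤ B, R .reach [x', y', x, T] → R .mem [T, y]
  nil : ∀ x ≤ B, ∀ y ≤ B, x < N → y < N → ∃ T ≤ B, R .reach [x, y, x, T] ∧
    ∀ z ≤ B, R .mem [T, z] → z = y
  cons : ∀ x' ≤ B, ∀ y' ≤ B, ∀ x₁ ≤ B, ∀ T₁ ≤ B, R .reach [x', y', x₁, T₁] →
    ∀ e ≤ B, ∀ x ≤ B, ∀ a ≤ B, R .edge [e, 0, x] → R .edge [e, 1, a] → R .edge [e, 2, x₁] →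
      ∃ T ≤ B, R .reach [x', y', x, T] ∧ ∀ y ≤ B, R .mem [T, y] → ∃ e' ≤ B, ∃ y₁ ≤ B,
        R .edge [e', 0, y] ∧ R .edge [e', 1, a] ∧ R .edge [e', 2, y₁] ∧ R .mem [T₁, y₁]

namespace Form

/-- The conditions on a certificate. -/
def cert : Form :=
  .and (.all 0 (.all 1 (.all 2 ((lt (var 1) numPos).imp ((lt (var 2) nodes).imp (.ex 3 (.and
    (mem .digit [var 3, var 1, var 2]) (.all 4 (.all 5 ((lt (var 4) numPos).imp
      ((lt (var 5) nodes).imp ((eq (var 4) (var 1)).neg.imp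
        ((mem .digit [var 0, var 4, var 5]).imp (mem .digit [var 3, var 4, var 5]))))))))))))))
  (.and (.all 0 ((Form.all 1 ((lt (var 1) numPos).imp (.ex 2 (.and (lt (var 2) nodes)
    (mem .digit [var 0, var 1, var 2]))))).imp (.ex 3 (.and (lt (var 3) nodes)
      (mem .image [var 0, var 3])))))
  (.and (.all 0 (.all 1 (.all 2 ((lt (var 0) arity).imp ((mem .image [var 1, var 2]).imp
    ((Form.all 3 ((lt (var 3) numPos).imp (.ex 4 (.and (mem .pos [var 3, var 0, var 4])
      (mem .digit [var 1, var 3, var 4]))))).imp (mem .goal [var 0, var 2])))))))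
  (.and (.all 0 (.all 1 (.ex 2 (.and (lt (var 2) numPos) (.all 3 (.all 4 (.all 5 (.all 6
    ((mem .digit [var 0, var 2, var 3]).imp ((mem .image [var 0, var 4]).imp
      ((mem .digit [var 1, var 2, var 5]).imp ((mem .image [var 1, var 6]).imp
        (.all 7 ((mem .reach [var 5, var 6, var 3, var 7]).imp
          (mem .mem [var 7, var 4])))))))))))))))
  (.and (.all 0 (.all 1 ((lt (var 0) nodes).imp ((lt (var 1) nodes).imp (.ex 2 (.and
    (mem .reach [var 0, var 1, var 0, var 2]) (.all 3 ((mem .mem [var 2, var 3]).imp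
      (eq (var 3) (var 1))))))))))
  (.all 0 (.all 1 (.all 2 (.all 3 ((mem .reach [var 0, var 1, var 2, var 3]).imp (.all 4 (.all 5
    (.all 6 ((mem .edge [var 4, idx, var 5]).imp ((mem .edge [var 4, one, var 6]).imp
      ((mem .edge [var 4, two, var 2]).imp (.ex 7 (.and (mem .reach [var 0, var 1, var 5, var 7])
        (.all 8 ((mem .mem [var 7, var 8]).imp (.ex 9 (.ex 10 (.and (mem .edge [var 9, idx, var 8])
          (.and (mem .edge [var 9, one, var 6]) (.and (mem .edge [var 9, two, var 10])
            (mem .mem [var 3, var 10])))))))))))))))))))))))))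

theorem eval_cert {v : Reg → ℕ} (h0 : v idx = 0) (h1 : v one = 1) (h2 : v two = 2) :
    cert.Eval B A v ↔ Cert B (v nodes) (v numPos) (v arity) (InArr B A) := by
  simp only [cert, Eval, eval_imp, eval_neg, eval_lt, eval_eq, eval_mem, List.map_cons,
    List.map_nil, Function.update_apply, Reg.var.injEq, Fin.reduceEq, reduceCtorEq, if_true,
    if_false, h0, h1, h2]
  exact ⟨fun ⟨a, b, c, d, e, f⟩ => ⟨a, b, c, d, e, f⟩, fun ⟨a, b, c, d, e, f⟩ => ⟨a, b, c, d, e, f⟩⟩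

/-- The existence of an invalid list of tuples. -/
def invalidTuples (f g : Arr) : Form :=
  .or (.ex 0 (.ex 1 (.and (mem g [var 0, var 1]) (eq (var 1) arity).neg)))
    (.ex 0 (.ex 1 (.ex 2 (.and (mem f [var 0, var 1, var 2]) (lt (var 2) nodes).neg))))

theorem eval_invalidTuples {f g : Arr} {v : Reg → ℕ} : (invalidTuples f g).Eval B A v ↔
    (∃ i ≤ B, ∃ m ≤ B, InArr B A g [i, m] ∧ ¬ m = v arity) ∨
      ∃ i ≤ B, ∃ j ≤ B, ∃ x ≤ B, InArr B A f [i, j, x] ∧ ¬ x < v nodes := by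
  simp only [invalidTuples, Eval, eval_neg, eval_lt, eval_eq, eval_mem, List.map_cons,
    List.map_nil, Function.update_apply, Reg.var.injEq, Fin.reduceEq, reduceCtorEq, if_true,
    if_false]

/-- The existence of an invalid list of edges. -/
def invalidEdges : Form :=
  .or (.ex 0 (.ex 1 (.and (mem .edgeLen [var 0, var 1]) (eq (var 1) three).neg)))
    (.ex 0 (.ex 1 (.or (.and (mem .edge [var 0, idx, var 1]) (lt (var 1) nodes).neg)
      (.or (.and (mem .edge [var 0, one, var 1]) (lt (var 1) letters).neg)
        (.and (mem .edge [var 0, two, var 1]) (lt (var 1) nodes).neg)))))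

theorem eval_invalidEdges {v : Reg → ℕ} (h0 : v idx = 0) (h1 : v one = 1) (h2 : v two = 2)
    (h3 : v three = 3) : invalidEdges.Eval B A v ↔
    (∃ i ≤ B, ∃ m ≤ B, InArr B A .edgeLen [i, m] ∧ ¬ m = 3) ∨
      ∃ i ≤ B, ∃ x ≤ B, (InArr B A .edge [i, 0, x] ∧ ¬ x < v nodes) ∨
        (InArr B A .edge [i, 1, x] ∧ ¬ x < v letters) ∨
          (InArr B A .edge [i, 2, x] ∧ ¬ x < v nodes) := by
  simp only [invalidEdges, Eval, eval_neg, eval_lt, eval_eq, eval_mem, List.map_cons,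
    List.map_nil, Function.update_apply, Reg.var.injEq, Fin.reduceEq, reduceCtorEq, if_true,
    if_false, h0, h1, h2, h3]

/-- The tuple described by `goal` is a negative example, respectively no positive example. -/
def target : Bool → Form
  | true => .ex 0 (.and (lt (var 0) numNeg) (.all 1 (.all 2 ((lt (var 1) arity).imp
      ((mem .goal [var 1, var 2]).imp (mem .neg [var 0, var 1, var 2]))))))
  | false => .all 0 ((lt (var 0) numPos).imp (.ex 1 (.and (lt (var 1) arity) (.all 2
      ((mem .pos [var 0, var 1, var 2]).imp (mem .goal [var 1, var 2]).neg)))))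

theorem eval_target_true {v : Reg → ℕ} : (target true).Eval B A v ↔
    ∃ i ≤ B, i < v numNeg ∧ ∀ j ≤ B, ∀ x ≤ B, j < v arity → InArr B A .goal [j, x] →
      InArr B A .neg [i, j, x] := by
  simp only [target, Eval, eval_imp, eval_lt, eval_mem, List.map_cons,
    List.map_nil, Function.update_apply, Reg.var.injEq, Fin.reduceEq, reduceCtorEq, if_true,
    if_false]

theorem eval_target_false {v : Reg → ℕ} : (target false).Eval B A v ↔
    ∀ i ≤ B, i < v numPos → ∃ j ≤ B, j < v arity ∧ ∀ x ≤ B, InArr B A .pos [i, j, x] →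
      ¬ InArr B A .goal [j, x] := by
  simp only [target, Eval, eval_imp, eval_neg, eval_lt, eval_mem, List.map_cons,
    List.map_nil, Function.update_apply, Reg.var.injEq, Fin.reduceEq, reduceCtorEq, if_true,
    if_false]

/-- The input is invalid, or the certificate is correct. -/
def main (b : Bool) : Form :=
  .or invalidEdges (.or (invalidTuples .pos .posLen) (.or (invalidTuples .neg .negLen)
    (.and cert (target b))))

theorem ok_main (b : Bool) : (main b).Ok := by
  cases b <;> decide

end Form

/-! ### Correctness of certificates -/

variable {R : Arr → List ℕ → Prop}

/-- The relations describe a list of tuples. -/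
structure Listed (B : ℕ) (R : Arr → List ℕ → Prop) (f g : Arr) (L : List (List ℕ)) : Prop where
  entry : ∀ i ≤ B, ∀ j ≤ B, ∀ m ≤ B,
    (R f [i, j, m] ↔ ∃ t, L[i]? = some t ∧ t[j]? = some m)
  length : ∀ i ≤ B, ∀ m ≤ B, (R g [i, m] ↔ ∃ t, L[i]? = some t ∧ t.length = m)

theorem Listed.tuple_iff {N n : ℕ} {S : List (Fin n → Fin N)} {f g : Arr}
    (h : Listed B R f g (rawTuples S)) {i j m : ℕ} (hi : i ≤ B) (hj : j ≤ B) (hm : m ≤ B) :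
    R f [i, j, m] ↔ ∃ (h : i < S.length) (h' : j < n), (S.get ⟨i, h⟩ ⟨j, h'⟩).1 = m := by
  rw [h.entry i hi j hj m hm]
  simp only [rawTuples, List.getElem?_map, Option.map_eq_some_iff]
  constructor
  · rintro ⟨_, ⟨t, h1, rfl⟩, h2⟩
    obtain ⟨hi, rfl⟩ := List.getElem?_eq_some_iff.1 h1
    obtain ⟨hj, h3⟩ := List.getElem?_eq_some_iff.1 h2
    exact ⟨hi, by simpa using hj, by simpa using h3⟩
  · rintro ⟨h1, h2, rfl⟩
    exact ⟨_, ⟨_, List.getElem?_eq_getElem h1, rfl⟩, by simp [h2]⟩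

theorem Listed.edge_iff {I : DefInput} (h : Listed B R .edge .edgeLen (rawEdges I.edges))
    (h2 : 2 ≤ B) {i x a y : ℕ} (hi : i ≤ B) (hx : x ≤ B) (ha : a ≤ B) (hy : y ≤ B) :
    (R .edge [i, 0, x] ∧ R .edge [i, 1, a] ∧ R .edge [i, 2, y]) ↔
      ∃ e, I.edges[i]? = some e ∧ e.1.1 = x ∧ e.2.1.1 = a ∧ e.2.2.1 = y := by
  rw [h.entry i hi 0 (by omega) x hx, h.entry i hi 1 (by omega) a ha, h.entry i hi 2 h2 y hy]
  simp only [rawEdges, List.getElem?_map, Option.map_eq_some_iff]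
  constructor
  · rintro ⟨⟨_, ⟨e, h1, rfl⟩, h2⟩, ⟨_, ⟨e', h1', rfl⟩, h2'⟩, ⟨_, ⟨e'', h1'', rfl⟩, h2''⟩⟩
    rw [h1] at h1' h1''
    obtain rfl := Option.some.inj h1'
    obtain rfl := Option.some.inj h1''
    exact ⟨e, h1, by simpa using h2, by simpa using h2', by simpa using h2''⟩
  · rintro ⟨e, h1, rfl, rfl, rfl⟩
    exact ⟨⟨_, ⟨e, h1, rfl⟩, rfl⟩, ⟨_, ⟨e, h1, rfl⟩, rfl⟩, ⟨_, ⟨e, h1, rfl⟩, rfl⟩⟩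

theorem Listed.exists_edge {I : DefInput} (h : Listed B R .edge .edgeLen (rawEdges I.edges))
    (h2 : 2 ≤ B) (hN : I.nodes ≤ B) (hk : I.letters ≤ B) (hE : I.edges.length ≤ B)
    {x y : Fin I.nodes} {a : Fin I.letters} (he : (x, a, y) ∈ I.graph.edge) :
    ∃ e ≤ B, R .edge [e, 0, x] ∧ R .edge [e, 1, a] ∧ R .edge [e, 2, y] := by
  obtain ⟨i, hi⟩ := List.getElem?_of_mem (show (x, a, y) ∈ I.edges from he)
  obtain ⟨hl, -⟩ := List.getElem?_eq_some_iff.1 hi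
  have := x.2
  have := y.2
  have := a.2
  exact ⟨i, by omega, (h.edge_iff h2 (by omega) (by omega) (by omega) (by omega)).2
    ⟨_, hi, rfl, rfl, rfl⟩⟩

theorem Listed.edge_mem {I : DefInput} (h : Listed B R .edge .edgeLen (rawEdges I.edges))
    (h2 : 2 ≤ B) {i x a y : ℕ} (hi : i ≤ B) (hx : x ≤ B) (ha : a ≤ B) (hy : y ≤ B)
    (h0 : R .edge [i, 0, x]) (h1 : R .edge [i, 1, a]) (h2' : R .edge [i, 2, y]) :
    ∃ (x' y' : Fin I.nodes) (a' : Fin I.letters), x'.1 = x ∧ y'.1 = y ∧ a'.1 = a ∧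
      (x', a', y') ∈ I.graph.edge := by
  obtain ⟨⟨x', a', y'⟩, he, h3, h4, h5⟩ := (h.edge_iff h2 hi hx ha hy).1 ⟨h0, h1, h2'⟩
  exact ⟨x', y', a', h3, h5, h4, List.mem_of_getElem? he⟩

/-! ### Soundness of certificates -/

/-- The condition `digit` allows one coordinate of a coded tuple to be overwritten. Starting from
the arbitrary number `0` and overwriting all coordinates in turn yields a code for any tuple. Codes
need not be unique. -/
theorem Cert.exists_code {N k n : ℕ} (h : Cert B N k n R) (hN : N ≤ B) (hk : k ≤ B)
    (f : Fin k → Fin N) : ∃ u ≤ B, ∀ i : Fin k, R .digit [u, i, f i] := by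
  have : ∀ m ≤ k, ∃ u ≤ B, ∀ i : Fin k, i.1 < m → R .digit [u, i, f i] := by
    intro m
    induction m with
    | zero => exact fun _ => ⟨0, Nat.zero_le _, fun i hi => absurd hi (by omega)⟩
    | succ m ih =>
      intro hm
      obtain ⟨u, hu, h1⟩ := ih (by omega)
      have hx := (f ⟨m, hm⟩).2
      obtain ⟨u', hu', h2, h3⟩ := h.digit u hu m (by omega) (f ⟨m, hm⟩) (by omega) hm hx
      refine ⟨u', hu', fun i hi => ?_⟩
      by_cases him : i.1 = m
      · obtain rfl : i = ⟨m, hm⟩ := Fin.ext him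
        exact h2
      · have := (f i).2
        exact h3 i (by omega) (f i) (by omega) i.2 (by omega) him (h1 i (by omega))
  obtain ⟨u, hu, h1⟩ := this k le_rfl
  exact ⟨u, hu, fun i => h1 i i.2⟩

/-- Induction on the word, prepending letters by `cons`. A guessed set `T` only has to be contained
in the true set of starting nodes: being too small merely makes the condition `transfer` harder to
satisfy. -/
theorem Cert.exists_reach {I : DefInput} {k n : ℕ} (h : Cert B I.nodes k n R) (h2 : 2 ≤ B)
    (hN : I.nodes ≤ B) (hk : I.letters ≤ B) (hE : I.edges.length ≤ B)
    (hL : Listed B R .edge .edgeLen (rawEdges I.edges)) {x x' : Fin I.nodes}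
    {w : List (Fin I.letters)} (hw : I.graph.HasPath x w x') (y' : Fin I.nodes) :
    ∃ T ≤ B, R .reach [x', y', x, T] ∧
      ∀ y : Fin I.nodes, R .mem [T, y] → I.graph.HasPath y w y' := by
  have hx' := x'.2
  have hy' := y'.2
  induction w generalizing x with
  | nil =>
    obtain rfl : x = x' := hw
    obtain ⟨T, hT, h1, h3⟩ := h.nil x (by omega) y' (by omega) x.2 y'.2
    refine ⟨T, hT, h1, fun y hy => ?_⟩
    have := y.2
    exact Fin.ext (h3 y (by omega) hy)
  | cons a w ih =>
    obtain ⟨x₁, he, hw⟩ := hw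
    obtain ⟨T₁, hT₁, h1, h3⟩ := ih hw
    obtain ⟨e, heB, e0, e1, e2⟩ := hL.exists_edge h2 hN hk hE he
    have := x.2
    have := x₁.2
    have := a.2
    obtain ⟨T, hT, h4, h5⟩ := h.cons x' (by omega) y' (by omega) x₁ (by omega) T₁ hT₁ h1 e heB x
      (by omega) a (by omega) e0 e1 e2
    refine ⟨T, hT, h4, fun y hy => ?_⟩
    have := y.2
    obtain ⟨e', he', y₁, hy₁, e0', e1', e2', h6⟩ := h5 y (by omega) hy
    obtain ⟨z, z₁, c, hz, rfl, hc, h7⟩ := hL.edge_mem h2 he' (by omega) (by omega) hy₁ e0' e1' e2'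
    obtain rfl := Fin.ext hz
    obtain rfl := Fin.ext hc
    exact ⟨z₁, h7, h3 z₁ h6⟩

/-- The map `g` is obtained by choosing a code for every tuple and an image for that code. The
relations need not be functional, since the conditions hold for all codes and images. -/
theorem Cert.exists_forced {I : DefInput} (h : Cert B I.nodes I.pos.length I.arity R) (h2 : 2 ≤ B)
    (hN : I.nodes ≤ B) (hk : I.letters ≤ B) (hn : I.arity ≤ B) (hE : I.edges.length ≤ B)
    (hP : I.pos.length ≤ B) (hL : Listed B R .edge .edgeLen (rawEdges I.edges))
    (hL' : Listed B R .pos .posLen (rawTuples I.pos)) :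
    ∃ b, I.Forced b ∧ ∀ j : Fin I.arity, R .goal [j, b j] := by
  choose u hu hd using h.exists_code hN hP
  have him : ∀ f, ∃ x : Fin I.nodes, R .image [u f, x] := by
    intro f
    obtain ⟨x, -, hx, h1⟩ := h.image (u f) (hu f) fun i _ hi =>
      ⟨f ⟨i, hi⟩, (f ⟨i, hi⟩).2.le.trans hN, (f ⟨i, hi⟩).2, hd f ⟨i, hi⟩⟩
    exact ⟨⟨x, hx⟩, h1⟩
  choose g hg using him
  have lt : ∀ x : Fin I.nodes, x.1 ≤ B := fun x => x.2.le.trans hN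
  refine ⟨_, ⟨g, fun f f' => ?_, rfl⟩, fun j => ?_⟩
  · obtain ⟨i, -, hi, h1⟩ := h.transfer (u f) (hu f) (u f') (hu f')
    refine ⟨⟨i, hi⟩, fun w hw => ?_⟩
    obtain ⟨T, hT, h3, h4⟩ := h.exists_reach h2 hN hk hE hL hw (g f')
    exact h4 _ (h1 _ (lt _) _ (lt _) _ (lt _) _ (lt _) (hd f ⟨i, hi⟩) (hg f) (hd f' ⟨i, hi⟩) (hg f')
      T hT h3)
  · refine h.goal j (j.2.le.trans hn) _ (hu _) _ (lt _) j.2 (hg _) fun i hi hi' =>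
      ⟨I.pos.get ⟨i, hi'⟩ j, lt _, ?_, hd _ ⟨i, hi'⟩⟩
    exact (hL'.tuple_iff hi (j.2.le.trans hn) (lt _)).2 ⟨hi', j.2, rfl⟩

/-! ### Completeness of certificates -/

/-- The number of indices of an array of a certificate. -/
def Arr.dim (f : Arr) : ℕ :=
  match f with
  | reach => 4
  | digit => 3
  | _ => 2

/-- The intended contents of the arrays of a certificate. -/
def certSet {V A : Type} {n k : ℕ} (G : GraphDB V A) (r : V → ℕ) (g : (Fin k → V) → V)
    (b : Fin n → V) (c : (Fin k → V) → ℕ) (d : Set V → ℕ) (f : Arr) : Set (List ℕ) :=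
  match f with
  | .digit => {l | ∃ f i, l = [c f, i.1, r (f i)]}
  | .image => {l | ∃ f, l = [c f, r (g f)]}
  | .goal => {l | ∃ j, l = [j.1, r (b j)]}
  | .reach => {l | ∃ x' y' x w, G.HasPath x w x' ∧
      l = [r x', r y', r x, d {y | G.HasPath y w y'}]}
  | .mem => {l | ∃ S, ∃ y ∈ S, l = [d S, r y]}
  | _ => ∅

/-- With tuples numbered injectively by `c` and sets of nodes by `d`, the intended relations satisfy
all conditions. Injectivity recovers the tuple or set from its number; numbers that code nothing
satisfy the conditions for trivial reasons. -/
theorem cert_of_transfers {I : DefInput} (h2 : 2 ≤ B) (hN : I.nodes ≤ B) (hk : I.letters ≤ B)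
    (hE : I.edges.length ≤ B) (hP : I.pos.length ≤ B)
    {g : (Fin I.pos.length → Fin I.nodes) → Fin I.nodes} (hg : I.graph.Transfers g)
    {c : (Fin I.pos.length → Fin I.nodes) → ℕ} (hc : Function.Injective c) (hcB : ∀ f, c f ≤ B)
    {d : Set (Fin I.nodes) → ℕ} (hd : Function.Injective d) (hdB : ∀ S, d S ≤ B)
    (hR : ∀ f l, f.IsCert = true → l.length = f.dim → (∀ x ∈ l, x ≤ B) → (R f l ↔
      l ∈ certSet I.graph Fin.val g (fun j => g fun i => I.pos.get i j) c d f))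
    (hL : Listed B R .edge .edgeLen (rawEdges I.edges))
    (hL' : Listed B R .pos .posLen (rawTuples I.pos)) :
    Cert B I.nodes I.pos.length I.arity R := by
  have lt : ∀ x : Fin I.nodes, x.1 ≤ B := fun x => x.2.le.trans hN
  have r1 : ∀ u ≤ B, ∀ i ≤ B, ∀ x ≤ B, (R .digit [u, i, x] ↔ ∃ f i', u = c f ∧ i = i'.1 ∧
      x = (f i').1) := by
    intro u hu i hi x hx
    rw [hR _ _ rfl rfl (by simp [hu, hi, hx])]
    simp [certSet]
  have r2 : ∀ u ≤ B, ∀ x ≤ B, (R .image [u, x] ↔ ∃ f, u = c f ∧ x = (g f).1) := by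
    intro u hu x hx
    rw [hR _ _ rfl rfl (by simp [hu, hx])]
    simp [certSet]
  have r3 : ∀ j ≤ B, ∀ x ≤ B, (R .goal [j, x] ↔ ∃ j' : Fin I.arity, j = j'.1 ∧
      x = (g fun i => I.pos.get i j').1) := by
    intro u hu x hx
    rw [hR _ _ rfl rfl (by simp [hu, hx])]
    simp [certSet]
  have r4 : ∀ a ≤ B, ∀ e ≤ B, ∀ x ≤ B, ∀ T ≤ B, (R .reach [a, e, x, T] ↔
      ∃ (x' y' x₁ : Fin I.nodes) (w : _), I.graph.HasPath x₁ w x' ∧ a = x'.1 ∧ e = y'.1 ∧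
        x = x₁.1 ∧ T = d {y | I.graph.HasPath y w y'}) := by
    intro a ha e he x hx T hT
    rw [hR _ _ rfl rfl (by simp [ha, he, hx, hT])]
    simp [certSet]
  have r5 : ∀ T ≤ B, ∀ y ≤ B, (R .mem [T, y] ↔ ∃ S, ∃ y' ∈ S, T = d S ∧ y = y'.1) := by
    intro u hu x hx
    rw [hR _ _ rfl rfl (by simp [hu, hx])]
    simp [certSet]
  -- Transferring asserts that a coordinate exists, so there is at least one positive example.
  have hpos : 0 < I.pos.length := by
    by_contra h
    have emp : Fin I.pos.length → False := fun i => h (i.1.zero_le.trans_lt i.2)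
    obtain ⟨i, -⟩ := hg (fun i => (emp i).elim) fun i => (emp i).elim
    exact emp i
  constructor
  · intro u hu i hi x hx hik hxN
    by_cases h : ∃ f, u = c f
    · obtain ⟨f, rfl⟩ := h
      refine ⟨c (Function.update f ⟨i, hik⟩ ⟨x, hxN⟩), hcB _, (r1 _ (hcB _) _ hi _ hx).2
        ⟨_, ⟨i, hik⟩, rfl, rfl, by simp⟩, fun j hj y hy hjk hyN hji h3 => ?_⟩
      obtain ⟨f', j', h4, rfl, rfl⟩ := (r1 _ hu _ hj _ hy).1 h3
      obtain rfl := hc h4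
      have hne : j' ≠ ⟨i, hik⟩ := fun h => hji (congrArg Fin.val h)
      exact (r1 _ (hcB _) _ hj _ hy).2 ⟨_, j', rfl, rfl, by simp [hne]⟩
    -- If `u` codes nothing, it has no digits to preserve, and a constant tuple will do.
    · refine ⟨c fun _ => ⟨x, hxN⟩, hcB _, (r1 _ (hcB _) _ hi _ hx).2 ⟨_, ⟨i, hik⟩, rfl, rfl, rfl⟩,
        fun j hj y hy _ _ _ h3 => ?_⟩
      obtain ⟨f', j', h4, -⟩ := (r1 _ hu _ hj _ hy).1 h3
      exact (h ⟨_, h4⟩).elim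
  · intro u hu h
    -- A digit at the single coordinate `0` already shows that `u` is a code.
    obtain ⟨x, hx, hxN, h1⟩ := h 0 (Nat.zero_le _) hpos
    obtain ⟨f, -, rfl, -⟩ := (r1 _ hu _ (Nat.zero_le _) _ hx).1 h1
    exact ⟨g f, lt _, (g f).2, (r2 _ hu _ (lt _)).2 ⟨f, rfl, rfl⟩⟩
  · intro j hj u hu x hx hjn h1 h3
    obtain ⟨f, rfl, rfl⟩ := (r2 _ hu _ hx).1 h1
    refine (r3 _ hj _ hx).2 ⟨⟨j, hjn⟩, rfl, ?_⟩
    congr 2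
    funext i
    obtain ⟨y, hy, h4, h5⟩ := h3 i (i.2.le.trans hP) i.2
    obtain ⟨f', i', h6, h7, rfl⟩ := (r1 _ hu _ (i.2.le.trans hP) _ hy).1 h5
    obtain rfl := hc h6
    obtain rfl := Fin.ext h7
    obtain ⟨_, _, h8⟩ := (hL'.tuple_iff (i.2.le.trans hP) hj hy).1 h4
    exact Fin.ext h8.symm
  · intro u hu v hv
    by_cases h : (∃ f, u = c f) ∧ ∃ f, v = c f
    · obtain ⟨⟨f, rfl⟩, ⟨f', rfl⟩⟩ := h
      obtain ⟨i, hi⟩ := hg f f'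
      refine ⟨i, i.2.le.trans hP, i.2, fun x hx y hy x' hx' y' hy' h1 h3 h4 h5 T hT h6 => ?_⟩
      obtain ⟨_, i', e1, e2, rfl⟩ := (r1 _ hu _ (i.2.le.trans hP) _ hx).1 h1
      obtain rfl := hc e1
      obtain rfl := Fin.ext e2
      obtain ⟨_, e1, rfl⟩ := (r2 _ hu _ hy).1 h3
      obtain rfl := hc e1
      obtain ⟨_, i', e1, e2, rfl⟩ := (r1 _ hv _ (i.2.le.trans hP) _ hx').1 h4
      obtain rfl := hc e1
      obtain rfl := Fin.ext e2
      obtain ⟨_, e1, rfl⟩ := (r2 _ hv _ hy').1 h5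
      obtain rfl := hc e1
      obtain ⟨z', t', z, w, hw, e1, e2, e3, rfl⟩ := (r4 _ hx' _ hy' _ hx _ hT).1 h6
      obtain rfl := Fin.ext e1
      obtain rfl := Fin.ext e2
      obtain rfl := Fin.ext e3
      exact (r5 _ hT _ hy).2 ⟨_, g f, hi w hw, rfl, rfl⟩
    · refine ⟨0, Nat.zero_le _, hpos, fun x hx y hy x' hx' y' hy' h1 h3 h4 h5 => ?_⟩
      obtain ⟨f, e1, -⟩ := (r2 _ hu _ hy).1 h3
      obtain ⟨f', e1', -⟩ := (r2 _ hv _ hy').1 h5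
      exact (h ⟨⟨f, e1⟩, ⟨f', e1'⟩⟩).elim
  · intro x hx y hy hxN hyN
    refine ⟨_, hdB _, (r4 _ hx _ hy _ hx _ (hdB _)).2
      ⟨⟨x, hxN⟩, ⟨y, hyN⟩, ⟨x, hxN⟩, [], rfl, rfl, rfl, rfl, rfl⟩, fun z hz h => ?_⟩
    obtain ⟨S, y', hy', e1, rfl⟩ := (r5 _ (hdB _) _ hz).1 h
    obtain rfl := hd e1
    have : y' = ⟨y, hyN⟩ := hy'
    rw [this]
  · intro x' hx' y' hy' x₁ hx₁ T₁ hT₁ h e he x hx a ha e0 e1 e2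
    obtain ⟨z', t', z₁, w, hw, rfl, rfl, rfl, rfl⟩ := (r4 _ hx' _ hy' _ hx₁ _ hT₁).1 h
    obtain ⟨z, z₁', b, rfl, h3, rfl, h4⟩ := hL.edge_mem h2 he hx ha hx₁ e0 e1 e2
    obtain rfl := Fin.ext h3
    refine ⟨_, hdB _, (r4 _ hx' _ hy' _ hx _ (hdB _)).2
      ⟨z', t', z, b :: w, ⟨_, h4, hw⟩, rfl, rfl, rfl, rfl⟩, fun y hy h => ?_⟩
    obtain ⟨S, y', hy', e1, rfl⟩ := (r5 _ (hdB _) _ hy).1 h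
    obtain rfl := hd e1
    obtain ⟨y₁, h5, h6⟩ := hy'
    obtain ⟨e', he', h7, h8, h9⟩ := hL.exists_edge h2 hN hk hE h5
    exact ⟨e', he', y₁, lt _, h7, h8, h9, (r5 _ hT₁ _ (lt _)).2 ⟨_, y₁, h6, rfl, rfl⟩⟩

/-! ### Correctness of the check -/

/-- All indices are at most `B`, so distinct index tuples have distinct addresses and no bit has two
meanings. -/
theorem listed_of_tupleBits {f g : Arr} (hfg : f ≠ g) {A : Arr → ℕ → Bool} {L : List (List ℕ)}
    (hL : BoundedList B L) (hf : ∀ a, A f a = true ↔ tupleBits B f g 0 L f a)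
    (hg : ∀ a, A g a = true ↔ tupleBits B f g 0 L g a) : Listed B (InArr B A) f g L := by
  have hi : ∀ {i t}, L[i]? = some t → i ≤ B ∧ t.length ≤ B ∧ ∀ m ∈ t, m ≤ B := by
    intro i t h
    obtain ⟨h1, rfl⟩ := List.getElem?_eq_some_iff.1 h
    have h2 := hL.2 _ (List.getElem_mem h1)
    exact ⟨h1.le.trans hL.1, h2.2, h2.1⟩
  constructor
  · intro i hiB j hj m hm
    rw [InArr, hf]
    simp only [tupleBits, true_and, hfg, false_and, or_false, zero_add]
    constructor
    · rintro ⟨i', j', t, m', h1, h2, h3⟩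
      obtain ⟨h4, h5, h6⟩ := hi h1
      obtain ⟨h7, rfl⟩ := List.getElem?_eq_some_iff.1 h2
      have h8 := (address_injective (l := [i, j, m]) (m := [i', j', t[j']]) rfl
        (by simp [hiB, hj, hm])
        (by simpa [h4, h7.le.trans h5] using h6 _ (List.getElem_mem h7)) h3).2
      simp only [List.cons.injEq, and_true] at h8
      obtain ⟨rfl, rfl, rfl⟩ := h8
      exact ⟨t, h1, h2⟩
    · rintro ⟨t, h1, h2⟩
      exact ⟨i, j, t, m, h1, h2, rfl⟩
  · intro i hiB m hm
    rw [InArr, hg]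
    simp only [tupleBits, true_and, hfg.symm, false_and, false_or, zero_add]
    constructor
    · rintro ⟨i', t, h1, h3⟩
      obtain ⟨h4, h5, h6⟩ := hi h1
      have h8 := (address_injective (l := [i, m]) (m := [i', t.length]) rfl (by simp [hiB, hm])
        (by simp [h4, h5]) h3).2
      simp only [List.cons.injEq, and_true] at h8
      obtain ⟨rfl, rfl⟩ := h8
      exact ⟨t, h1, rfl⟩
    · rintro ⟨t, h1, rfl⟩
      exact ⟨i, t, h1, rfl⟩

theorem Listed.invalidTuples_iff {R : Arr → List ℕ → Prop} {f g : Arr} {L : List (List ℕ)}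
    (h : Listed B R f g L) (hB : BoundedList B L) {N n : ℕ} :
    ((∃ i ≤ B, ∃ m ≤ B, R g [i, m] ∧ ¬ m = n) ∨
      ∃ i ≤ B, ∃ j ≤ B, ∃ x ≤ B, R f [i, j, x] ∧ ¬ x < N) ↔ ¬ ValidTuples N n L := by
  constructor
  · rintro (⟨i, hi, m, hm, h1, h2⟩ | ⟨i, hi, j, hj, x, hx, h1, h2⟩) hv
    · obtain ⟨t, h3, rfl⟩ := (h.length i hi m hm).1 h1
      exact h2 (hv t (List.mem_of_getElem? h3)).1
    · obtain ⟨t, h3, h4⟩ := (h.entry i hi j hj x hx).1 h1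
      exact h2 ((hv t (List.mem_of_getElem? h3)).2 x (List.mem_of_getElem? h4))
  · intro hv
    by_contra hc
    refine hv fun t ht => ?_
    obtain ⟨i, hi⟩ := List.getElem?_of_mem ht
    have hiB : i ≤ B := (List.getElem?_eq_some_iff.1 hi).1.le.trans hB.1
    obtain ⟨h1, h2⟩ := hB.2 t ht
    constructor
    · by_contra hn
      exact hc (Or.inl ⟨i, hiB, t.length, h2, (h.length _ hiB _ h2).2 ⟨t, hi, rfl⟩, hn⟩)
    · intro x hx
      obtain ⟨j, hj⟩ := List.getElem?_of_mem hx
      have hjB : j ≤ B := (List.getElem?_eq_some_iff.1 hj).1.le.trans h2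
      by_contra hn
      exact hc (Or.inr ⟨i, hiB, j, hjB, x, h1 x hx,
        (h.entry _ hiB _ hjB _ (h1 x hx)).2 ⟨t, hi, hj⟩, hn⟩)

theorem Listed.invalidEdges_iff {R : Arr → List ℕ → Prop} {f g : Arr} {L : List (List ℕ)}
    (h : Listed B R f g L) (hB : BoundedList B L) (h2 : 2 ≤ B) {N k : ℕ} :
    ((∃ i ≤ B, ∃ m ≤ B, R g [i, m] ∧ ¬ m = 3) ∨
      ∃ i ≤ B, ∃ x ≤ B, (R f [i, 0, x] ∧ ¬ x < N) ∨ (R f [i, 1, x] ∧ ¬ x < k) ∨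
          (R f [i, 2, x] ∧ ¬ x < N)) ↔ ¬ ValidEdges N k L := by
  constructor
  · rintro (⟨i, hi, m, hm, h1, h2⟩ | ⟨i, hi, x, hx, h1⟩) hv
    · obtain ⟨t, h3, rfl⟩ := (h.length i hi m hm).1 h1
      obtain ⟨_, _, _, rfl, -⟩ := hv t (List.mem_of_getElem? h3)
      exact h2 rfl
    · rcases h1 with ⟨h1, hn⟩ | ⟨h1, hn⟩ | ⟨h1, hn⟩
      · obtain ⟨t, h3, h4⟩ := (h.entry i hi 0 (by omega) x hx).1 h1
        obtain ⟨_, _, _, rfl, h5, h6, h7⟩ := hv t (List.mem_of_getElem? h3)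
        obtain rfl : _ = x := by simpa using h4
        exact hn h5
      · obtain ⟨t, h3, h4⟩ := (h.entry i hi 1 (by omega) x hx).1 h1
        obtain ⟨_, _, _, rfl, h5, h6, h7⟩ := hv t (List.mem_of_getElem? h3)
        obtain rfl : _ = x := by simpa using h4
        exact hn h6
      · obtain ⟨t, h3, h4⟩ := (h.entry i hi 2 (by omega) x hx).1 h1
        obtain ⟨_, _, _, rfl, h5, h6, h7⟩ := hv t (List.mem_of_getElem? h3)
        obtain rfl : _ = x := by simpa using h4
        exact hn h7
  · intro hv
    by_contra hc
    refine hv fun t ht => ?_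
    obtain ⟨i, hi⟩ := List.getElem?_of_mem ht
    have hiB : i ≤ B := (List.getElem?_eq_some_iff.1 hi).1.le.trans hB.1
    obtain ⟨h1, h3⟩ := hB.2 t ht
    have hl : t.length = 3 := by
      by_contra hn
      exact hc (Or.inl ⟨i, hiB, t.length, h3, (h.length _ hiB _ h3).2 ⟨t, hi, rfl⟩, hn⟩)
    obtain ⟨x, a, y, rfl⟩ := List.length_eq_three.1 hl
    simp only [List.mem_cons, List.not_mem_nil, or_false, forall_eq_or_imp, forall_eq] at h1
    obtain ⟨hx, ha, hy⟩ := h1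
    refine ⟨x, a, y, rfl, ?_, ?_, ?_⟩ <;> by_contra hn
    · exact hc (Or.inr ⟨i, hiB, x, hx, Or.inl
        ⟨(h.entry _ hiB _ (by omega) _ hx).2 ⟨_, hi, rfl⟩, hn⟩⟩)
    · exact hc (Or.inr ⟨i, hiB, a, ha, Or.inr (Or.inl
        ⟨(h.entry _ hiB _ (by omega) _ ha).2 ⟨_, hi, rfl⟩, hn⟩)⟩)
    · exact hc (Or.inr ⟨i, hiB, y, hy, Or.inr (Or.inr
        ⟨(h.entry _ hiB _ (by omega) _ hy).2 ⟨_, hi, rfl⟩, hn⟩)⟩)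

theorem St.parsed_arr {s : St} {J : RawInput} {L : List (List ℕ)} {f : Arr} {a : ℕ} :
    (s.parsed B J L).arr f a = true ↔ tupleBits B .neg .negLen 0 L f a ∨
      tupleBits B .pos .posLen 0 J.pos f a ∨ tupleBits B .edge .edgeLen 0 J.edges f a ∨
        s.arr f a = true := by
  simp only [St.parsed, St.withConstants, St.setReg, St.put, St.setBits, St.setInp]
  by_cases h1 : tupleBits B .neg .negLen 0 L f a <;>
  by_cases h2 : tupleBits B .pos .posLen 0 J.pos f a <;>
  by_cases h3 : tupleBits B .edge .edgeLen 0 J.edges f a <;> simp [h1, h2, h3]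

/-- The counters and arrays describe an input. -/
structure Represents (B : ℕ) (J : RawInput) (L : List (List ℕ)) (s : St) : Prop where
  idx : s.reg .idx = 0
  one : s.reg .one = 1
  two : s.reg .two = 2
  three : s.reg .three = 3
  nodes : s.reg .nodes = J.nodes
  letters : s.reg .letters = J.letters
  arity : s.reg .arity = J.arity
  numPos : s.reg .numPos = J.pos.length
  numNeg : s.reg .numNeg = L.length
  edge : Listed B (InArr B s.arr) .edge .edgeLen J.edges
  pos : Listed B (InArr B s.arr) .pos .posLen J.pos
  neg : Listed B (InArr B s.arr) .neg .negLen L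

theorem represents_parsed {J : RawInput} {L : List (List ℕ)} (hJ : J.Fits B)
    (hL : BoundedList B L) {A : Arr → ℕ → Bool} (hA : ∀ f a, f.IsCert = false → A f a = false)
    (w : List InputSym) : Represents B J L ((St.base B A w).parsed B J L) := by
  obtain ⟨-, -, -, h1, h2⟩ := hJ
  refine ⟨rfl, rfl, rfl, rfl, rfl, rfl, rfl, rfl, rfl,
    listed_of_tupleBits (by decide) h1 ?_ ?_, listed_of_tupleBits (by decide) h2 ?_ ?_,
    listed_of_tupleBits (by decide) hL ?_ ?_⟩ <;> intro a <;> rw [St.parsed_arr] <;>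
    simp [tupleBits, St.base, hA .edge a rfl, hA .edgeLen a rfl, hA .pos a rfl, hA .posLen a rfl,
      hA .neg a rfl, hA .negLen a rfl]

/-- The input is invalid, or some tuple shows that there is no suitable query. -/
def Refuted (b : Bool) (J : RawInput) (L : List (List ℕ)) : Prop :=
  ¬ (J.Valid ∧ ValidTuples J.nodes J.arity L) ∨ ∃ I : QBEInput, I.toDefInput.raw = J ∧
    rawTuples I.neg = L ∧ ∃ c, I.toDefInput.Forced c ∧
      (b = true → c ∈ I.neg) ∧ (b = false → c ∉ I.pos)

theorem Represents.eval_main_iff {J : RawInput} {L : List (List ℕ)} {s : St}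
    (h : Represents B J L s) (hJ : J.Fits B) (hL : BoundedList B L) (h3 : 3 ≤ B) {b : Bool} :
    (Form.main b).Eval B s.arr s.reg ↔ ¬ (J.Valid ∧ ValidTuples J.nodes J.arity L) ∨
      (Cert B J.nodes J.pos.length J.arity (InArr B s.arr) ∧
        (Form.target b).Eval B s.arr s.reg) := by
  simp only [Form.main, Form.Eval, Form.eval_cert h.idx h.one h.two,
    Form.eval_invalidEdges h.idx h.one h.two h.three, Form.eval_invalidTuples, h.nodes, h.letters,
    h.arity, h.numPos]
  rw [h.edge.invalidEdges_iff hJ.2.2.2.1 (by omega), h.pos.invalidTuples_iff hJ.2.2.2.2,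
    h.neg.invalidTuples_iff hL, RawInput.Valid]
  tauto

/-- An invalid input counts as refuted, so the certificate matters only for numbers that form a
genuine input, where it yields a forced tuple `c`. -/
theorem Represents.refuted {J : RawInput} {L : List (List ℕ)} {s : St} (h : Represents B J L s)
    (hJ : J.Fits B) (hL : BoundedList B L) (h3 : 3 ≤ B) {b : Bool}
    (hs : (Form.main b).Eval B s.arr s.reg) : Refuted b J L := by
  by_cases hv : J.Valid ∧ ValidTuples J.nodes J.arity L
  swap
  · exact Or.inl hv
  rcases (h.eval_main_iff hJ hL h3).1 hs with hn | ⟨hc, ht⟩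
  · exact (hn hv).elim
  obtain ⟨I, rfl⟩ := RawInput.valid_iff.1 hv.1
  obtain ⟨S, rfl⟩ := validTuples_iff.1 hv.2
  obtain ⟨hN, hk, hn, hE, hP⟩ := hJ
  have hE := hE.1
  have hP := hP.1
  simp only [DefInput.raw, rawEdges, rawTuples, List.length_map] at hE hP hN hk hn
  have hc' : Cert B I.nodes I.pos.length I.arity (InArr B s.arr) := by
    have : I.raw.pos.length = I.pos.length := by simp [DefInput.raw, rawTuples]
    rw [this] at hc
    exact hc
  obtain ⟨c, hf, hg⟩ := hc'.exists_forced (by omega) hN hk hn hE hP h.edge h.pos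
  refine Or.inr ⟨⟨I, S⟩, rfl, rfl, c, hf, ?_, ?_⟩
  · rintro rfl
    obtain ⟨i, hi, hi', h1⟩ := Form.eval_target_true.1 ht
    rw [h.numNeg, rawTuples, List.length_map] at hi'
    -- `goal` contains the entries of `c`, and the target places them in the `i`-th negative
    -- example, which has one entry per index.
    have key : S.get ⟨i, hi'⟩ = c := by
      funext j
      have hj : j.1 ≤ B := j.2.le.trans hn
      have hx : (c j).1 ≤ B := (c j).2.le.trans hN
      have h4 := h1 j hj (c j) hx (by rw [h.arity]; exact j.2) (hg j)
      obtain ⟨h5, h6, h7⟩ := (h.neg.tuple_iff hi hj hx).1 h4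
      exact Fin.ext h7
    rw [← key]
    exact S.get_mem _
  · rintro rfl hmem
    obtain ⟨i, rfl⟩ := List.get_of_mem hmem
    have hi : i.1 ≤ B := i.2.le.trans hP
    obtain ⟨j, hj, hj', h1⟩ := Form.eval_target_false.1 ht i hi (by
      rw [h.numPos]; simp [DefInput.raw, rawTuples])
    rw [h.arity] at hj'
    have hx := (I.pos.get i ⟨j, hj'⟩).2.le.trans hN
    exact h1 _ hx ((h.pos.tuple_iff hi hj hx).2 ⟨i.2, hj', rfl⟩) (hg ⟨j, hj'⟩)

open Classical in
/-- The contents of the arrays for given sets of lists. -/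
noncomputable def certArr (B : ℕ) (Q : Arr → Set (List ℕ)) (f : Arr) (a : ℕ) : Bool :=
  decide (f.IsCert = true ∧ ∃ l ∈ Q f, l.length = f.dim ∧ (∀ x ∈ l, x ≤ B) ∧ a = address B 0 l)

theorem certArr_of_not_isCert {Q : Arr → Set (List ℕ)} {f : Arr} (a : ℕ) (hf : f.IsCert = false) :
    certArr B Q f a = false := by
  simp [certArr, hf]

theorem certArr_address {Q : Arr → Set (List ℕ)} {f : Arr} {l : List ℕ} (hf : f.IsCert = true)
    (hl : l.length = f.dim) (hB : ∀ x ∈ l, x ≤ B) :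
    certArr B Q f (address B 0 l) = true ↔ l ∈ Q f := by
  simp only [certArr, hf, true_and, decide_eq_true_eq]
  constructor
  · rintro ⟨m, hm, hm', hmB, h⟩
    rwa [(address_injective (hl.trans hm'.symm) hB hmB h).2]
  · exact fun h => ⟨l, h, hl, hB, rfl⟩

/-- Certificate arrays have at most four indices, so the guessing phase can stop at address `X ^ 4`.
-/
theorem certArr_of_le {Q : Arr → Set (List ℕ)} {X : ℕ} (hX : B + 2 ≤ X) {f : Arr} {a : ℕ}
    (ha : X ^ 4 ≤ a) : certArr B Q f a = false := by
  simp only [certArr, decide_eq_false_iff_not]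
  rintro ⟨-, l, -, hl, hlB, rfl⟩
  have h1 := address_lt hlB 0
  have h2 : f.dim ≤ 4 := by cases f <;> decide
  rw [hl, zero_add, one_mul] at h1
  have h3 : (B + 1) ^ f.dim ≤ X ^ 4 :=
    (Nat.pow_le_pow_left (by omega) _).trans (Nat.pow_le_pow_right (by omega) h2)
  omega

/-- The hypotheses `hB` and `hB'` leave room to number all tuples in `V^k` and all sets of nodes by
values up to `B`. -/
theorem exists_cert_of_refuted {b : Bool} {J : RawInput} {L : List (List ℕ)} (hJ : J.Fits B)
    (hL : BoundedList B L) (hb : b = false → L = []) (h3 : 3 ≤ B)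
    (hB : J.nodes ^ J.pos.length ≤ B) (hB' : 2 ^ J.nodes ≤ B) (h : Refuted b J L)
    (w : List InputSym) : ∃ Q : Arr → Set (List ℕ),
      (Form.main b).Eval B ((St.base B (certArr B Q) w).parsed B J L).arr
        ((St.base B (certArr B Q) w).parsed B J L).reg := by
  rcases h with hn | ⟨I, rfl, rfl, c, ⟨g, hg, rfl⟩, hb1, hb2⟩
  · exact ⟨fun _ => ∅, ((represents_parsed hJ hL (fun f a => certArr_of_not_isCert a)
      w).eval_main_iff hJ hL h3).2 (Or.inl hn)⟩
  · let e := Fintype.equivFin (Fin I.pos.length → Fin I.nodes)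
    let d := Fintype.equivFin (Set (Fin I.nodes))
    let Q := certSet I.graph Fin.val g (fun j => g fun i => I.pos.get i j) (fun f => (e f).1)
      fun S => (d S).1
    refine ⟨Q, ?_⟩
    have hr := represents_parsed hJ hL (fun f a => certArr_of_not_isCert (B := B) (Q := Q) a) w
    set s := (St.base B (certArr B Q) w).parsed B I.raw (rawTuples I.neg) with hs
    have hQ : ∀ f l, f.IsCert = true → l.length = f.dim → (∀ x ∈ l, x ≤ B) →
        (InArr B s.arr f l ↔ l ∈ Q f) := by
      intro f l hf hl hlB
      rw [InArr, hs, St.parsed_arr, ← certArr_address hf hl hlB]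
      simp only [tupleBits]
      cases f <;> simp [Arr.IsCert] at hf <;> simp [St.base]
    obtain ⟨hN, hk, hn, hE, hP⟩ := id hJ
    have hE := hE.1
    have hP := hP.1
    have hL' := hL.1
    simp only [DefInput.raw, rawEdges, rawTuples, List.length_map] at hE hP hN hk hn hB hB' hL'
    have hQ' : ∀ j ≤ B, ∀ x ≤ B, (InArr B s.arr .goal [j, x] ↔ ∃ j' : Fin I.arity, j = j'.1 ∧
        x = (g fun i => I.pos.get i j').1) := by
      intro j hj x hx
      rw [hQ _ _ rfl rfl (by simp [hj, hx])]
      simp [Q, certSet]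
    refine (hr.eval_main_iff hJ hL h3).2 (Or.inr ⟨?_, ?_⟩)
    · have := cert_of_transfers (by omega) hN hk hE hP hg (c := fun f => (e f).1)
        (Fin.val_injective.comp e.injective) (fun f => ?_) (d := fun S => (d S).1)
        (Fin.val_injective.comp d.injective) (fun S => ?_) hQ hr.edge hr.pos
      · have h4 : I.raw.pos.length = I.pos.length := by simp [DefInput.raw, rawTuples]
        rw [h4]
        exact this
      · refine (e f).2.le.trans ?_
        simpa using hB
      · refine (d S).2.le.trans ?_
        simpa using hB'
    · cases b with
      | true =>
        obtain ⟨i, hi⟩ := List.get_of_mem (hb1 rfl)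
        refine Form.eval_target_true.2 ⟨i, i.2.le.trans hL', ?_, fun j hj x hx _ h4 => ?_⟩
        · rw [hr.numNeg]
          simp [rawTuples]
        · obtain ⟨j', rfl, rfl⟩ := (hQ' j hj x hx).1 h4
          refine (hr.neg.tuple_iff (i.2.le.trans hL') hj hx).2 ⟨i.2, j'.2, ?_⟩
          exact congrArg Fin.val (congrFun hi j')
      | false =>
        refine Form.eval_target_false.2 fun i hi hi' => ?_
        rw [hr.numPos] at hi'
        have hi' : i < I.pos.length := by simpa [DefInput.raw, rawTuples] using hi'
        have hne : I.pos.get ⟨i, hi'⟩ ≠ fun j => g fun i => I.pos.get i j := fun h =>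
          hb2 rfl (h ▸ I.pos.get_mem _)
        obtain ⟨j, hj⟩ := Function.ne_iff.1 hne
        refine ⟨j, j.2.le.trans hn, by rw [hr.arity]; exact j.2, fun x hx h4 h5 => hj ?_⟩
        obtain ⟨_, _, rfl⟩ := (hr.pos.tuple_iff hi (j.2.le.trans hn) hx).1 h4
        obtain ⟨j', h6, h7⟩ := (hQ' j (j.2.le.trans hn) _ hx).1 h5
        obtain rfl := Fin.ext h6
        exact Fin.ext h7

/-! ### The complexity of the problems -/

theorem BoundedList.mono {B B' : ℕ} {L : List (List ℕ)} (h : BoundedList B L) (hB : B ≤ B') :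
    BoundedList B' L :=
  ⟨h.1.trans hB, fun t ht => ⟨fun m hm => ((h.2 t ht).1 m hm).trans hB, (h.2 t ht).2.trans hB⟩⟩

theorem length_num (m : ℕ) : (InputSym.num m).length = m + 1 := by
  simp [InputSym.num]

theorem bounds_flatMap_num (t : List ℕ) :
    (∀ m ∈ t, m ≤ (t.flatMap InputSym.num).length) ∧
      t.length ≤ (t.flatMap InputSym.num).length := by
  induction t with
  | nil => simp
  | cons a t ih =>
    obtain ⟨h1, h2⟩ := ih
    simp only [List.flatMap_cons, List.length_append, length_num, List.mem_cons, forall_eq_or_imp,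
      List.length_cons]
    exact ⟨⟨by omega, fun m hm => (h1 m hm).trans (by omega)⟩, by omega⟩

theorem boundedList_length (L : List (List ℕ)) : BoundedList (rawList L).length L := by
  induction L with
  | nil => exact ⟨by simp, by simp⟩
  | cons t L ih =>
    have h : (rawList (t :: L)).length =
        (t.flatMap InputSym.num).length + 1 + (rawList L).length := by
      simp [rawList]
      omega
    obtain ⟨h1, h2⟩ := ih.mono (show _ ≤ (rawList (t :: L)).length by omega)
    refine ⟨?_, ?_⟩
    · have := ih.1
      simp only [List.length_cons]
      omega
    · simp only [List.mem_cons, forall_eq_or_imp]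
      obtain ⟨h3, h4⟩ := bounds_flatMap_num t
      exact ⟨⟨fun m hm => (h3 m hm).trans (by omega), by omega⟩, h2⟩

theorem RawInput.fits_length (J : RawInput) : J.Fits J.encode.length := by
  simp only [encode, List.length_append, length_num]
  exact ⟨by omega, by omega, by omega, (boundedList_length _).mono (by omega),
    (boundedList_length _).mono (by omega)⟩

theorem RawInput.Fits.mono {J : RawInput} {B B' : ℕ} (h : J.Fits B) (hB : B ≤ B') : J.Fits B' :=
  ⟨h.1.trans hB, h.2.1.trans hB, h.2.2.1.trans hB, h.2.2.2.1.mono hB, h.2.2.2.2.mono hB⟩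

theorem boundedList_rawTail {b : Bool} {L : List (List ℕ)} (hb : b = false → L = []) :
    BoundedList (rawTail b L).length L := by
  cases b with
  | true => exact boundedList_length L
  | false => exact ⟨by simp [hb rfl], by simp [hb rfl]⟩

/-- The inputs with no suitable query, and the words that are no inputs. -/
def refutedWords (b : Bool) : Language InputSym :=
  {w | ∀ J L, (b = false → L = []) → w = J.encode ++ rawTail b L → Refuted b J L}

/-- The words for lists of numbers. -/
def wordShape : Bool → RegularExpression InputSym
  | true => inputShape * listShape
  | false => inputShape

theorem mem_wordShape {b : Bool} {w : List InputSym} : w ∈ (wordShape b).matches' ↔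
    ∃ (J : RawInput) (L : _), (b = false → L = []) ∧ w = J.encode ++ rawTail b L := by
  cases b with
  | true => exact (mem_inputShape_mul w).trans (by simp [rawTail])
  | false => exact (mem_inputShape w).trans (by simp [rawTail])

/-- Check that a certificate refutes an input. -/
noncomputable def Prog.check (b : Bool) : Prog :=
  chooseMax * (chooseCert * (parse b * (Form.main b).prog))

theorem St.ready_base (A : Arr → ℕ → Bool) (w : List InputSym) : (St.base B A w).Ready B :=
  ⟨fun _ _ => rfl, rfl, rfl, rfl, rfl, fun _ _ => Nat.zero_le _⟩

/-- By unique decoding, the single reading found by the parser is the only one to be refuted. -/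
theorem mem_refutedWords {b : Bool} {w : List InputSym} {J : RawInput} {L : List (List ℕ)}
    (hb : b = false → L = []) (hw : w = J.encode ++ rawTail b L) (h : Refuted b J L) :
    w ∈ refutedWords b := by
  intro J' L' hb' hw'
  obtain ⟨rfl, h1⟩ := RawInput.encode_append_inj (hw.symm.trans hw')
  obtain rfl : L = L' := by
    cases b with
    | true => exact (rawList_append_inj (r := []) (r' := []) (by simpa [rawTail] using h1)).1
    | false => rw [hb rfl, hb' rfl]
  exact h

theorem Form.ready_parsed {J : RawInput} {L : List (List ℕ)} (hJ : J.Fits B)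
    (hL : BoundedList B L) (h3 : 3 ≤ B) (A : Arr → ℕ → Bool) (w : List InputSym) :
    ((St.base B A w).parsed B J L).Ready B :=
  ((((((((((St.ready_base A w).setReg (by decide) hJ.1).setReg (by decide) hJ.2.1).setReg
    (by decide) hJ.2.2.1).put _ _ (by decide) hJ.2.2.2.1.1).put _ _ (by decide)
      hJ.2.2.2.2.1).put _ _ (by decide) hL.1).setReg (by decide) (by omega)).setReg
        (by decide) (by omega)).setReg (by decide) (by omega))

theorem mem_refutedWords_of_leads {b : Bool} {w : List InputSym} {s' : St}
    (h : Leads Op.Step (Prog.check b) (St.start w) s') : w ∈ refutedWords b := by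
  obtain ⟨s1, h1, h⟩ := leads_mul.1 h
  obtain ⟨B, rfl⟩ := leads_chooseMax h1
  obtain ⟨s2, h2, h⟩ := leads_mul.1 h
  obtain ⟨A, hA, rfl⟩ := leads_chooseCert h2
  obtain ⟨s3, h3, h⟩ := leads_mul.1 h
  obtain ⟨J, L, hJ, hL, hB, hb, hw, rfl⟩ := (does_parse (X := B + 2) le_rfl b
    (St.ready_base A w) (fun _ => rfl) s3).1 h3
  obtain ⟨h4, -⟩ := ((Form.main b).does_prog (X := B + 2) le_rfl (Form.ok_main b)
    (Form.ready_parsed hJ hL hB A w) (fun i _ => rfl) s').1 h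
  exact mem_refutedWords hb hw ((represents_parsed hJ hL hA w).refuted hJ hL hB h4)

/-- An exponent for the time of the check. -/
def checkTime (b : Bool) : ℕ := 6 + (4 * 2 + 5 + (2000 + (Form.main b).time + 1) + 1) + 1

/-- In the bound on `B`, the four summands make room for the tuples in `V^k`, the sets of nodes, the
numbers and lengths in the input, and the constant `3`. -/
theorem reaches_check {b : Bool} {w : List InputSym} (hX : B + 2 ≤ X) {J : RawInput}
    {L : List (List ℕ)} (hb : b = false → L = []) (hw : w = J.encode ++ rawTail b L)
    (h : Refuted b J L) (hB : 2 ^ (w.length * w.length) + 2 ^ w.length + w.length + 3 ≤ B) :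
    ∃ s', Reaches Op.Step (Prog.check b) (X ^ checkTime b) (St.start w) s' := by
  have hX' : 2 ≤ X := by omega
  have hlen : w.length = J.encode.length + (rawTail b L).length := by simp [hw]
  have e1 : 0 < 2 ^ (w.length * w.length) := by positivity
  have e2 : 0 < 2 ^ w.length := by positivity
  have hJw : J.Fits w.length := J.fits_length.mono (by omega)
  have hJ : J.Fits B := hJw.mono (by omega)
  have hL : BoundedList B L := (boundedList_rawTail hb).mono (by omega)
  have h1 : J.nodes ^ J.pos.length ≤ 2 ^ (w.length * w.length) :=
    calc J.nodes ^ J.pos.length ≤ (2 ^ w.length) ^ J.pos.length :=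
          Nat.pow_le_pow_left (hJw.1.trans Nat.lt_two_pow_self.le) _
      _ = 2 ^ (w.length * J.pos.length) := (pow_mul _ _ _).symm
      _ ≤ _ := Nat.pow_le_pow_right (by omega) (Nat.mul_le_mul_left _ hJw.2.2.2.2.1)
  have h2 : 2 ^ J.nodes ≤ 2 ^ w.length := Nat.pow_le_pow_right (by omega) hJw.1
  obtain ⟨Q, hQ⟩ := exists_cert_of_refuted hJ hL hb (by omega) (by omega) (by omega) h w
  refine ⟨(St.base B (certArr B Q) w).parsed B J L, ?_⟩
  have r1 := reaches_chooseMax hX w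
  have r2 := reaches_chooseCert (B := B) hX' w (A := certArr B Q) (c := 4)
    (fun f a => certArr_of_not_isCert a) (fun f a => certArr_of_le hX)
  have r3 := (does_parse hX b (St.ready_base (certArr B Q) w) (fun _ => rfl) _).2
    ⟨J, L, hJ, hL, by omega, hb, hw, rfl⟩
  have r4 := ((Form.main b).does_prog hX (Form.ok_main b)
    (Form.ready_parsed hJ hL (by omega) (certArr B Q) w) (fun i _ => rfl) _).2 ⟨hQ, rfl⟩
  refine (r1.mul (r2.mul (r3.mul r4))).mono ?_
  exact (Nat.add_le_add_left ((Nat.add_le_add_left (pow_add_pow_le_pow hX' _ _) _).trans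
    (pow_add_pow_le_pow hX' _ _)) _).trans (pow_add_pow_le_pow hX' _ _)

/-! ### Words of the wrong shape and the time bound -/

theorem exec_read {l : List InputSym} {s s' : St} (h : s.inp = l ++ s'.inp)
    (h' : s' = s.setInp s'.inp) : Exec Op.Step (l.map Op.read) s s' := by
  induction l generalizing s with
  | nil =>
    have h : s.inp = s'.inp := h
    rw [h', ← h]
    rfl
  | cons a l ih => exact ⟨s.setInp (l ++ s'.inp), ⟨_, h, rfl⟩, ih rfl h'⟩

theorem inp_eq_of_exec_read {l : List InputSym} {s s' : St}
    (h : Exec Op.Step (l.map Op.read) s s') : s.inp = l ++ s'.inp := by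
  induction l generalizing s with
  | nil =>
    obtain rfl : s = s' := h
    rfl
  | cons a l ih =>
    obtain ⟨_, ⟨r, h1, rfl⟩, h2⟩ := h
    rw [h1, List.cons_append, ← ih h2]

/-- The words of operations that show that an input is refuted or that a word is no input. -/
noncomputable def refutations (b : Bool) : Language Op :=
  (Prog.check b).matches' + Language.map Op.read (wordShape b).matches'ᶜ * {[Op.eof]}

theorem isRegular_refutations (b : Bool) : (refutations b).IsRegular :=
  (RegularExpression.isRegular_matches' _).add
    (((RegularExpression.isRegular_matches' _).compl.map fun _ _ h => Op.read.inj h).mul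
      (Language.isRegular_of_finite (Set.finite_singleton _)))

/-- A word of the right shape is handled by guessing and checking a certificate. Any other word lies
in the complement of a regular language, so reading it to the end suffices. The polynomial arises
from the base `X = 2 ^ M` with `M = ℓ² + ℓ + 4`, which exceeds the chosen `B`, and the constant
exponent `checkTime b`; one more factor `X` absorbs the marking step. -/
theorem refutedWords_mem_NEXP (b : Bool) : refutedWords b ∈ NEXP InputSym := by
  refine mem_NEXP_of_isRegular (isRegular_refutations b)
    (Polynomial.C (checkTime b + 1) * (Polynomial.X ^ 2 + Polynomial.X + 4)) ?_ ?_
  · rintro w l (hl | hl) s' hs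
    · exact mem_refutedWords_of_leads ⟨l, hl, hs⟩
    · obtain ⟨_, ⟨v, hv, rfl⟩, _, rfl, rfl⟩ := hl
      obtain ⟨u, h1, h2⟩ := exec_append.1 hs
      -- The final `eof` ensures that `v` is the whole input and not just a prefix.
      obtain ⟨_, ⟨h3, -⟩, -⟩ := h2
      have h4 : w = v := by simpa [h3, St.start] using inp_eq_of_exec_read h1
      intro J L hb hw
      exact (hv (mem_wordShape.2 ⟨J, L, hb, h4 ▸ hw⟩)).elim
  · intro w hw
    have heval : (Polynomial.C (checkTime b + 1) * (Polynomial.X ^ 2 + Polynomial.X + 4)).eval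
        w.length = (w.length * w.length + w.length + 4) * (checkTime b + 1) := by
      simp
      ring
    rw [heval]
    set M := w.length * w.length + w.length + 4 with hM
    by_cases h : w ∈ (wordShape b).matches'
    · obtain ⟨J, L, hb, hJ⟩ := mem_wordShape.1 h
      set B := 2 ^ (w.length * w.length) + 2 ^ w.length + w.length + 3 with hB
      have hX : B + 2 ≤ 2 ^ M := by
        have h1 : 2 ^ (w.length * w.length) ≤ 2 ^ (w.length * w.length + w.length) :=
          Nat.pow_le_pow_right (by omega) (by omega)
        have h2 : 2 ^ w.length ≤ 2 ^ (w.length * w.length + w.length) :=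
          Nat.pow_le_pow_right (by omega) (by omega)
        have h3 : w.length < 2 ^ w.length := Nat.lt_two_pow_self
        have h4 : 1 ≤ 2 ^ w.length := Nat.one_le_two_pow
        rw [hM, pow_add]
        omega
      obtain ⟨s', l, hl, hlen, hs⟩ := reaches_check hX hb hJ (hw J L hb hJ) le_rfl
      refine ⟨l, Or.inl hl, ?_, s', hs⟩
      rw [pow_mul, pow_succ]
      have h1 : 1 ≤ (2 ^ M) ^ checkTime b := Nat.one_le_pow _ _ (by positivity)
      have h2 : 2 ≤ 2 ^ M := (Nat.le_add_left 2 B).trans hX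
      nlinarith
    · refine ⟨w.map Op.read ++ [Op.eof], Or.inr ⟨_, ⟨w, h, rfl⟩, _, rfl, rfl⟩, ?_,
        (St.start w).setInp [], exec_append.2 ⟨_, exec_read (s' := (St.start w).setInp [])
          (by simp [St.setInp, St.start]) rfl, _, ⟨rfl, rfl⟩, rfl⟩⟩
      have h1 : w.length + 2 < 2 ^ (w.length + 2) := Nat.lt_two_pow_self
      have h2 : 2 ^ (w.length + 2) ≤ 2 ^ (M * (checkTime b + 1)) :=
        Nat.pow_le_pow_right (by omega) (by rw [hM]; nlinarith)
      simp
      omega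

/-! ### The complements of the two problems -/

theorem rawTuples_injective {N n : ℕ} :
    Function.Injective (rawTuples : List (Fin n → Fin N) → List (List ℕ)) := by
  refine List.map_injective_iff.2 fun t t' h => ?_
  funext j
  exact Fin.ext (congrFun (List.ofFn_injective h) j)

theorem rawEdges_injective {N k : ℕ} :
    Function.Injective (rawEdges : List (Fin N × Fin k × Fin N) → List (List ℕ)) := by
  refine List.map_injective_iff.2 fun e e' h => ?_
  simp only [List.cons.injEq, and_true] at h
  exact Prod.ext (Fin.ext h.1) (Prod.ext (Fin.ext h.2.1) (Fin.ext h.2.2))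

theorem DefInput.raw_injective : Function.Injective DefInput.raw := by
  rintro ⟨N, k, n, E, S⟩ ⟨N', k', n', E', S'⟩ h
  simp only [DefInput.raw, RawInput.mk.injEq] at h
  obtain ⟨rfl, rfl, rfl, hE, hS⟩ := h
  rw [rawEdges_injective hE, rawTuples_injective hS]

/-- A word outside the problem encodes an unexplainable input or no input at all; in the latter case
each of its readings, if there are any, is invalid. Conversely, injectivity of the raw form
identifies the refuted input with the encoded one. -/
theorem compl_crpqQueryByExample : crpqQueryByExampleᶜ = refutedWords true := by
  ext w
  constructor
  · intro hw J L _ h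
    by_cases hv : J.Valid ∧ ValidTuples J.nodes J.arity L
    · obtain ⟨I, rfl⟩ := RawInput.valid_iff.1 hv.1
      obtain ⟨S, rfl⟩ := validTuples_iff.1 hv.2
      have : ¬ QBEInput.Explainable ⟨I, S⟩ := fun he =>
        hw ⟨_, he, (QBEInput.encode_eq _).trans h.symm⟩
      rw [QBEInput.explainable_iff] at this
      push Not at this
      obtain ⟨c, hc, hf⟩ := this
      exact Or.inr ⟨⟨I, S⟩, rfl, rfl, c, hf, fun _ => hc, by simp⟩
    · exact Or.inl hv
  · rintro hw ⟨I, hI, rfl⟩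
    rcases hw I.raw (rawTuples I.neg) (by simp) I.encode_eq with
      hn | ⟨⟨I', S'⟩, h1, h2, c, hf, h3, -⟩
    · exact hn ⟨RawInput.valid_iff.2 ⟨_, rfl⟩, validTuples_iff.2 ⟨_, rfl⟩⟩
    · obtain ⟨I, S⟩ := I
      obtain rfl := DefInput.raw_injective h1
      obtain rfl := rawTuples_injective h2
      exact (QBEInput.explainable_iff _).1 hI c (h3 rfl) hf

/-- A definability input is treated as a query-by-example input with an empty list of negative
examples; the target now demands a forced tuple that is not a positive example. -/
theorem compl_crpqDefinability : crpqDefinabilityᶜ = refutedWords false := by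
  ext w
  constructor
  · intro hw J L hL h
    obtain rfl := hL rfl
    have h : w = J.encode := by simpa [rawTail] using h
    by_cases hv : J.Valid
    · obtain ⟨I, rfl⟩ := RawInput.valid_iff.1 hv
      have : ¬ I.Definable := fun he => hw ⟨_, he, I.encode_eq.trans h.symm⟩
      rw [DefInput.definable_iff] at this
      push Not at this
      obtain ⟨c, hf, hc⟩ := this
      exact Or.inr ⟨⟨I, []⟩, rfl, rfl, c, hf, by simp, fun _ => hc⟩
    · exact Or.inl fun h => hv h.1
  · rintro hw ⟨I, hI, rfl⟩
    rcases hw I.raw [] (by simp) (by simpa [rawTail] using I.encode_eq) with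
      hn | ⟨⟨I', S'⟩, h1, -, c, hf, -, h3⟩
    · exact hn ⟨RawInput.valid_iff.2 ⟨_, rfl⟩, by simp [ValidTuples]⟩
    · obtain rfl := DefInput.raw_injective h1
      exact h3 rfl (I'.definable_iff.1 hI c hf)

theorem theorem11 :
    crpqQueryByExample ∈ coNEXP InputSym ∧ crpqDefinability ∈ coNEXP InputSym := by
  constructor
  · change crpqQueryByExampleᶜ ∈ NEXP InputSym
    rw [compl_crpqQueryByExample]
    exact refutedWords_mem_NEXP true
  · change crpqDefinabilityᶜ ∈ NEXP InputSym
    rw [compl_crpqDefinability]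
    exact refutedWords_mem_NEXP false
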